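/- Fix integers $d\ge 1$ and $M\ge 0$. For $R\ge 1$ let $B_R\subset\mathbb R^d$ be the open ball of radius $R$ centred at the origin and $|B_R|$ its volume. Let $K,C:\mathbb R^d\times\mathbb R^d\to\mathbb R$ be covariance kernels (symmetric and positive semidefinite), both infinitely differentiable; assume that all derivatives $K_{\alpha\beta}:=\partial_x^\alpha\partial_y^\beta K$ are bounded on $\mathbb R^d\times\mathbb R^d$, say $|K_{\alpha\beta}|\le b_{\alpha\beta}$ for all multi-indices $\alpha,\beta$. Put $C_{\alpha\beta}:=\partial_x^\alpha\partial_y^\beta C$ and $$\eta=\eta(M,R):=\max_{|\alpha|\le M,\ |\beta|\le M}\ \sup_{x,y\in B_R}|K_{\alpha\beta}(x,y)-C_{\alpha\beta}(x,y)|.$$ Then there are constants $A,A'\in(0,\infty)$, depending only on $M$, $d$ and the bounds $(b_{\alpha\beta})$ (in particular neither on $C$ nor on $R$), such that for every $R\ge 1$ there exists, on some probability space, a centred two-dimensional (jointly) Gaussian field $\{(X_0(z),Y_0(z)):z\in B_R\}$ with infinitely differentiable sample paths, such that $X_0$ has covariance $K$, $Y_0$ has covariance $C$, and $$\mathbb E\big[\|X_0-Y_0\|^2_{W^{M,2}(B_R)}\big]\le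 A\Big\{\eta\,|B_R|+\sqrt{\eta}\,|B_R|^{1/2}R^{\frac{3d+1}{2}}\Big\}.$$ If moreover $M>j:=\lfloor d/2\rfloor+1$, then the same field also satisfies $$\mathbb E\big[\|X_0-Y_0\|^2_{C_b^{M-j}(B_R)}\big]\le A'\,R^{2M-d}\Big\{\eta\,|B_R|+\sqrt{\eta}\,|B_R|^{1/2}R^{\frac{3d+1}{2}}\Big\}.$$ Here $\|u\|^2_{W^{M,2}(B_R)}=\sum_{|\alpha|\le M}\int_{B_R}|\partial^\alpha u(x)|^2\,dx$; the space $C_b^{k}(B_R)$ consists of the functions on $B_R$ whose partial derivatives of order at most $k$ exist and are uniformly continuous on $B_R$, with $\|u\|_{C_b^k(B_R)}=\max_{|\alpha|\le k}\sup_{B_R}|\partial^\alpha u|$. Both norms are understood to be $+\infty$ outside the corresponding space. -/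

import Mathlib

open MeasureTheory ProbabilityTheory
open scoped ENNReal NNReal ContDiff

noncomputable section

namespace GaussCoupling

/-- `ℝ^d` with its Euclidean norm. -/
abbrev E (d : ℕ) : Type := EuclideanSpace ℝ (Fin d)

/-- Multi-indices in `d` variables. -/
abbrev MIdx (d : ℕ) : Type := Fin d → ℕ

/-- The length `|α| = α_1 + ⋯ + α_d` of a multi-index. -/
def MIdx.length {d : ℕ} (α : MIdx d) : ℕ := ∑ i, α i

/-- `S(M)`: the finite set of multi-indices of length at most `M`. -/
def multiIndices (d M : ℕ) : Finset (MIdx d) :=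
  (Fintype.piFinset fun _ => Finset.range (M + 1)).filter fun α => α.length ≤ M

theorem mem_multiIndices {d M : ℕ} {α : MIdx d} :
    α ∈ multiIndices d M ↔ α.length ≤ M := by
  refine ⟨fun h => (Finset.mem_filter.1 h).2, fun h => Finset.mem_filter.2 ⟨?_, h⟩⟩
  refine Fintype.mem_piFinset.2 fun i => Finset.mem_range.2 ?_
  have h1 : α i ≤ α.length :=
    Finset.single_le_sum (f := α) (fun _ _ => Nat.zero_le _) (Finset.mem_univ i)
  omega

/-- The partial derivative `∂_i f`. -/
def partialDeriv {d : ℕ} (i : Fin d) (f : E d → ℝ) : E d → ℝ :=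
  fun x => fderiv ℝ f x (EuclideanSpace.single i 1)

/-- The iterated partial derivative `∂^α f = ∂_1^{α_1} ⋯ ∂_d^{α_d} f`. It is only ever applied to
functions that are smooth on an open set, and evaluated at points of that open set, so that the
order of differentiation and the values of `f` elsewhere do not matter. -/
def multiDeriv {d : ℕ} (α : MIdx d) (f : E d → ℝ) : E d → ℝ :=
  (List.finRange d).foldr (fun i g => (partialDeriv i)^[α i] g) f

/-- `K_{αβ}(x, y) = ∂_x^α ∂_y^β K(x, y)`. -/
def mixedDeriv {d : ℕ} (α β : MIdx d) (K : E d → E d → ℝ) (x y : E d) : ℝ :=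
  multiDeriv α (fun x' => multiDeriv β (fun y' => K x' y') y) x

/-- A real-valued covariance kernel: a symmetric, positive semidefinite function of two
variables, i.e. `∑_{x,y} c_x c_y K(x,y) ≥ 0` for all finitely supported real families `c`. -/
def IsCovKernel {d : ℕ} (K : E d → E d → ℝ) : Prop := (Matrix.of K).PosSemidef

/-- Class `C^{∞,∞}`: all derivatives in `(x, y)` exist and are continuous. -/
def SmoothKernel {d : ℕ} (K : E d → E d → ℝ) : Prop :=
  ContDiff ℝ ∞ (fun p : E d × E d => K p.1 p.2)

/-- `η(M, R)`: the supremum over `x, y ∈ B_R` and `α, β ∈ S(M)` of `|K_{αβ}(x,y) - C_{αβ}(x,y)|`,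
with values in `[0, ∞]`. -/
def eta {d : ℕ} (K C : E d → E d → ℝ) (M : ℕ) (R : ℝ) : ℝ≥0∞ :=
  ⨆ α ∈ multiIndices d M, ⨆ β ∈ multiIndices d M,
    ⨆ x ∈ Metric.ball (0 : E d) R, ⨆ y ∈ Metric.ball (0 : E d) R,
      ‖mixedDeriv α β K x y - mixedDeriv α β C x y‖ₑ

/-- `v` is the weak derivative of order `α` of `u` on the open set `U`. -/
structure HasWeakDeriv {d : ℕ} (U : Set (E d)) (α : MIdx d) (u v : E d → ℝ) : Prop where
  locallyIntegrable : LocallyIntegrableOn u U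
  locallyIntegrable_deriv : LocallyIntegrableOn v U
  integral_eq : ∀ φ : E d → ℝ, ContDiff ℝ ∞ φ → HasCompactSupport φ → tsupport φ ⊆ U →
    ∫ x in U, u x * multiDeriv α φ x = (-1) ^ α.length * ∫ x in U, v x * φ x

/-- The norm `‖u‖_{W^{k,2}(U)} = (∑_{|α| ≤ k} ‖∂^α u‖²_{L²(U)})^{1/2}`, where `∂^α u` are the weak
derivatives. It is `∞` if `u` does not belong to `W^{k,2}(U)`. As weak derivatives are unique almost
everywhere on `U`, the infimum has at most one distinct term. -/
def sobolevNorm {d : ℕ} (U : Set (E d)) (k : ℕ) (u : E d → ℝ) : ℝ≥0∞ :=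
  ⨅ (v : MIdx d → E d → ℝ) (_ : ∀ α ∈ multiIndices d k, HasWeakDeriv U α u (v α)),
    (∑ α ∈ multiIndices d k, eLpNorm (v α) 2 (volume.restrict U) ^ 2) ^ (1 / 2 : ℝ)

/-- Membership in `C_b^k(U)`: `u` is `k` times continuously differentiable on the open set `U` and
its partial derivatives of order at most `k` are bounded and uniformly continuous on `U`. -/
structure MemCb {d : ℕ} (U : Set (E d)) (k : ℕ) (u : E d → ℝ) : Prop where
  contDiffOn : ContDiffOn ℝ k u U
  uniformContinuousOn : ∀ α ∈ multiIndices d k, UniformContinuousOn (multiDeriv α u) U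
  bounded : ∀ α ∈ multiIndices d k, ∃ c : ℝ, ∀ x ∈ U, |multiDeriv α u x| ≤ c

/-- The norm `‖u‖_{C_b^k(U)} = max_{|α| ≤ k} sup_U |∂^α u|`. It is `∞` if `u` does not belong to
`C_b^k(U)`. -/
def cbNorm {d : ℕ} (U : Set (E d)) (k : ℕ) (u : E d → ℝ) : ℝ≥0∞ :=
  ⨅ (_ : MemCb U k u), ⨆ α ∈ multiIndices d k, ⨆ x ∈ U, ‖multiDeriv α u x‖ₑ

/-- `{(X(z), Y(z)) : z ∈ B_R}` is a centred two-dimensional Gaussian field on the probability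
space `(Ω, P)`, with smooth sample paths on `B_R`, such that `X` has covariance `K` and `Y` has
covariance `C`. The values of `X` and `Y` outside `B_R` are irrelevant. -/
structure IsGaussianCoupling {d : ℕ} (K C : E d → E d → ℝ) (R : ℝ)
    {Ω : Type} [MeasurableSpace Ω] (P : Measure Ω) (X Y : E d → Ω → ℝ) : Prop where
  measurable_left : ∀ z ∈ Metric.ball (0 : E d) R, Measurable (X z)
  measurable_right : ∀ z ∈ Metric.ball (0 : E d) R, Measurable (Y z)
  smooth_left : ∀ w, ContDiffOn ℝ ∞ (fun z => X z w) (Metric.ball (0 : E d) R)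
  smooth_right : ∀ w, ContDiffOn ℝ ∞ (fun z => Y z w) (Metric.ball (0 : E d) R)
  gaussian : IsGaussianProcess
    (fun (z : Metric.ball (0 : E d) R) (w : Ω) => (X z.1 w, Y z.1 w)) P
  centred_left : ∀ z ∈ Metric.ball (0 : E d) R, ∫ w, X z w ∂P = 0
  centred_right : ∀ z ∈ Metric.ball (0 : E d) R, ∫ w, Y z w ∂P = 0
  cov_left : ∀ x ∈ Metric.ball (0 : E d) R, ∀ y ∈ Metric.ball (0 : E d) R,
    cov[X x, X y; P] = K x y
  cov_right : ∀ x ∈ Metric.ball (0 : E d) R, ∀ y ∈ Metric.ball (0 : E d) R,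
    cov[Y x, Y y; P] = C x y

/-- The quantity `η |B_R| + √η |B_R|^{1/2} R^{(3d+1)/2}`. -/
def couplingRate {d : ℕ} (K C : E d → E d → ℝ) (M : ℕ) (R : ℝ) : ℝ≥0∞ :=
  eta K C M R * volume (Metric.ball (0 : E d) R) +
    eta K C M R ^ (1 / 2 : ℝ) * volume (Metric.ball (0 : E d) R) ^ (1 / 2 : ℝ) *
      ENNReal.ofReal (R ^ ((3 * (d : ℝ) + 1) / 2))

end GaussCoupling

end

/-! A smooth covariance kernel is the Gram kernel of a smooth feature map `φ` into a Hilbert space,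
and a Gaussian field with that covariance is `X(x) = ∑ ξ_i ⟪φ x, e_i⟫` with independent standard
Gaussian `ξ_i`. If `K` and `C` are realised by `φ` and `ψ` in one common Hilbert space and the same
`ξ_i` drive both series, then `(X, Y)` is jointly Gaussian and `E|∂^α(X - Y)(x)|² = ‖∂^α φ x - ∂^α ψ
x‖²`. It therefore suffices to embed two feature maps isometrically into one space so that their
jets are close in `L²(B_R)` (`exists_close_features`, `exists_gaussian_field`).

View the jets of order `M` as functions `Φ`, `Ψ` on `S(M) × B_R`, a space of mass `V = |S(M)|
|B_R|`. Their Gram kernels differ by at most `η`. For `n` orthonormal functions in `L²`, the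
coefficient vectors of `Φ` and `Ψ` have Gram matrices that differ by at most `ηV` as quadratic
forms. The Powers–Størmer inequality (`exists_gram_coupling`) realises them at total squared
distance at most `nηV`, and the orthogonal complements of the two spans are sent to separate
summands (`exists_isometry_pair`). If the `n` functions approximate `Φ` with squared error `τ`, the
residual of `Ψ` is small too, because the total and the captured energies of `Φ` and `Ψ` are close.
The cost is `4τ + 2ηV + 3nηV` (`exists_coupling_of_orthonormal`). Only `Φ` has to be approximated,
so only derivative bounds on `K` enter.

The approximating functions are Taylor monomials of degree less than `d`, localised to cubes of side
`h`. There are of order `(R/h)^d` of them, and the pointwise squared error is of order `h^(2d)`. The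
choice `h^d = √η` gives the terms `η|B_R|` and `√η R^d |B_R|`, and the second is a multiple of `√η
|B_R|^(1/2) R^(3d/2)`.

The bound in `C_b^(M-j)` follows from the Sobolev bound by Sobolev's inequality on `B_R` with an
explicit power of `R` (`exists_sobolev_const`). The same inequality makes the random series converge
with all derivatives. -/

noncomputable section

namespace GaussCoupling

/-! ### Jets of smooth vector-valued functions and Taylor's formula -/

section

variable {F : Type*} [NormedAddCommGroup F] [NormedSpace ℝ F]

/-- The partial derivative `∂_i f` of a vector-valued function. -/
def vecPartial {d : ℕ} (i : Fin d) (f : E d → F) : E d → F :=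
  fun x => fderiv ℝ f x (EuclideanSpace.single i 1)

/-- The iterated partial derivative `∂^α f` of a vector-valued function. -/
def vecDeriv {d : ℕ} (α : MIdx d) (f : E d → F) : E d → F :=
  (List.finRange d).foldr (fun i g => (vecPartial i)^[α i] g) f

theorem vecDeriv_real {d : ℕ} (α : MIdx d) (f : E d → ℝ) : vecDeriv α f = multiDeriv α f := rfl

/-- A family of functions indexed by multi-indices in which `J (α + e_i)` is the continuous partial
derivative `∂_i (J α)`. -/
def IsJet {d : ℕ} (J : MIdx d → E d → F) : Prop :=
  ∀ α x, HasFDerivAt (J α)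
    (∑ i, (EuclideanSpace.proj i : E d →L[ℝ] ℝ).smulRight (J (α + Pi.single i 1) x)) x

theorem vecPartial_contDiff {d : ℕ} (i : Fin d) {f : E d → F} (hf : ContDiff ℝ ∞ f) :
    ContDiff ℝ ∞ (vecPartial i f) :=
  (hf.fderiv_right (m := ∞) (by simp)).clm_apply contDiff_const

theorem vecPartial_iterate_contDiff {d : ℕ} (i : Fin d) (n : ℕ) {f : E d → F}
    (hf : ContDiff ℝ ∞ f) : ContDiff ℝ ∞ ((vecPartial i)^[n] f) := by
  induction n with
  | zero => exact hf
  | succ n ih => rw [Function.iterate_succ_apply']; exact vecPartial_contDiff i ih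

theorem foldr_contDiff {d : ℕ} (α : MIdx d) (l : List (Fin d)) {f : E d → F}
    (hf : ContDiff ℝ ∞ f) :
    ContDiff ℝ ∞ (l.foldr (fun i g => (vecPartial i)^[α i] g) f) := by
  induction l with
  | nil => exact hf
  | cons i l ih => exact vecPartial_iterate_contDiff i _ ih

theorem vecDeriv_contDiff {d : ℕ} (α : MIdx d) {f : E d → F} (hf : ContDiff ℝ ∞ f) :
    ContDiff ℝ ∞ (vecDeriv α f) := foldr_contDiff α _ hf

theorem vecPartial_comm {d : ℕ} (i j : Fin d) {f : E d → F} (hf : ContDiff ℝ ∞ f) :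
    vecPartial i (vecPartial j f) = vecPartial j (vecPartial i f) := by
  funext x
  have h2 : DifferentiableAt ℝ (fderiv ℝ f) x :=
    ((hf.fderiv_right (m := ∞) (by simp)).differentiable (by simp)).differentiableAt
  have hs : IsSymmSndFDerivAt ℝ f x := by
    refine (hf.contDiffAt (x := x)).isSymmSndFDerivAt ?_
    rw [minSmoothness_of_isRCLikeNormedField]
    exact WithTop.coe_le_coe.2 (le_top : (2 : ℕ∞) ≤ ⊤)
  have key : ∀ v w : E d, fderiv ℝ (fun y => fderiv ℝ f y v) x w = fderiv ℝ (fderiv ℝ f) x w v := by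
    intro v w
    rw [fderiv_clm_apply h2 (differentiableAt_const _)]
    simp
  exact (key _ _).trans ((hs.eq _ _).trans (key _ _).symm)

theorem vecPartial_iterate_comm {d : ℕ} (i j : Fin d) (n : ℕ) {f : E d → F}
    (hf : ContDiff ℝ ∞ f) :
    vecPartial i ((vecPartial j)^[n] f) = (vecPartial j)^[n] (vecPartial i f) := by
  induction n with
  | zero => rfl
  | succ n ih =>
    rw [Function.iterate_succ_apply', Function.iterate_succ_apply', ← ih,
      vecPartial_comm i j (vecPartial_iterate_contDiff j n hf)]

/-- The additional `∂_j` commutes past the factors in front of it. `Nodup` ensures that the index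
`j` is met only once. -/
theorem foldr_add_single {d : ℕ} (α : MIdx d) (j : Fin d) (l : List (Fin d)) (hl : l.Nodup)
    {f : E d → F} (hf : ContDiff ℝ ∞ f) :
    l.foldr (fun i g => (vecPartial i)^[(α + Pi.single j 1 : MIdx d) i] g) f =
      if j ∈ l then vecPartial j (l.foldr (fun i g => (vecPartial i)^[α i] g) f)
      else l.foldr (fun i g => (vecPartial i)^[α i] g) f := by
  induction l with
  | nil => simp
  | cons i l ih =>
    have hn := List.nodup_cons.1 hl
    simp only [List.foldr_cons]
    rw [ih hn.2]
    by_cases hij : j = i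
    · subst hij
      simp [hn.1, Function.iterate_succ_apply']
    · have : (α + Pi.single j 1 : MIdx d) i = α i := by simp [Ne.symm hij]
      rw [this]
      by_cases hjl : j ∈ l
      · simp [hjl, vecPartial_iterate_comm j i _ (foldr_contDiff α l hf)]
      · simp [hjl, hij]

theorem vecDeriv_add_single {d : ℕ} (α : MIdx d) (j : Fin d) {f : E d → F}
    (hf : ContDiff ℝ ∞ f) :
    vecDeriv (α + Pi.single j 1) f = vecPartial j (vecDeriv α f) := by
  unfold vecDeriv
  rw [foldr_add_single α j _ (List.nodup_finRange d) hf]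
  simp

@[simp] theorem vecDeriv_zero {d : ℕ} (f : E d → F) : vecDeriv (0 : MIdx d) f = f := by
  unfold vecDeriv
  induction List.finRange d with
  | nil => rfl
  | cons i l ih => simp

/-- A linear map on `ℝ^d` is determined by its values on the standard basis. -/
theorem clm_eq_sum {d : ℕ} (L : E d →L[ℝ] F) :
    L = ∑ i, (EuclideanSpace.proj i : E d →L[ℝ] ℝ).smulRight (L (EuclideanSpace.single i 1)) := by
  ext v
  have hv : v = ∑ i, v i • EuclideanSpace.single i (1 : ℝ) := by
    ext j
    simp [Finset.sum_apply, Pi.single_apply]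
  conv_lhs => rw [hv]
  simp

theorem isJet_vecDeriv {d : ℕ} {f : E d → F} (hf : ContDiff ℝ ∞ f) :
    IsJet (fun α => vecDeriv α f) := by
  intro α x
  have h := ((vecDeriv_contDiff α hf).differentiable (by simp) x).hasFDerivAt
  rw [clm_eq_sum (fderiv ℝ (vecDeriv α f) x)] at h
  refine h.congr_fderiv (Finset.sum_congr rfl fun i _ => ?_)
  simp only [vecDeriv_add_single α i hf, vecPartial]

theorem IsJet.contDiff {d : ℕ} {J : MIdx d → E d → F} (hJ : IsJet J) (α : MIdx d) :
    ContDiff ℝ ∞ (J α) := by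
  rw [contDiff_infty]
  intro n
  induction n generalizing α with
  | zero => 
    rw [Nat.cast_zero, contDiff_zero]
    exact continuous_iff_continuousAt.2 fun x => (hJ α x).continuousAt
  | succ n ih =>
    rw [Nat.cast_add, Nat.cast_one, contDiff_succ_iff_hasFDerivAt (n := (n : ℕ))]
    refine ⟨_, ?_, hJ α⟩
    refine ContDiff.sum fun i _ => ?_
    exact ContDiff.comp (g := ContinuousLinearMap.smulRightL ℝ (E d) F (EuclideanSpace.proj i))
      (ContinuousLinearMap.contDiff _) (ih _)

theorem IsJet.vecPartial_eq {d : ℕ} {J : MIdx d → E d → F} (hJ : IsJet J) (α : MIdx d)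
    (i : Fin d) : vecPartial i (J α) = J (α + Pi.single i 1) := by
  funext x
  rw [vecPartial, (hJ α x).fderiv]
  simp

/-- A jet is determined by its member of order zero. Iterated derivatives can thus be computed by
exhibiting a candidate family, as is done below for linear images, finite sums and series. -/
theorem IsJet.vecDeriv_eq {d : ℕ} {J : MIdx d → E d → F} (hJ : IsJet J) (α : MIdx d) :
    vecDeriv α (J 0) = J α := by
  suffices H : ∀ n (α : MIdx d), ∑ i, α i = n → vecDeriv α (J 0) = J α from H _ α rfl
  intro n
  induction n with
  | zero =>
    intro α h
    have : α = 0 := by funext i; simpa using (Finset.sum_eq_zero_iff.1 h) i (Finset.mem_univ i)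
    simp [this]
  | succ n ih =>
    intro α h
    obtain ⟨i, hi⟩ : ∃ i, α i ≠ 0 := by
      by_contra! hc
      simp [hc] at h
    have hα : α = (α - Pi.single i 1) + Pi.single i 1 := by
      funext j
      by_cases hj : j = i
      · subst hj; simp; omega
      · simp [hj]
    have hs : ∑ j, (α - Pi.single i 1 : MIdx d) j = n := by
      have := congrArg (fun β : MIdx d => ∑ j, β j) hα
      simp only [Pi.add_apply, Finset.sum_add_distrib, Finset.sum_pi_single', Finset.mem_univ,
        if_true] at this
      omega
    rw [hα, vecDeriv_add_single _ _ (hJ.contDiff 0), ih _ hs, hJ.vecPartial_eq]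

theorem vecDeriv_clm {d : ℕ} {G : Type*} [NormedAddCommGroup G] [NormedSpace ℝ G] (L : F →L[ℝ] G)
    {f : E d → F} (hf : ContDiff ℝ ∞ f) (α : MIdx d) :
    vecDeriv α (fun x => L (f x)) = fun x => L (vecDeriv α f x) := by
  have hJ : IsJet (fun α x => L (vecDeriv α f x)) := by
    intro α x
    have h := L.hasFDerivAt.comp x (isJet_vecDeriv hf α x)
    refine h.congr_fderiv ?_
    ext v
    simp
  simpa using hJ.vecDeriv_eq α

/-- The `k`-th derivative of `t ↦ J α (z + t v)` for a jet `J`. -/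
def lineJet {d : ℕ} (J : MIdx d → E d → F) (α : MIdx d) (z v : E d) (k : ℕ) (t : ℝ) : F :=
  ∑ I : Fin k → Fin d, (∏ j, v (I j)) • J (α + ∑ j, Pi.single (I j) 1) (z + t • v)

/-- One more derivative prepends a letter to the word `I`. Summing over words instead of
multi-indices avoids multinomial coefficients. -/
theorem IsJet.hasDerivAt_lineJet {d : ℕ} {J : MIdx d → E d → F} (hJ : IsJet J) (α : MIdx d)
    (z v : E d) (k : ℕ) (t : ℝ) :
    HasDerivAt (lineJet J α z v k) (lineJet J α z v (k + 1) t) t := by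
  have hline : HasDerivAt (fun t : ℝ => z + t • v) v t := by
    simpa using ((hasDerivAt_id t).smul_const v).const_add z
  have h : HasDerivAt (lineJet J α z v k) (∑ I : Fin k → Fin d, (∏ j, v (I j)) •
      ∑ i, v i • J (α + ∑ j, Pi.single (I j) 1 + Pi.single i 1) (z + t • v)) t := by
    refine HasDerivAt.fun_sum fun I _ => HasDerivAt.const_smul _ ?_
    have := (hJ (α + ∑ j, Pi.single (I j) 1) (z + t • v)).comp_hasDerivAt t hline
    simpa [Function.comp_def] using this
  convert h using 1
  unfold lineJet
  rw [← (Fin.consEquiv (fun _ : Fin (k + 1) => Fin d)).sum_comp, Fintype.sum_prod_type,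
    Finset.sum_comm]
  refine Finset.sum_congr rfl fun I _ => ?_
  rw [Finset.smul_sum]
  refine Finset.sum_congr rfl fun i _ => ?_
  simp only [Fin.consEquiv_apply, Fin.prod_univ_succ, Fin.cons_zero, Fin.cons_succ,
    Fin.sum_univ_succ, smul_smul]
  rw [mul_comm, add_assoc, add_comm (∑ j, _)]

theorem lineJet_zero {d : ℕ} (J : MIdx d → E d → F) (α : MIdx d) (z v : E d) (t : ℝ) :
    lineJet J α z v 0 t = J α (z + t • v) := by
  simp [lineJet]

/-- Taylor's formula with integral remainder along a sequence of successive derivatives. -/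
theorem taylor_sequence [CompleteSpace F] {g : ℕ → ℝ → F}
    (hg : ∀ k t, HasDerivAt (g k) (g (k + 1) t) t) (m : ℕ) (a x : ℝ) :
    g 0 x = ∑ k ∈ Finset.range (m + 1), ((x - a) ^ k / (k.factorial : ℝ)) • g k a +
      ∫ t in a..x, ((x - t) ^ m / (m.factorial : ℝ)) • g (m + 1) t := by
  have hc : ∀ k, Continuous (g k) := fun k =>
    continuous_iff_continuousAt.2 fun t => (hg k t).continuousAt
  induction m with
  | zero =>
    have := intervalIntegral.integral_eq_sub_of_hasDerivAt (a := a) (b := x)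
      (fun t _ => hg 0 t) ((hc 1).intervalIntegrable _ _)
    simp [this]
  | succ m ih =>
    rw [ih, Finset.sum_range_succ _ (m + 1), add_assoc]
    congr 1
    -- Integration by parts: this primitive of the kernel vanishes at `t = x`, so only the boundary
    -- term at `a` survives.
    have hu : ∀ t ∈ Set.uIcc a x, HasDerivAt
        (fun t : ℝ => -((x - t) ^ (m + 1) / ((m + 1).factorial : ℝ)))
        ((x - t) ^ m / (m.factorial : ℝ)) t := by
      intro t _
      have h1 : HasDerivAt (fun t : ℝ => x - t) (-1) t := by
        simpa using (hasDerivAt_id t).const_sub x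
      have h2 := ((h1.pow (m + 1)).div_const ((m + 1).factorial : ℝ)).neg
      refine h2.congr_deriv ?_
      rw [Nat.factorial_succ]
      push_cast
      field_simp
    have h3 := intervalIntegral.integral_deriv_smul_eq_sub_of_hasDeriv_right
      (by fun_prop) (hc (m + 1)).continuousOn
      (fun t ht => (hu t (Set.mem_of_mem_of_subset ht Set.Ioo_subset_Icc_self)).hasDerivWithinAt)
      (fun t _ => (hg (m + 1) t).hasDerivWithinAt)
      (Continuous.intervalIntegrable (by fun_prop) _ _) ((hc (m + 2)).intervalIntegrable _ _)
    rw [← sub_eq_zero]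
    have h4 : ∫ t in a..x, ((x - t) ^ m / (m.factorial : ℝ)) • g (m + 1) t +
        -((x - t) ^ (m + 1) / ((m + 1).factorial : ℝ)) • g (m + 2) t =
        (∫ t in a..x, ((x - t) ^ m / (m.factorial : ℝ)) • g (m + 1) t) -
        ∫ t in a..x, ((x - t) ^ (m + 1) / ((m + 1).factorial : ℝ)) • g (m + 2) t := by
      simp only [neg_smul, ← sub_eq_add_neg]
      exact intervalIntegral.integral_sub
        (Continuous.intervalIntegrable (by have := hc (m+1); fun_prop) _ _)
        (Continuous.intervalIntegrable (by have := hc (m+2); fun_prop) _ _)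
    rw [← sub_sub, sub_right_comm, ← h4, h3]
    simp

end

/-! ### Sobolev's inequality on a ball -/

section

theorem sq_setLIntegral_le {X : Type*} [MeasurableSpace X] (μ : Measure X) {f : X → ℝ≥0∞}
    (hf : AEMeasurable f μ) : (∫⁻ x, f x ∂μ) ^ 2 ≤ μ Set.univ * ∫⁻ x, f x ^ 2 ∂μ := by
  have h := ENNReal.lintegral_mul_le_Lp_mul_Lq μ Real.HolderConjugate.two_two
    (aemeasurable_const (b := (1 : ℝ≥0∞))) hf
  have h2 := pow_le_pow_left' h 2
  simp only [Pi.mul_apply, one_mul, ENNReal.one_rpow, lintegral_const] at h2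
  refine h2.trans_eq ?_
  rw [mul_pow, ← ENNReal.rpow_natCast, ← ENNReal.rpow_natCast, ← ENNReal.rpow_mul,
    ← ENNReal.rpow_mul]
  norm_num

theorem lintegral_comp_smul_add {d : ℕ} {H : E d → ℝ≥0∞} (hH : Measurable H) (b : E d) {t : ℝ}
    (ht : 0 < t) : ∫⁻ y, H (t • y + b) = ENNReal.ofReal ((t ^ d)⁻¹) * ∫⁻ y, H y := by
  have h1 : ∫⁻ y, H (t • y + b) = ∫⁻ z, H (z + b) ∂(Measure.map (fun y : E d => t • y) volume) := by
    rw [lintegral_map (by fun_prop) (by fun_prop)]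
  rw [h1, Measure.map_addHaar_smul _ ht.ne', lintegral_smul_measure,
    lintegral_add_right_eq_self (fun z => H z)]
  simp [abs_of_pos ht]

theorem lintegral_rpow_neg_half :
    ∫⁻ t in Set.Ioc (0 : ℝ) 1, ENNReal.ofReal (t ^ (-(1 / 2) : ℝ)) = 2 := by
  have hi : IntervalIntegrable (fun t : ℝ => t ^ (-(1 / 2) : ℝ)) volume 0 1 :=
    intervalIntegral.intervalIntegrable_rpow' (by norm_num)
  rw [← ofReal_integral_eq_lintegral_ofReal
    ((intervalIntegrable_iff_integrableOn_Ioc_of_le zero_le_one).1 hi), 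
    ← intervalIntegral.integral_of_le zero_le_one, integral_rpow (by norm_num)]
  · norm_num
  · filter_upwards [self_mem_ae_restrict measurableSet_Ioc] with t ht
    exact Real.rpow_nonneg ht.1.le _

theorem length_sum_single {d k : ℕ} (I : Fin k → Fin d) :
    MIdx.length (∑ j, Pi.single (I j) 1 : MIdx d) = k := by
  unfold MIdx.length
  simp only [Finset.sum_apply]
  rw [Finset.sum_comm]
  simp

theorem length_add {d : ℕ} (α β : MIdx d) :
    MIdx.length (α + β) = MIdx.length α + MIdx.length β := Finset.sum_add_distrib

theorem norm_lineJet_le {F : Type*} [NormedAddCommGroup F] [NormedSpace ℝ F] {d : ℕ}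
    (J : MIdx d → E d → F) (α : MIdx d) (z v : E d) (k : ℕ) (t r s : ℝ) (hr : ‖v‖ ≤ r)
    (hs : ∀ I : Fin k → Fin d, ‖J (α + ∑ j, Pi.single (I j) 1) (z + t • v)‖ ≤ s) :
    ‖lineJet J α z v k t‖ ≤ (d * r) ^ k * s := by
  unfold lineJet
  refine (norm_sum_le _ _).trans ?_
  have hr0 : 0 ≤ r := (norm_nonneg _).trans hr
  have : ∀ I ∈ (Finset.univ : Finset (Fin k → Fin d)),
      ‖(∏ j, v (I j)) • J (α + ∑ j, Pi.single (I j) 1) (z + t • v)‖ ≤ r ^ k * s := by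
    intro I _
    rw [norm_smul, norm_prod]
    refine mul_le_mul ?_ (hs I) (norm_nonneg _) (by positivity)
    refine (Finset.prod_le_prod (fun j _ => norm_nonneg _)
      fun j _ => (PiLp.norm_apply_le v (I j)).trans hr).trans (by simp)
  refine (Finset.sum_le_card_nsmul _ _ _ this).trans_eq ?_
  simp [mul_pow, mul_assoc]

/-- Taylor's formula along the segment from `y` to `x`. -/
theorem abs_le_taylor_segment {d : ℕ} {u : E d → ℝ} (hu : ContDiff ℝ ∞ u) (x y : E d) (m : ℕ)
    {r : ℝ} (hr : ‖y - x‖ ≤ r) (hr1 : 1 ≤ d * r) :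
    |u x| ≤ (m + 1) * (d * r) ^ (m + 1) *
      ((∑ α ∈ multiIndices d (m + 1), |multiDeriv α u y|) +
        ∫ t in (0 : ℝ)..1, t ^ m *
          ∑ α ∈ multiIndices d (m + 1), |multiDeriv α u (x + t • (y - x))|) := by
  set G : E d → ℝ := fun p => ∑ α ∈ multiIndices d (m + 1), |multiDeriv α u p| with hG
  have hJ : IsJet (fun α => multiDeriv α u) := isJet_vecDeriv (F := ℝ) hu
  set g := lineJet (fun α => multiDeriv α u) 0 x (y - x) with hg
  have hGc : Continuous G := by
    refine continuous_finsetSum _ fun α _ => ?_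
    exact (hJ.contDiff α).continuous.abs
  have hG0 : ∀ p, 0 ≤ G p := fun p => Finset.sum_nonneg fun α _ => abs_nonneg _
  have hgc : ∀ k, Continuous (g k) := fun k =>
    continuous_iff_continuousAt.2 fun t => (hJ.hasDerivAt_lineJet _ _ _ k t).continuousAt
  -- Because `1 ≤ d * r`, the bound for the top order `m + 1` serves all lower orders.
  have hbd : ∀ k ≤ m + 1, ∀ t, |g k t| ≤ (d * r) ^ (m + 1) * G (x + t • (y - x)) := by
    intro k hk t
    have h1 : |g k t| ≤ (d * r) ^ k * G (x + t • (y - x)) := by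
      refine norm_lineJet_le (F := ℝ) _ _ _ _ _ _ _ _ hr fun I => ?_
      refine Finset.single_le_sum
        (f := fun α => |multiDeriv α u (x + t • (y - x))|) (fun α _ => abs_nonneg _) ?_
      rw [mem_multiIndices, zero_add, length_sum_single]
      exact hk
    exact h1.trans (mul_le_mul_of_nonneg_right (pow_le_pow_right₀ hr1 hk) (hG0 _))
  -- The expansion is based at `t = 1`, that is at `y`, and evaluated at `t = 0`, that is at `x`.
  -- The remainder then carries the weight `t ^ m`, which damps the part of the segment near `x`.
  have hT := taylor_sequence (g := g) (hJ.hasDerivAt_lineJet 0 x (y - x)) m 1 0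
  have h0 : g 0 0 = u x := by simp [hg, lineJet_zero, ← vecDeriv_real]
  rw [h0] at hT
  have hA : ∀ k ∈ Finset.range (m + 1), ‖((0 - 1 : ℝ) ^ k / (k.factorial : ℝ)) • g k 1‖ ≤
      (d * r) ^ (m + 1) * G y := by
    intro k hk
    have hk' : k ≤ m + 1 := (Finset.mem_range.1 hk).le
    rw [norm_smul]
    have h1 : ‖(0 - 1 : ℝ) ^ k / (k.factorial : ℝ)‖ ≤ 1 := by
      rw [norm_div, norm_pow]
      simp only [zero_sub, norm_neg, norm_one, one_pow, Real.norm_natCast]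
      exact div_le_one_of_le₀ (by exact_mod_cast Nat.one_le_iff_ne_zero.2 k.factorial_ne_zero)
        (by positivity)
    have h2 := hbd k hk' 1
    rw [one_smul, add_sub_cancel] at h2
    calc _ ≤ 1 * ‖g k 1‖ := mul_le_mul_of_nonneg_right h1 (norm_nonneg _)
      _ ≤ _ := by rw [one_mul]; exact h2
  have hB : ‖∫ t in (1 : ℝ)..0, ((0 - t) ^ m / (m.factorial : ℝ)) • g (m + 1) t‖ ≤
      (d * r) ^ (m + 1) * ∫ t in (0 : ℝ)..1, t ^ m * G (x + t • (y - x)) := by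
    rw [intervalIntegral.integral_symm, norm_neg, ← intervalIntegral.integral_const_mul]
    refine intervalIntegral.norm_integral_le_of_norm_le zero_le_one ?_
      (Continuous.intervalIntegrable (by fun_prop) _ _)
    refine Filter.Eventually.of_forall fun t ht => ?_
    rw [norm_smul, norm_div, norm_pow]
    simp only [zero_sub, norm_neg, Real.norm_natCast, Real.norm_of_nonneg ht.1.le]
    have h1 : t ^ m / (m.factorial : ℝ) ≤ t ^ m :=
      div_le_self (pow_nonneg ht.1.le _)
        (by exact_mod_cast Nat.one_le_iff_ne_zero.2 m.factorial_ne_zero)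
    calc _ ≤ t ^ m * ((d * r) ^ (m + 1) * G (x + t • (y - x))) :=
          mul_le_mul h1 (hbd _ le_rfl t) (abs_nonneg _) (pow_nonneg ht.1.le _)
      _ = _ := by ring
  have hI0 : 0 ≤ ∫ t in (0 : ℝ)..1, t ^ m * G (x + t • (y - x)) :=
    intervalIntegral.integral_nonneg zero_le_one fun t ht =>
      mul_nonneg (pow_nonneg ht.1 _) (hG0 _)
  have hP : 0 ≤ (d * r) ^ (m + 1) := by positivity
  calc |u x| ≤ ‖∑ k ∈ Finset.range (m + 1), ((0 - 1 : ℝ) ^ k / (k.factorial : ℝ)) • g k 1‖ +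
        ‖∫ t in (1 : ℝ)..0, ((0 - t) ^ m / (m.factorial : ℝ)) • g (m + 1) t‖ := by
        rw [hT, ← Real.norm_eq_abs]; exact norm_add_le _ _
    _ ≤ (m + 1) * ((d * r) ^ (m + 1) * G y) +
        (d * r) ^ (m + 1) * ∫ t in (0 : ℝ)..1, t ^ m * G (x + t • (y - x)) := by
        refine add_le_add ((norm_sum_le _ _).trans ?_) hB
        refine (Finset.sum_le_card_nsmul _ _ _ hA).trans_eq ?_
        simp
    _ ≤ _ := by
        have : (1 : ℝ) ≤ m + 1 := by simp
        have h2 := mul_le_mul_of_nonneg_right this (mul_nonneg hP hI0)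
        linarith

/-- By convexity `y ↦ x + t (y - x)` maps the ball into itself, with Jacobian `t ^ d`.
Cauchy–Schwarz contributes the volume. -/
theorem lintegral_ball_segment_le {d : ℕ} {R : ℝ} {x : E d} (hx : x ∈ Metric.ball (0 : E d) R)
    {G : E d → ℝ≥0∞} (hG : Measurable G) {t : ℝ} (ht : t ∈ Set.Ioc (0 : ℝ) 1) :
    (∫⁻ y in Metric.ball (0 : E d) R, G (x + t • (y - x))) ^ 2 ≤
      volume (Metric.ball (0 : E d) R) * (ENNReal.ofReal ((t ^ d)⁻¹) *
        ∫⁻ y in Metric.ball (0 : E d) R, G y ^ 2) := by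
  set B := Metric.ball (0 : E d) R
  have hB : MeasurableSet B := measurableSet_ball
  refine (sq_setLIntegral_le _ (by fun_prop)).trans ?_
  rw [Measure.restrict_apply_univ]
  gcongr
  rw [← lintegral_indicator hB (fun y => G y ^ 2), ← lintegral_comp_smul_add
    (H := B.indicator fun y => G y ^ 2) ((hG.pow_const 2).indicator hB) (x - t • x) ht.1,
    ← lintegral_indicator hB]
  refine lintegral_mono fun y => ?_
  by_cases hy : y ∈ B
  · have hmem : t • y + (x - t • x) ∈ B := by
      have := (convex_ball (0 : E d) R) hx hy (sub_nonneg.2 ht.2) ht.1.le (by ring)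
      convert this using 1
      module
    have he : x + t • (y - x) = t • y + (x - t • x) := by module
    rw [Set.indicator_of_mem hy, Set.indicator_of_mem hmem, he]
  · rw [Set.indicator_of_notMem hy]
    exact zero_le

theorem rpow_half_sq (a : ℝ≥0∞) : (a ^ (1 / 2 : ℝ)) ^ 2 = a := by
  rw [← ENNReal.rpow_natCast, ← ENNReal.rpow_mul]
  norm_num

theorem le_rpow_half_of_sq_le {a b : ℝ≥0∞} (h : a ^ 2 ≤ b) : a ≤ b ^ (1 / 2 : ℝ) := by
  rw [← ENNReal.pow_le_pow_left_iff two_ne_zero, rpow_half_sq]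
  exact h

/-- For fixed `t` the previous bound costs `t ^ (-d/2)`. The weight with exponent `⌊d/2⌋` reduces
this to at most `t ^ (-1/2)`, whose integral over `(0, 1]` is 2. This is why `⌊d/2⌋ + 1` derivatives
suffice. -/
theorem lintegral_segments_le {d : ℕ} {R : ℝ} {x : E d} (hx : x ∈ Metric.ball (0 : E d) R)
    {G : E d → ℝ≥0∞} (hG : Measurable G) :
    ∫⁻ y in Metric.ball (0 : E d) R, ∫⁻ t in Set.Ioc (0 : ℝ) 1,
        ENNReal.ofReal (t ^ (d / 2)) * G (x + t • (y - x)) ≤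
      2 * (volume (Metric.ball (0 : E d) R) *
        ∫⁻ y in Metric.ball (0 : E d) R, G y ^ 2) ^ (1 / 2 : ℝ) := by
  rw [lintegral_lintegral_swap (by fun_prop)]
  set V := volume (Metric.ball (0 : E d) R)
  set Q := ∫⁻ y in Metric.ball (0 : E d) R, G y ^ 2
  calc _ ≤ ∫⁻ t in Set.Ioc (0 : ℝ) 1, ENNReal.ofReal (t ^ (-(1 / 2) : ℝ)) *
        (V * Q) ^ (1 / 2 : ℝ) := by
        refine setLIntegral_mono' measurableSet_Ioc fun t ht => ?_
        rw [lintegral_const_mul _ (by fun_prop)]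
        have h1 := le_rpow_half_of_sq_le (lintegral_ball_segment_le hx hG ht)
        refine (mul_le_mul_right h1 _).trans ?_
        rw [mul_left_comm, ENNReal.mul_rpow_of_nonneg (ENNReal.ofReal _) _ (by norm_num),
          ← mul_assoc]
        refine mul_le_mul_left ?_ _
        rw [ENNReal.ofReal_rpow_of_nonneg (inv_nonneg.2 (pow_nonneg ht.1.le _)) (by norm_num),
          ← ENNReal.ofReal_mul (pow_nonneg ht.1.le _)]
        refine ENNReal.ofReal_le_ofReal ?_
        rw [← Real.rpow_natCast, ← Real.rpow_natCast, ← Real.rpow_neg ht.1.le,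
          ← Real.rpow_mul ht.1.le, ← Real.rpow_add ht.1]
        refine Real.rpow_le_rpow_of_exponent_ge ht.1 ht.2 ?_
        have : (d : ℝ) ≤ 2 * (d / 2 : ℕ) + 1 := by
          have : d ≤ 2 * (d / 2) + 1 := by omega
          exact_mod_cast this
        linarith
    _ = _ := by
        rw [lintegral_mul_const _ (by fun_prop), lintegral_rpow_neg_half]

/-- Sobolev's inequality on the ball of radius `R`. -/
theorem exists_sobolev_const (d : ℕ) (hd : 1 ≤ d) : ∃ c : ℝ≥0, ∀ R : ℝ, 1 ≤ R →
    ∀ u : E d → ℝ, ContDiff ℝ ∞ u → ∀ x ∈ Metric.ball (0 : E d) R,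
      ‖u x‖ₑ ^ 2 ≤ c * ENNReal.ofReal (R ^ (2 * ((d / 2 + 1 : ℕ) : ℝ) - d)) *
        ∑ α ∈ multiIndices d (d / 2 + 1),
          ∫⁻ y in Metric.ball (0 : E d) R, ‖multiDeriv α u y‖ₑ ^ 2 := by
  set j := d / 2 + 1 with hj
  set S := multiIndices d j with hS
  set V1 := volume (Metric.ball (0 : E d) 1) with hV1
  have hV1pos : V1 ≠ 0 := (Metric.measure_ball_pos volume (0 : E d) one_pos).ne'
  have hV1top : V1 ≠ ⊤ := measure_ball_lt_top.ne
  obtain ⟨v1, hv1⟩ : ∃ v1 : ℝ≥0, (v1 : ℝ≥0∞) = V1 := ⟨V1.toNNReal, ENNReal.coe_toNNReal hV1top⟩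
  -- `(2d)^j` comes from segments of length at most `2R`, `j` from the number of Taylor terms, and
  -- `3 = 1 + 2` from the boundary term and the segment integral. `v1⁻¹` comes from dividing by the
  -- volume, and the cardinality from squaring the sum over `S`.
  refine ⟨((j : ℝ≥0) * (2 * d) ^ j * 3) ^ 2 * v1⁻¹ * S.card, fun R hR u hu x hx => ?_⟩
  have hR0 : 0 < R := by linarith
  set B := Metric.ball (0 : E d) R with hB
  set G : E d → ℝ≥0∞ := fun p => ∑ α ∈ S, ‖multiDeriv α u p‖ₑ with hG
  have hmc : ∀ α, Continuous (multiDeriv α u) := fun α => (vecDeriv_contDiff (F := ℝ) α hu).continuous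
  have hGm : Measurable G := by
    refine Finset.measurable_fun_sum _ fun α _ => ?_
    exact (hmc α).measurable.enorm
  set P := ENNReal.ofReal (j * (2 * d * R) ^ j) with hP
  set Q := ∫⁻ y in B, G y ^ 2 with hQ
  have hVR : volume B = ENNReal.ofReal (R ^ d) * V1 := by
    rw [hB, Measure.addHaar_ball_of_pos volume _ hR0]
    simp [hV1]
  have hVpos : volume B ≠ 0 := (Metric.measure_ball_pos volume (0 : E d) hR0).ne'
  have hVtop : volume B ≠ ⊤ := measure_ball_lt_top.ne
  have hpt : ∀ y ∈ B, ‖u x‖ₑ ≤ P * (G y + ∫⁻ t in Set.Ioc (0 : ℝ) 1,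
      ENNReal.ofReal (t ^ (d / 2)) * G (x + t • (y - x))) := by
    intro y hy
    have hxy : ‖y - x‖ ≤ 2 * R := by
      rw [hB, mem_ball_zero_iff] at hx hy
      linarith [norm_sub_le y x]
    have hd' : (1 : ℝ) ≤ d := by exact_mod_cast hd
    have h := abs_le_taylor_segment hu x y (d / 2) hxy (by nlinarith)
    have h2 := ENNReal.ofReal_le_ofReal h
    rw [← Real.norm_eq_abs, ofReal_norm] at h2
    have hGr : ∀ p, ENNReal.ofReal (∑ α ∈ S, |multiDeriv α u p|) = G p := by
      intro p
      rw [ENNReal.ofReal_sum_of_nonneg fun _ _ => abs_nonneg _, hG]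
      simp only [← Real.norm_eq_abs, ofReal_norm]
    have hcont : Continuous fun p => ∑ α ∈ S, |multiDeriv α u p| :=
      continuous_finsetSum _ fun α _ => (hmc α).abs
    refine h2.trans_eq ?_
    rw [ENNReal.ofReal_mul (by positivity), ENNReal.ofReal_add
      (Finset.sum_nonneg fun _ _ => abs_nonneg _)
      (intervalIntegral.integral_nonneg zero_le_one fun t ht =>
        mul_nonneg (pow_nonneg ht.1 _) (Finset.sum_nonneg fun _ _ => abs_nonneg _)),
      hGr, intervalIntegral.integral_of_le zero_le_one, ofReal_integral_eq_lintegral_ofReal]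
    · congr 2
      · rw [hj]; push_cast; congr 2; ring
      · refine setLIntegral_congr_fun measurableSet_Ioc fun t ht => ?_
        rw [ENNReal.ofReal_mul (pow_nonneg ht.1.le _), hGr]
    · exact ((Continuous.intervalIntegrable (by fun_prop) 0 1).1)
    · filter_upwards [self_mem_ae_restrict measurableSet_Ioc] with t ht
      exact mul_nonneg (pow_nonneg ht.1.le _) (Finset.sum_nonneg fun _ _ => abs_nonneg _)
  -- The Taylor bound holds for every base point `y`; it is averaged over the ball.
  have hint : volume B * ‖u x‖ₑ ≤ P * (3 * (volume B * Q) ^ (1 / 2 : ℝ)) := by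
    calc volume B * ‖u x‖ₑ = ∫⁻ _ in B, ‖u x‖ₑ := by rw [setLIntegral_const, mul_comm]
      _ ≤ ∫⁻ y in B, P * (G y + ∫⁻ t in Set.Ioc (0 : ℝ) 1,
            ENNReal.ofReal (t ^ (d / 2)) * G (x + t • (y - x))) :=
          setLIntegral_mono' measurableSet_ball hpt
      _ = P * ((∫⁻ y in B, G y) + ∫⁻ y in B, ∫⁻ t in Set.Ioc (0 : ℝ) 1,
            ENNReal.ofReal (t ^ (d / 2)) * G (x + t • (y - x))) := by
          rw [lintegral_const_mul' _ _ ENNReal.ofReal_ne_top, lintegral_add_left hGm]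
      _ ≤ P * ((volume B * Q) ^ (1 / 2 : ℝ) + 2 * (volume B * Q) ^ (1 / 2 : ℝ)) := by
          gcongr
          · refine le_rpow_half_of_sq_le ?_
            simpa using sq_setLIntegral_le (volume.restrict B) hGm.aemeasurable
          · exact lintegral_segments_le hx hGm
      _ = _ := by ring
  have hsq : volume B * (volume B * ‖u x‖ₑ ^ 2) ≤ volume B * ((P * 3) ^ 2 * Q) := by
    calc _ = (volume B * ‖u x‖ₑ) ^ 2 := by ring
      _ ≤ (P * (3 * (volume B * Q) ^ (1 / 2 : ℝ))) ^ 2 := pow_le_pow_left' hint 2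
      _ = _ := by rw [← mul_assoc, mul_pow, rpow_half_sq]; ring
  have h3 := (ENNReal.mul_le_mul_iff_right hVpos hVtop).1 hsq
  have hQle : Q ≤ S.card * ∑ α ∈ S, ∫⁻ y in B, ‖multiDeriv α u y‖ₑ ^ 2 := by
    rw [← lintegral_finsetSum _ fun α _ => ((hmc α).measurable.enorm.pow_const 2),
      ← lintegral_const_mul' _ _ (ENNReal.natCast_ne_top _)]
    refine lintegral_mono fun y => ?_
    have := ENNReal.inner_le_Lp_mul_Lq S (fun _ => (1 : ℝ≥0∞)) (fun α => ‖multiDeriv α u y‖ₑ)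
      Real.HolderConjugate.two_two
    have h2 := pow_le_pow_left' this 2
    simp only [one_mul, ENNReal.one_rpow, Finset.sum_const, nsmul_eq_mul, mul_one, mul_pow,
      rpow_half_sq] at h2
    simpa using h2
  have h4 : ‖u x‖ₑ ^ 2 ≤ (volume B)⁻¹ * ((P * 3) ^ 2 * Q) := by
    rw [mul_comm, ← div_eq_mul_inv]
    exact ENNReal.le_div_iff_mul_le (Or.inl hVpos) (Or.inl hVtop) |>.2 (by rw [mul_comm]; exact h3)
  refine h4.trans ?_
  refine (mul_le_mul_right (mul_le_mul_right hQle _) _).trans_eq ?_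
  have hPR : P = ((j : ℝ≥0) * (2 * d) ^ j : ℝ≥0) * ENNReal.ofReal (R ^ j) := by
    rw [hP, mul_pow, ← mul_assoc, ENNReal.ofReal_mul (by positivity)]
    congr 1
    rw [← ENNReal.ofReal_coe_nnreal]
    simp
  have hRR : ENNReal.ofReal (R ^ (2 * (j : ℝ) - d)) =
      (ENNReal.ofReal (R ^ d))⁻¹ * ENNReal.ofReal (R ^ j) ^ 2 := by
    rw [Real.rpow_sub hR0, mul_comm 2 (j : ℝ), Real.rpow_mul hR0.le, Real.rpow_natCast,
      Real.rpow_natCast, ENNReal.ofReal_div_of_pos (by positivity), div_eq_mul_inv, mul_comm,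
      ← ENNReal.ofReal_pow (by positivity)]
    norm_num
  have hv10 : v1 ≠ 0 := by rintro rfl; exact hV1pos (by simp [← hv1])
  rw [hVR, ENNReal.mul_inv (Or.inr hV1top) (Or.inr hV1pos), hRR, hPR, ← hv1,
    ← ENNReal.coe_inv hv10]
  push_cast
  ring

end

/-! ### Smooth feature maps of smooth kernels -/

section

open scoped InnerProductSpace Topology
open Filter

/-- The space is the reproducing kernel Hilbert space of `K`, and `φ x` is the kernel section at
`x`. The scalar kernel is first read as one with values in the endomorphisms of `ℝ`. -/
theorem exists_feature {d : ℕ} {K : E d → E d → ℝ} (hK : IsCovKernel K) :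
    ∃ (H : Type) (_ : NormedAddCommGroup H) (_ : InnerProductSpace ℝ H) (_ : CompleteSpace H)
      (φ : E d → H), ∀ x y, ⟪φ x, φ y⟫_ℝ = K x y := by
  let K' : Matrix (E d) (E d) (ℝ →L[ℝ] ℝ) := Matrix.of fun x y => K x y • (1 : ℝ →L[ℝ] ℝ)
  have hsymm : ∀ x y, K y x = K x y := fun x y => by simpa using hK.1.apply x y
  have hpos : K'.PosSemidef := by
    refine ((RKHS.posSemidef_tfae (K := K')).out 0 2).2 (show _ ∧ _ from ⟨?_, fun c => ?_⟩)
    · ext x y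
      simp [K', hsymm x y]
    · have h := hK.2 c
      simp only [RCLike.re_to_real]
      refine h.trans_eq ?_
      simp only [Finsupp.sum]
      refine Finset.sum_congr rfl fun x _ => Finset.sum_congr rfl fun y _ => ?_
      simp [K', hsymm x y]
      ring
  have : Fact K'.PosSemidef := ⟨hpos⟩
  refine ⟨RKHS.OfKernel K', inferInstance, inferInstance, inferInstance,
    fun x => RKHS.kerFun (RKHS.OfKernel K') x 1, fun x y => ?_⟩
  have h := RKHS.kernel_inner (H := RKHS.OfKernel K') y x (1 : ℝ) (1 : ℝ)
  rw [RKHS.OfKernel.kernel_ofKernel] at h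
  rw [← h]
  simp [K', hsymm x y]

section Feature

variable {X H : Type*} [NormedAddCommGroup X] [NormedSpace ℝ X]
  [NormedAddCommGroup H] [InnerProductSpace ℝ H]

theorem hasDerivAt_line {F : Type*} [NormedAddCommGroup F] [NormedSpace ℝ F] {f : X → F}
    (hf : Differentiable ℝ f) (x v : X) (t : ℝ) :
    HasDerivAt (fun t : ℝ => f (x + t • v)) (fderiv ℝ f (x + t • v) v) t := by
  have hline : HasDerivAt (fun t : ℝ => x + t • v) v t := by
    simpa using ((hasDerivAt_id t).smul_const v).const_add x
  exact (hf _).hasFDerivAt.comp_hasDerivAt t hline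

/-- The mean value theorem in each variable in turn. When `G` is the Gram kernel of a map, the left
side is the inner product of two of its difference quotients. -/
theorem exists_mixed_slope {G : X × X → ℝ} (hG : ContDiff ℝ ∞ G) (x y v w : X) {t s : ℝ}
    (ht : t ≠ 0) (hs : s ≠ 0) : ∃ a ∈ Set.Ioo (0 : ℝ) 1, ∃ b ∈ Set.Ioo (0 : ℝ) 1,
      t⁻¹ * s⁻¹ * (G (x + t • v, y + s • w) - G (x + t • v, y) - G (x, y + s • w) + G (x, y)) =
        fderiv ℝ (fun p => fderiv ℝ G p (v, 0)) (x + (a * t) • v, y + (b * s) • w) (0, w) := by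
  have hGd : Differentiable ℝ G := hG.differentiable (by simp)
  have hD : ContDiff ℝ ∞ (fun p => fderiv ℝ G p (v, 0)) :=
    (hG.fderiv_right (m := ∞) (by simp)).clm_apply contDiff_const
  have hDd := hD.differentiable (by simp)
  have h1 : ∀ (z : X) (a : ℝ), HasDerivAt (fun a : ℝ => G (x + (a * t) • v, z))
      (t * fderiv ℝ G (x + (a * t) • v, z) (v, 0)) a := by
    intro z a
    have := hasDerivAt_line hGd (x, z) (t • (v, 0)) a
    rw [map_smul, smul_eq_mul] at this
    simpa [mul_smul, Prod.smul_mk] using this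
  obtain ⟨a, ha, hae⟩ := exists_hasDerivAt_eq_slope
    (fun a : ℝ => G (x + (a * t) • v, y + s • w) - G (x + (a * t) • v, y))
    _ zero_lt_one (fun a _ => ((h1 _ a).sub (h1 _ a)).continuousAt.continuousWithinAt)
    (fun a _ => (h1 _ a).sub (h1 _ a))
  have h2 : ∀ b : ℝ, HasDerivAt
      (fun b : ℝ => fderiv ℝ G (x + (a * t) • v, y + (b * s) • w) (v, 0))
      (s * fderiv ℝ (fun p => fderiv ℝ G p (v, 0)) (x + (a * t) • v, y + (b * s) • w) (0, w)) b := by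
    intro b
    have := hasDerivAt_line hDd (x + (a * t) • v, y) (s • (0, w)) b
    rw [map_smul, smul_eq_mul] at this
    simpa [mul_smul, Prod.smul_mk] using this
  obtain ⟨b, hb, hbe⟩ := exists_hasDerivAt_eq_slope _ _ zero_lt_one
    (fun b _ => (h2 b).continuousAt.continuousWithinAt) (fun b _ => h2 b)
  refine ⟨a, ha, b, hb, ?_⟩
  simp only [zero_mul, one_mul, zero_smul, add_zero, sub_zero, div_one] at hae hbe
  have h3 : G (x + t • v, y + s • w) - G (x + t • v, y) - G (x, y + s • w) + G (x, y) =
      t * (s * fderiv ℝ (fun p => fderiv ℝ G p (v, 0))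
        (x + (a * t) • v, y + (b * s) • w) (0, w)) := by
    rw [hbe, mul_sub, hae]; ring
  rw [h3]
  field_simp

/-- The inner products of difference quotients `⟪q t, q s⟫` converge to the mixed derivative `D (x,
x)` as `t` and `s` tend to zero independently. Hence `‖q t - q s‖²` tends to `D - 2D + D = 0`, and
completeness gives the limit. -/
theorem exists_hasDerivAt_feature [CompleteSpace H] {φ : X → H}
    (hG : ContDiff ℝ ∞ (fun p : X × X => ⟪φ p.1, φ p.2⟫_ℝ)) (x v : X) :
    ∃ w : H, HasDerivAt (fun t : ℝ => φ (x + t • v)) w 0 := by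
  set G : X × X → ℝ := fun p => ⟪φ p.1, φ p.2⟫_ℝ with hGdef
  set D : X × X → ℝ := fun p => fderiv ℝ (fun p => fderiv ℝ G p (v, 0)) p (0, v) with hDdef
  have hDc : Continuous D := by
    have hD : ContDiff ℝ ∞ (fun p => fderiv ℝ G p (v, 0)) :=
      (hG.fderiv_right (m := ∞) (by simp)).clm_apply contDiff_const
    exact ((hD.fderiv_right (m := ∞) (by simp)).clm_apply contDiff_const).continuous
  set q : ℝ → H := fun t => t⁻¹ • (φ (x + t • v) - φ x) with hq
  have hlim : Tendsto (fun p : ℝ × ℝ => ⟪q p.1, q p.2⟫_ℝ) (𝓝[≠] 0 ×ˢ 𝓝[≠] 0) (𝓝 (D (x, x))) := by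
    rw [Metric.tendsto_nhds]
    intro ε hε
    have hcont : Continuous fun p : ℝ × ℝ => D (x + p.1 • v, x + p.2 • v) := by fun_prop
    obtain ⟨δ, hδ, hball⟩ := Metric.continuousAt_iff.1 (hcont.continuousAt (x := (0, 0))) ε hε
    have hn : {t : ℝ | |t| < δ ∧ t ≠ 0} ∈ 𝓝[≠] (0 : ℝ) := by
      rw [mem_nhdsWithin]
      exact ⟨Metric.ball 0 δ, Metric.isOpen_ball, Metric.mem_ball_self hδ,
        fun t ht => ⟨by simpa using ht.1, ht.2⟩⟩
    filter_upwards [prod_mem_prod hn hn] with p hp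
    obtain ⟨⟨ht, ht0⟩, ⟨hs, hs0⟩⟩ := hp
    obtain ⟨a, ha, b, hb, he⟩ := exists_mixed_slope hG x x v v ht0 hs0
    have h1 : ⟪q p.1, q p.2⟫_ℝ = D (x + (a * p.1) • v, x + (b * p.2) • v) := by
      rw [hDdef]
      simp only
      rw [← he, hq]
      simp only [hGdef, inner_smul_left, inner_smul_right, inner_sub_left, inner_sub_right]
      simp
      ring
    have hab : ∀ c ∈ Set.Ioo (0 : ℝ) 1, ∀ r : ℝ, |r| < δ → |c * r| < δ := by
      intro c hc r hr
      rw [abs_mul, abs_of_pos hc.1]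
      exact (mul_le_of_le_one_left (abs_nonneg _) hc.2.le).trans_lt hr
    have h2 := hball (x := (a * p.1, b * p.2)) (by
      rw [Prod.dist_eq]
      simpa using ⟨by simpa [abs_mul] using hab a ha _ ht, by simpa [abs_mul] using hab b hb _ hs⟩)
    rw [h1]
    simpa using h2
  have hfst : Tendsto (fun p : ℝ × ℝ => ⟪q p.1, q p.1⟫_ℝ) (𝓝[≠] 0 ×ˢ 𝓝[≠] 0) (𝓝 (D (x, x))) :=
    hlim.comp (tendsto_fst.prodMk tendsto_fst)
  have hsnd : Tendsto (fun p : ℝ × ℝ => ⟪q p.2, q p.2⟫_ℝ) (𝓝[≠] 0 ×ˢ 𝓝[≠] 0) (𝓝 (D (x, x))) :=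
    hlim.comp (tendsto_snd.prodMk tendsto_snd)
  have hsq : Tendsto (fun p : ℝ × ℝ => ‖q p.1 - q p.2‖ ^ 2) (𝓝[≠] 0 ×ˢ 𝓝[≠] 0) (𝓝 0) := by
    have h := (hfst.sub (hlim.const_mul 2)).add hsnd
    rw [show D (x, x) - 2 * D (x, x) + D (x, x) = 0 by ring] at h
    refine h.congr fun p => ?_
    rw [norm_sub_sq_real, real_inner_self_eq_norm_sq, real_inner_self_eq_norm_sq]
  have hnorm : Tendsto (fun p : ℝ × ℝ => ‖q p.1 - q p.2‖) (𝓝[≠] 0 ×ˢ 𝓝[≠] 0) (𝓝 0) := by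
    have := hsq.sqrt
    simpa [Real.sqrt_sq] using this
  have hcauchy : Cauchy (map q (𝓝[≠] 0)) := by
    rw [cauchy_map_iff]
    refine ⟨inferInstance, ?_⟩
    rw [Metric.uniformity_eq_comap_nhds_zero, tendsto_comap_iff]
    simpa [Function.comp_def, dist_eq_norm] using hnorm
  obtain ⟨w, hw⟩ := CompleteSpace.complete hcauchy
  refine ⟨w, ?_⟩
  rw [hasDerivAt_iff_tendsto_slope_zero]
  simpa [hq, Tendsto] using hw

/-- Feature maps of smooth kernels are smooth. -/
theorem contDiff_feature [FiniteDimensional ℝ X] [CompleteSpace H] {φ : X → H}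
    (hG : ContDiff ℝ ∞ (fun p : X × X => ⟪φ p.1, φ p.2⟫_ℝ)) : ContDiff ℝ ∞ φ := by
  rw [contDiff_infty]
  intro n
  -- Each directional derivative of `φ` is again a map with smooth Gram kernel, so the statement for
  -- first derivatives can be iterated.
  suffices Hmain : ∀ φ : X → H, ContDiff ℝ ∞ (fun p : X × X => ⟪φ p.1, φ p.2⟫_ℝ) →
      Differentiable ℝ φ ∧ ∀ v, ContDiff ℝ ∞
        (fun p : X × X => ⟪fderiv ℝ φ p.1 v, fderiv ℝ φ p.2 v⟫_ℝ) by
    induction n generalizing φ with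
    | zero =>
      rw [Nat.cast_zero, contDiff_zero]
      exact (Hmain φ hG).1.continuous
    | succ n ih =>
      rw [Nat.cast_add, Nat.cast_one, contDiff_succ_iff_fderiv_apply]
      refine ⟨(Hmain φ hG).1, by simp, fun v => ih ((Hmain φ hG).2 v)⟩
  clear hG φ n
  intro φ hG
  choose ψ hψ using exists_hasDerivAt_feature hG
  set G : X × X → ℝ := fun p => ⟪φ p.1, φ p.2⟫_ℝ with hGdef
  have hGd : Differentiable ℝ G := hG.differentiable (by simp)
  have hD : ∀ v, ContDiff ℝ ∞ (fun p => fderiv ℝ G p (v, 0)) := fun v =>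
    (hG.fderiv_right (m := ∞) (by simp)).clm_apply contDiff_const
  have h1 : ∀ x v y, ⟪ψ x v, φ y⟫_ℝ = fderiv ℝ G (x, y) (v, 0) := by
    intro x v y
    have ha := (hψ x v).inner ℝ (hasDerivAt_const (0 : ℝ) (φ y))
    have hb := hasDerivAt_line hGd (x, y) (v, 0) 0
    simp only [inner_zero_right, zero_add, zero_smul, add_zero] at ha hb
    refine ha.unique ?_
    simpa [hGdef] using hb
  have h2 : ∀ x y v w, ⟪ψ x v, ψ y w⟫_ℝ =
      fderiv ℝ (fun p => fderiv ℝ G p (v, 0)) (x, y) (0, w) := by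
    intro x y v w
    have ha := (hasDerivAt_const (0 : ℝ) (ψ x v)).inner ℝ (hψ y w)
    have hb := hasDerivAt_line ((hD v).differentiable (by simp)) (x, y) (0, w) 0
    simp only [inner_zero_left, add_zero, zero_smul] at ha hb
    refine ha.unique ?_
    simpa [h1] using hb
  -- Source of linearity in `v`: the defect of additivity or homogeneity is orthogonal to every `φ
  -- y`, hence to every `ψ x v`, hence to itself.
  have hzero : ∀ e : H, (∀ y, ⟪e, φ y⟫_ℝ = 0) → ∀ x v, ⟪e, ψ x v⟫_ℝ = 0 := by
    intro e he x v
    have ha := (hasDerivAt_const (0 : ℝ) e).inner ℝ (hψ x v)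
    simp only [he, inner_zero_left, add_zero] at ha
    exact ha.unique (hasDerivAt_const _ _)
  have hadd : ∀ x v w, ψ x (v + w) = ψ x v + ψ x w := by
    intro x v w
    have he : ∀ y, ⟪ψ x (v + w) - (ψ x v + ψ x w), φ y⟫_ℝ = 0 := by
      intro y
      rw [inner_sub_left, inner_add_left, h1, h1, h1, ← map_add]
      simp
    have h := hzero _ he
    rw [← sub_eq_zero, ← inner_self_eq_zero (𝕜 := ℝ)]
    rw [inner_sub_right, inner_add_right, h, h, h]
    simp
  have hsmul : ∀ x (c : ℝ) v, ψ x (c • v) = c • ψ x v := by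
    intro x c v
    have he : ∀ y, ⟪ψ x (c • v) - c • ψ x v, φ y⟫_ℝ = 0 := by
      intro y
      have : ((c • v, 0) : X × X) = c • (v, 0) := by simp
      rw [inner_sub_left, inner_smul_left, h1, h1, this, map_smul]
      simp
    have h := hzero _ he
    rw [← sub_eq_zero, ← inner_self_eq_zero (𝕜 := ℝ)]
    rw [inner_sub_right, inner_smul_right, h, h]
    simp
  let L : X → X →L[ℝ] H := fun x => LinearMap.toContinuousLinearMap
    { toFun := ψ x, map_add' := hadd x, map_smul' := hsmul x }
  have hL : ∀ x v, L x v = ψ x v := fun x v => rfl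
  have hsm : ∀ v, ContDiff ℝ ∞ (fun p : X × X => ⟪ψ p.1 v, ψ p.2 v⟫_ℝ) := by
    intro v
    have : (fun p : X × X => ⟪ψ p.1 v, ψ p.2 v⟫_ℝ) = fun p =>
        fderiv ℝ (fun p => fderiv ℝ G p (v, 0)) p (0, v) := by
      funext p; rw [h2]
    rw [this]
    exact ((hD v).fderiv_right (m := ∞) (by simp)).clm_apply contDiff_const
  have hψc : ∀ v, Continuous fun x => ψ x v := by
    intro v
    rw [continuous_iff_continuousAt]
    intro x
    have hc : Tendsto (fun y => ‖ψ y v - ψ x v‖ ^ 2) (𝓝 x) (𝓝 0) := by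
      have hcont := (hsm v).continuous
      have hA : Continuous fun y => ‖ψ y v - ψ x v‖ ^ 2 := by
        have : (fun y => ‖ψ y v - ψ x v‖ ^ 2) = fun y =>
            ⟪ψ y v, ψ y v⟫_ℝ - 2 * ⟪ψ y v, ψ x v⟫_ℝ + ⟪ψ x v, ψ x v⟫_ℝ := by
          funext y
          rw [norm_sub_sq_real, real_inner_self_eq_norm_sq, real_inner_self_eq_norm_sq]
        rw [this]
        have c1 : Continuous fun y => ⟪ψ y v, ψ y v⟫_ℝ :=
          hcont.comp (continuous_id.prodMk continuous_id)
        have c2 : Continuous fun y => ⟪ψ y v, ψ x v⟫_ℝ :=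
          hcont.comp (continuous_id.prodMk continuous_const)
        fun_prop
      simpa using hA.tendsto x
    rw [ContinuousAt, tendsto_iff_norm_sub_tendsto_zero]
    simpa [Real.sqrt_sq] using hc.sqrt
  have hLc : Continuous L := continuous_clm_apply.2 hψc
  have hline : ∀ x v t, HasDerivAt (fun t : ℝ => φ (x + t • v)) (L (x + t • v) v) t := by
    intro x v t
    have h := hψ (x + t • v) v
    have h' : HasDerivAt (fun s : ℝ => φ (x + t • v + (s - t) • v)) (ψ (x + t • v) v) t := by
      have := HasDerivAt.scomp t (g₁ := fun s : ℝ => φ (x + t • v + s • v)) (h := fun s => s - t)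
        (by simpa using h) ((hasDerivAt_id t).sub_const t)
      simpa [Function.comp_def] using this
    refine h'.congr_of_eventuallyEq (Eventually.of_forall fun s => ?_)
    simp only
    congr 1
    module
  -- A directional derivative that is linear in `v` and continuous in `x` is a Fréchet derivative:
  -- the mean value inequality is applied to `t ↦ φ (x + t v) - t L x v`.
  have hF : ∀ x, HasFDerivAt φ (L x) x := by
    intro x
    rw [hasFDerivAt_iff_isLittleO_nhds_zero, Asymptotics.isLittleO_iff]
    intro c hc
    obtain ⟨δ, hδ, hball⟩ := Metric.continuousAt_iff.1 (hLc.continuousAt (x := x)) c hc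
    filter_upwards [Metric.ball_mem_nhds (0 : X) hδ] with v hv
    have hder : ∀ t ∈ Set.Icc (0 : ℝ) 1, HasDerivWithinAt
        (fun t : ℝ => φ (x + t • v) - t • L x v) (L (x + t • v) v - L x v) (Set.Icc 0 1) t := by
      intro t _
      have := (hline x v t).sub ((hasDerivAt_id t).smul_const (L x v))
      rw [one_smul] at this
      exact this.hasDerivWithinAt
    have hb : ∀ t ∈ Set.Ico (0 : ℝ) 1, ‖L (x + t • v) v - L x v‖ ≤ c * ‖v‖ := by
      intro t ht
      rw [← sub_apply]
      refine (ContinuousLinearMap.le_opNorm _ _).trans ?_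
      refine mul_le_mul_of_nonneg_right ?_ (norm_nonneg _)
      rw [← dist_eq_norm]
      refine (hball ?_).le
      rw [dist_self_add_left, norm_smul, Real.norm_of_nonneg ht.1]
      exact (mul_le_of_le_one_left (norm_nonneg _) ht.2.le).trans_lt (by simpa using hv)
    have := norm_image_sub_le_of_norm_deriv_le_segment' hder hb 1 (by simp)
    simp only [one_smul, zero_smul, add_zero, sub_zero, mul_one] at this
    rwa [sub_right_comm] at this
  refine ⟨fun x => (hF x).differentiableAt, fun v => ?_⟩
  have : ∀ x, fderiv ℝ φ x v = ψ x v := fun x => by rw [(hF x).fderiv, hL]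
  simpa only [this] using hsm v

end Feature

/-- Derivatives pass through the continuous linear maps `⟪w, ·⟫`. Thus bounds on the diagonal
derivatives of `K` bound the norms of the derivatives of `φ`, and `η` bounds the difference of the
Gram kernels of two jets. -/
theorem mixedDeriv_eq_inner {d : ℕ} {H : Type*} [NormedAddCommGroup H] [InnerProductSpace ℝ H]
    {φ : E d → H} (hφ : ContDiff ℝ ∞ φ) {K : E d → E d → ℝ} (hK : ∀ x y, ⟪φ x, φ y⟫_ℝ = K x y)
    (α β : MIdx d) (x y : E d) :
    mixedDeriv α β K x y = ⟪vecDeriv α φ x, vecDeriv β φ y⟫_ℝ := by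
  unfold mixedDeriv
  have h1 : ∀ x', multiDeriv β (fun y' => K x' y') y = ⟪vecDeriv β φ y, φ x'⟫_ℝ := by
    intro x'
    have : (fun y' => K x' y') = fun y' => innerSL ℝ (φ x') (φ y') := by
      funext y'; rw [innerSL_apply_apply, hK]
    rw [this, ← vecDeriv_real, vecDeriv_clm (innerSL ℝ (φ x')) hφ]
    simp [real_inner_comm]
  simp only [h1]
  have : (fun x' => ⟪vecDeriv β φ y, φ x'⟫_ℝ) = fun x' => innerSL ℝ (vecDeriv β φ y) (φ x') := by
    funext x'; rw [innerSL_apply_apply]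
  rw [this, ← vecDeriv_real, vecDeriv_clm (innerSL ℝ (vecDeriv β φ y)) hφ]
  simp [real_inner_comm]

theorem exists_smooth_feature {d : ℕ} {K : E d → E d → ℝ} (hK : IsCovKernel K)
    (hs : SmoothKernel K) :
    ∃ (H : Type) (_ : NormedAddCommGroup H) (_ : InnerProductSpace ℝ H) (_ : CompleteSpace H)
      (φ : E d → H), ContDiff ℝ ∞ φ ∧ ∀ x y, ⟪φ x, φ y⟫_ℝ = K x y := by
  obtain ⟨H, _, _, _, φ, hφ⟩ := exists_feature hK
  refine ⟨H, _, _, inferInstance, φ, contDiff_feature ?_, hφ⟩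
  simpa only [hφ] using (show ContDiff ℝ ∞ (fun p : E d × E d => K p.1 p.2) from hs)

end

/-! ### The Powers–Størmer inequality and gluing of Hilbert spaces -/

section

open scoped InnerProductSpace Matrix

section PowersStormer

open scoped MatrixOrder

variable {ι : Type*} [Fintype ι]

theorem exists_isHermitian_sq {S : Matrix ι ι ℝ} (hS : S.PosSemidef) :
    ∃ A : Matrix ι ι ℝ, A.PosSemidef ∧ A * A = S := by
  classical
  exact ⟨CFC.sqrt S, Matrix.nonneg_iff_posSemidef.1 (CFC.sqrt_nonneg S), CFC.sqrt_mul_sqrt_self S hS.nonneg⟩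

theorem trace_mul_self_eq_sum_sq_eigenvalues [DecidableEq ι] {X : Matrix ι ι ℝ}
    (hX : X.IsHermitian) : (X * X).trace = ∑ k, hX.eigenvalues k ^ 2 := by
  have h : X * X = Unitary.conjStarAlgAut ℝ _ hX.eigenvectorUnitary
      (Matrix.diagonal hX.eigenvalues * Matrix.diagonal hX.eigenvalues) := by
    rw [map_mul]
    have := hX.spectral_theorem
    simp only [RCLike.ofReal_real_eq_id, Function.id_comp] at this
    rw [← this]
  rw [h, Unitary.conjStarAlgAut_apply, Matrix.trace_mul_cycle]
  simp [sq]

/-- Put `a = ⟪v, A v⟫ = b + l` and `b = ⟪v, B v⟫`, both nonnegative. The quadratic form of `A² - B²`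
at `v` equals `l (a + b)`, and `a + b ≥ |a - b| = |l|`. -/
theorem sq_eigenvalue_le {A B : Matrix ι ι ℝ} (hA : A.PosSemidef) (hB : B.PosSemidef) {v : ι → ℝ}
    {l : ℝ} (hv : v ⬝ᵥ v = 1) (hl : (A - B) *ᵥ v = l • v) :
    l ^ 2 ≤ |v ⬝ᵥ (A * A - B * B) *ᵥ v| := by
  have hAt : ∀ w, v ⬝ᵥ A *ᵥ w = (A *ᵥ v) ⬝ᵥ w := by
    intro w
    have : Aᵀ = A := by simpa using hA.1.eq
    rw [Matrix.dotProduct_mulVec, ← Matrix.mulVec_transpose, this]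
  have hBt : ∀ w, v ⬝ᵥ B *ᵥ w = (B *ᵥ v) ⬝ᵥ w := by
    intro w
    have : Bᵀ = B := by simpa using hB.1.eq
    rw [Matrix.dotProduct_mulVec, ← Matrix.mulVec_transpose, this]
  have hAB : A *ᵥ v = B *ᵥ v + l • v := by
    rw [← hl, Matrix.sub_mulVec]; abel
  have ha : 0 ≤ v ⬝ᵥ A *ᵥ v := by simpa using hA.dotProduct_mulVec_nonneg v
  have hb : 0 ≤ v ⬝ᵥ B *ᵥ v := by simpa using hB.dotProduct_mulVec_nonneg v
  have hab : v ⬝ᵥ A *ᵥ v = v ⬝ᵥ B *ᵥ v + l := by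
    rw [hAB, dotProduct_add, dotProduct_smul, hv]; simp
  have key : v ⬝ᵥ (A * A - B * B) *ᵥ v = 2 * l * (v ⬝ᵥ B *ᵥ v) + l ^ 2 := by
    rw [Matrix.sub_mulVec, dotProduct_sub, ← Matrix.mulVec_mulVec, ← Matrix.mulVec_mulVec, hAt, hBt,
      hAB]
    simp only [dotProduct_add, add_dotProduct, dotProduct_smul, smul_dotProduct, hv, smul_eq_mul]
    rw [dotProduct_comm (B *ᵥ v) v]
    ring
  rw [key]
  rcases le_total 0 l with h | h
  · exact le_trans (by nlinarith [mul_nonneg h hb]) (le_abs_self _)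
  · exact le_trans (by nlinarith [mul_nonneg (neg_nonneg.2 h) ha]) (neg_le_abs _)

/-- The Powers–Størmer inequality, for matrices that are close in operator norm. -/
theorem exists_gram_coupling {S T : Matrix ι ι ℝ} (hS : S.PosSemidef) (hT : T.PosSemidef) {c : ℝ}
    (hc : ∀ v : ι → ℝ, v ⬝ᵥ v = 1 → |v ⬝ᵥ (S - T) *ᵥ v| ≤ c) :
    ∃ a b : ι → EuclideanSpace ℝ ι, (∀ i j, ⟪a i, a j⟫_ℝ = S i j) ∧ (∀ i j, ⟪b i, b j⟫_ℝ = T i j) ∧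
      ∑ i, ‖a i - b i‖ ^ 2 ≤ Fintype.card ι * c := by
  classical
  obtain ⟨A, hA, hAS⟩ := exists_isHermitian_sq hS
  obtain ⟨B, hB, hBT⟩ := exists_isHermitian_sq hT
  have hAt : ∀ i j, A i j = A j i := fun i j => by simpa using hA.1.apply j i
  have hBt : ∀ i j, B i j = B j i := fun i j => by simpa using hB.1.apply j i
  -- The rows of the positive square roots of `S` and `T` have the required Gram matrices.
  refine ⟨fun i => WithLp.toLp 2 (A i), fun i => WithLp.toLp 2 (B i), ?_, ?_, ?_⟩
  · intro i j
    rw [← hAS, Matrix.mul_apply, PiLp.inner_apply]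
    refine Finset.sum_congr rfl fun k _ => ?_
    simp [hAt k j, mul_comm]
  · intro i j
    rw [← hBT, Matrix.mul_apply, PiLp.inner_apply]
    refine Finset.sum_congr rfl fun k _ => ?_
    simp [hBt k j, mul_comm]
  · have hX : (A - B).IsHermitian := hA.1.sub hB.1
    -- The total squared distance is the squared Hilbert–Schmidt norm of `A - B`, hence the sum of
    -- its squared eigenvalues, each at most `c`.
    have h1 : ∑ i, ‖(WithLp.toLp 2 (A i) - WithLp.toLp 2 (B i) : EuclideanSpace ℝ ι)‖ ^ 2 =
        ((A - B) * (A - B)).trace := by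
      unfold Matrix.trace
      refine Finset.sum_congr rfl fun i _ => ?_
      rw [EuclideanSpace.norm_sq_eq, Matrix.diag_apply, Matrix.mul_apply]
      refine Finset.sum_congr rfl fun k _ => ?_
      simp [hAt k i, hBt k i, sq]
    rw [h1, trace_mul_self_eq_sum_sq_eigenvalues hX]
    refine (Finset.sum_le_card_nsmul _ _ c fun k _ => ?_).trans_eq (by simp)
    have hv : (⇑(hX.eigenvectorBasis k) : ι → ℝ) ⬝ᵥ ⇑(hX.eigenvectorBasis k) = 1 := by
      have := hX.eigenvectorBasis.orthonormal.1 k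
      have h2 : ‖hX.eigenvectorBasis k‖ ^ 2 = 1 := by rw [this]; norm_num
      rw [EuclideanSpace.norm_sq_eq] at h2
      rw [← h2, dotProduct]
      simp [sq]
    refine (sq_eigenvalue_le hA hB hv (hX.mulVec_eigenvectorBasis k)).trans ?_
    rw [hAS, hBT]
    exact hc _ hv

end PowersStormer

section Gluing

variable {H₁ H₂ : Type} [NormedAddCommGroup H₁] [InnerProductSpace ℝ H₁]
  [NormedAddCommGroup H₂] [InnerProductSpace ℝ H₂] {ι : Type*} [Fintype ι]

theorem norm_sum_smul_eq {G₁ G₂ : Type*} [NormedAddCommGroup G₁] [InnerProductSpace ℝ G₁]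
    [NormedAddCommGroup G₂] [InnerProductSpace ℝ G₂] {u : ι → G₁} {a : ι → G₂}
    (h : ∀ i j, ⟪u i, u j⟫_ℝ = ⟪a i, a j⟫_ℝ) (c : ι → ℝ) :
    ‖∑ i, c i • u i‖ = ‖∑ i, c i • a i‖ := by
  rw [← sq_eq_sq₀ (norm_nonneg _) (norm_nonneg _), ← real_inner_self_eq_norm_sq,
    ← real_inner_self_eq_norm_sq]
  simp only [sum_inner, inner_sum, inner_smul_left, inner_smul_right, h]

/-- Families with equal Gram matrices are related by a linear map that is isometric on the span of
the first one. -/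
theorem exists_map_of_gram_eq {G₁ G₂ : Type*} [NormedAddCommGroup G₁] [InnerProductSpace ℝ G₁]
    [NormedAddCommGroup G₂] [InnerProductSpace ℝ G₂] {u : ι → G₁} {a : ι → G₂}
    (h : ∀ i j, ⟪u i, u j⟫_ℝ = ⟪a i, a j⟫_ℝ) :
    ∃ W : (Submodule.span ℝ (Set.range u)) →ₗ[ℝ] G₂, (∀ p, ‖W p‖ = ‖p‖) ∧
      ∀ i, W ⟨u i, Submodule.subset_span ⟨i, rfl⟩⟩ = a i := by
  classical
  set U : (ι → ℝ) →ₗ[ℝ] Submodule.span ℝ (Set.range u) :=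
    (Fintype.linearCombination ℝ u).codRestrict _ (fun c => by
      rw [Fintype.linearCombination_apply]
      exact Submodule.sum_mem _ fun i _ => Submodule.smul_mem _ _
        (Submodule.subset_span ⟨i, rfl⟩)) with hU
  set U' : (ι → ℝ) →ₗ[ℝ] G₂ := Fintype.linearCombination ℝ a with hU'
  have hnorm : ∀ c, ‖U' c‖ = ‖U c‖ := by
    intro c
    rw [Submodule.coe_norm]
    exact (norm_sum_smul_eq h c).symm
  have hsurj : Function.Surjective U := by
    rintro ⟨p, hp⟩
    rw [← Fintype.range_linearCombination (R := ℝ) u] at hp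
    obtain ⟨c, hc⟩ := hp
    exact ⟨c, Subtype.ext hc⟩
  obtain ⟨g, hg⟩ := U.exists_rightInverse_of_surjective (LinearMap.range_eq_top.2 hsurj)
  have hg' : ∀ p, U (g p) = p := fun p => LinearMap.congr_fun hg p
  refine ⟨U' ∘ₗ g, fun p => ?_, fun i => ?_⟩
  · rw [LinearMap.comp_apply, hnorm, hg']
  · set p : Submodule.span ℝ (Set.range u) := ⟨u i, Submodule.subset_span ⟨i, rfl⟩⟩
    have h1 : U (Pi.single i 1) = p := Subtype.ext (by simp [hU, p])
    have h2 : U' (Pi.single i 1) = a i := by simp [hU']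
    rw [LinearMap.comp_apply, ← h2, ← sub_eq_zero, ← map_sub, ← norm_eq_zero, hnorm, map_sub, hg',
      h1, sub_self, norm_zero]

/-- The isometry `h ↦ (W (P h), L (h - P h))`, where `P` is the orthogonal projection onto `p`. -/
def splitIsometry {G₁ G₂ G₃ : Type*} [NormedAddCommGroup G₁] [InnerProductSpace ℝ G₁]
    [NormedAddCommGroup G₂] [InnerProductSpace ℝ G₂] [NormedAddCommGroup G₃]
    [InnerProductSpace ℝ G₃] (p : Submodule ℝ G₁) [p.HasOrthogonalProjection] (W : p →ₗᵢ[ℝ] G₂)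
    (L : G₁ →ₗᵢ[ℝ] G₃) : G₁ →ₗᵢ[ℝ] WithLp 2 (G₂ × G₃) where
  toFun h := WithLp.toLp 2 (W (p.orthogonalProjectionOnto h), L (h - p.orthogonalProjectionOnto h))
  map_add' x y := by
    apply WithLp.ofLp_injective
    refine Prod.ext (by simp) ?_
    simp only [map_add, Submodule.coe_add, WithLp.ofLp_add, Prod.snd_add, map_sub]
    abel
  map_smul' c x := by
    apply WithLp.ofLp_injective
    refine Prod.ext (by simp) ?_
    simp [smul_sub]
  norm_map' x := by
    rw [← sq_eq_sq₀ (norm_nonneg _) (norm_nonneg _), WithLp.prod_norm_sq_eq_of_L2]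
    change ‖W (p.orthogonalProjectionOnto x)‖ ^ 2 + ‖L (x - p.orthogonalProjectionOnto x)‖ ^ 2 = _
    rw [LinearIsometry.norm_map, LinearIsometry.norm_map,
      Submodule.norm_sq_eq_add_norm_sq_projection x p,
      Submodule.orthogonalProjectionOnto_orthogonal, Submodule.coe_norm ⟨_, _⟩]
    rfl

theorem splitIsometry_apply_mem {G₁ G₂ G₃ : Type*} [NormedAddCommGroup G₁] [InnerProductSpace ℝ G₁]
    [NormedAddCommGroup G₂] [InnerProductSpace ℝ G₂] [NormedAddCommGroup G₃]
    [InnerProductSpace ℝ G₃] (p : Submodule ℝ G₁) [p.HasOrthogonalProjection] (W : p →ₗᵢ[ℝ] G₂)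
    (L : G₁ →ₗᵢ[ℝ] G₃) {x : G₁} (hx : x ∈ p) :
    splitIsometry p W L x = WithLp.toLp 2 (W ⟨x, hx⟩, 0) := by
  have h1 : p.orthogonalProjectionOnto x = ⟨x, hx⟩ :=
    Submodule.orthogonalProjectionOnto_mem_subspace_eq_self (⟨x, hx⟩ : p)
  change WithLp.toLp 2 (W (p.orthogonalProjectionOnto x),
    L (x - p.orthogonalProjectionOnto x)) = _
  rw [h1]
  simp

/-- The inclusion of the first factor in the Hilbert sum. -/
def inlIsometry (G₁ G₂ : Type*) [NormedAddCommGroup G₁] [InnerProductSpace ℝ G₁]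
    [NormedAddCommGroup G₂] [InnerProductSpace ℝ G₂] : G₁ →ₗᵢ[ℝ] WithLp 2 (G₁ × G₂) where
  toFun x := WithLp.toLp 2 (x, 0)
  map_add' x y := WithLp.ofLp_injective 2 (by simp)
  map_smul' c x := WithLp.ofLp_injective 2 (by simp)
  norm_map' x := by simp

/-- The inclusion of the second factor in the Hilbert sum. -/
def inrIsometry (G₁ G₂ : Type*) [NormedAddCommGroup G₁] [InnerProductSpace ℝ G₁]
    [NormedAddCommGroup G₂] [InnerProductSpace ℝ G₂] : G₂ →ₗᵢ[ℝ] WithLp 2 (G₁ × G₂) where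
  toFun x := WithLp.toLp 2 (0, x)
  map_add' x y := WithLp.ofLp_injective 2 (by simp)
  map_smul' c x := WithLp.ofLp_injective 2 (by simp)
  norm_map' x := by simp

/-- The span of `u` is carried to the vectors `a`, the span of `w` to the vectors `b`. The
orthogonal complements go to the separate summands `H₁` and `H₂`, so both maps are isometries of the
whole spaces. -/
theorem exists_isometry_pair (u : ι → H₁) (w : ι → H₂) (a b : ι → EuclideanSpace ℝ ι)
    (ha : ∀ i j, ⟪u i, u j⟫_ℝ = ⟪a i, a j⟫_ℝ) (hb : ∀ i j, ⟪w i, w j⟫_ℝ = ⟪b i, b j⟫_ℝ) :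
    ∃ (I : H₁ →ₗᵢ[ℝ] WithLp 2 (EuclideanSpace ℝ ι × WithLp 2 (H₁ × H₂)))
      (J : H₂ →ₗᵢ[ℝ] WithLp 2 (EuclideanSpace ℝ ι × WithLp 2 (H₁ × H₂))),
      ∀ i, ‖I (u i) - J (w i)‖ = ‖a i - b i‖ := by
  obtain ⟨W, hW, hWu⟩ := exists_map_of_gram_eq ha
  obtain ⟨W', hW', hWw⟩ := exists_map_of_gram_eq hb
  have : FiniteDimensional ℝ (Submodule.span ℝ (Set.range u)) :=
    FiniteDimensional.span_of_finite ℝ (Set.finite_range u)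
  have : FiniteDimensional ℝ (Submodule.span ℝ (Set.range w)) :=
    FiniteDimensional.span_of_finite ℝ (Set.finite_range w)
  refine ⟨splitIsometry _ ⟨W, hW⟩ (inlIsometry H₁ H₂), splitIsometry _ ⟨W', hW'⟩
    (inrIsometry H₁ H₂), fun i => ?_⟩
  have hu : u i ∈ Submodule.span ℝ (Set.range u) := Submodule.subset_span ⟨i, rfl⟩
  have hw : w i ∈ Submodule.span ℝ (Set.range w) := Submodule.subset_span ⟨i, rfl⟩
  rw [splitIsometry_apply_mem _ _ _ hu, splitIsometry_apply_mem _ _ _ hw]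
  simp only [LinearIsometry.coe_mk, hWu, hWw]
  rw [← WithLp.toLp_sub, Prod.mk_sub_mk, sub_zero,
    ← sq_eq_sq₀ (norm_nonneg _) (norm_nonneg _), WithLp.prod_norm_sq_eq_of_L2]
  simp

end Gluing

end

/-! ### Coupling two vector-valued functions with close Gram kernels -/

section

open scoped InnerProductSpace Matrix

section Projection

variable {Z : Type*} [MeasurableSpace Z] {ν : Measure Z} {κ : Type*} [Fintype κ]
  {G : Type*} [NormedAddCommGroup G] [InnerProductSpace ℝ G]

theorem memLp_two_integrable_smul {f : Z → ℝ} {F : Z → G} (hf : MemLp f 2 ν) (hF : MemLp F 2 ν) :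
    Integrable (fun z => f z • F z) ν :=
  memLp_one_iff_integrable.1 (hF.smul hf)

theorem memLp_two_sum_smul {e : κ → Z → ℝ} (he : ∀ i, MemLp (e i) 2 ν) (a : κ → G) :
    MemLp (fun z => ∑ i, e i z • a i) 2 ν := by
  refine memLp_finsetSum _ fun i _ => ?_
  have h : MemLp (fun z => ‖a i‖ * e i z) 2 ν := (he i).const_mul _
  refine h.of_le ((he i).1.smul_const _) (Filter.Eventually.of_forall fun z => ?_)
  rw [norm_smul, norm_mul, norm_norm, mul_comm]

/-- Pythagoras for the projection onto the span of the `e i`. With the true coefficients as `a` it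
computes the residual; with general `a` it shows that they are the best choice. -/
theorem integral_norm_sq_sub_projection [CompleteSpace G] {e : κ → Z → ℝ}
    (he : ∀ i, MemLp (e i) 2 ν) [DecidableEq κ]
    (ho : ∀ i j, ∫ z, e i z * e j z ∂ν = if i = j then 1 else 0) {F : Z → G} (hF : MemLp F 2 ν)
    (a : κ → G) :
    ∫ z, ‖F z - ∑ i, e i z • a i‖ ^ 2 ∂ν = (∫ z, ‖F z‖ ^ 2 ∂ν) - ∑ i, ‖∫ z, e i z • F z ∂ν‖ ^ 2 +
      ∑ i, ‖(∫ z, e i z • F z ∂ν) - a i‖ ^ 2 := by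
  have h1 : ∀ z, ‖F z - ∑ i, e i z • a i‖ ^ 2 = ‖F z‖ ^ 2 - 2 * ∑ i, ⟪a i, e i z • F z⟫_ℝ +
      ∑ i, ∑ j, (e i z * e j z) * ⟪a i, a j⟫_ℝ := by
    intro z
    rw [norm_sub_sq_real, ← real_inner_self_eq_norm_sq (∑ i, e i z • a i)]
    simp only [sum_inner, inner_sum, inner_smul_left, inner_smul_right, RCLike.conj_to_real]
    congr 1
    · congr 2
      exact Finset.sum_congr rfl fun i _ => by rw [real_inner_comm]
    · rw [Finset.sum_comm]
      refine Finset.sum_congr rfl fun i _ => ?_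
      rw [Finset.mul_sum]
      exact Finset.sum_congr rfl fun j _ => by ring
  have hi1 : Integrable (fun z => ‖F z‖ ^ 2) ν := hF.integrable_norm_pow two_ne_zero
  have hi2 : ∀ i, Integrable (fun z => ⟪a i, e i z • F z⟫_ℝ) ν := fun i =>
    (memLp_two_integrable_smul (he i) hF).const_inner _
  have hi3 : ∀ i j, Integrable (fun z => e i z * e j z * ⟪a i, a j⟫_ℝ) ν := fun i j =>
    (memLp_two_integrable_smul (he i) (he j)).mul_const _
  have hi4 : Integrable (fun z => 2 * ∑ i, ⟪a i, e i z • F z⟫_ℝ) ν :=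
    (integrable_finsetSum _ fun i _ => hi2 i).const_mul _
  have hi5 : Integrable (fun z => ‖F z‖ ^ 2 - 2 * ∑ i, ⟪a i, e i z • F z⟫_ℝ) ν := hi1.sub hi4
  simp only [h1]
  rw [integral_add hi5
    (integrable_finsetSum _ fun i _ => integrable_finsetSum _ fun j _ => hi3 i j),
    integral_sub hi1 hi4,
    integral_const_mul, integral_finsetSum _ fun i _ => hi2 i,
    integral_finsetSum _ fun i _ => integrable_finsetSum _ fun j _ => hi3 i j]
  have h4 : ∀ i, ∫ z, ∑ j, e i z * e j z * ⟪a i, a j⟫_ℝ ∂ν = ‖a i‖ ^ 2 := by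
    intro i
    rw [integral_finsetSum _ fun j _ => hi3 i j]
    simp only [integral_mul_const, ho, ite_mul, one_mul, zero_mul, Finset.sum_ite_eq,
      Finset.mem_univ, if_true, real_inner_self_eq_norm_sq]
  have h5 : ∀ i, ∫ z, ⟪a i, e i z • F z⟫_ℝ ∂ν = ⟪a i, ∫ z, e i z • F z ∂ν⟫_ℝ := fun i =>
    integral_inner (memLp_two_integrable_smul (he i) hF) _
  simp only [h4, h5, norm_sub_sq_real, Finset.sum_add_distrib, Finset.sum_sub_distrib,
    ← Finset.mul_sum]
  simp only [real_inner_comm]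
  ring

/-- Cauchy–Schwarz, read off from the nonnegative integral of `(V |f| - m)²`. -/
theorem sq_integral_abs_le [IsFiniteMeasure ν] {f : Z → ℝ} (hf : MemLp f 2 ν) :
    (∫ z, |f z| ∂ν) ^ 2 ≤ ν.real Set.univ * ∫ z, f z ^ 2 ∂ν := by
  set m := ∫ z, |f z| ∂ν
  set V := ν.real Set.univ with hV
  have hi : Integrable f ν := hf.integrable (by norm_num)
  have hi2 : Integrable (fun z => f z ^ 2) ν := hf.integrable_sq
  have h1 : 0 ≤ ∫ z, (V * |f z| - m) ^ 2 ∂ν := integral_nonneg fun z => sq_nonneg _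
  have h2 : ∫ z, (V * |f z| - m) ^ 2 ∂ν = V ^ 2 * (∫ z, f z ^ 2 ∂ν) - 2 * V * m * m + m ^ 2 * V := by
    have : ∀ z, (V * |f z| - m) ^ 2 = V ^ 2 * f z ^ 2 - 2 * V * m * |f z| + m ^ 2 := by
      intro z
      rw [← sq_abs (f z)]; ring
    have hi3 : Integrable (fun z => V ^ 2 * f z ^ 2 - 2 * V * m * |f z|) ν :=
      (hi2.const_mul _).sub (hi.abs.const_mul _)
    simp only [this]
    rw [integral_add hi3 (integrable_const _),
      integral_sub (hi2.const_mul _) (hi.abs.const_mul _), integral_const_mul, integral_const_mul,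
      integral_const, smul_eq_mul, mul_comm V]
  have hV0 : 0 ≤ V := measureReal_nonneg
  rcases hV0.eq_or_lt with h0 | hpos
  · have hν : ν = 0 := by
      rw [← Measure.measure_univ_eq_zero, ← measureReal_eq_zero_iff]
      exact h0.symm
    have : m = 0 := by simp [m, hν]
    rw [this, ← h0]; simp
  · rw [h2] at h1
    by_contra! hc
    nlinarith

end Projection

/-- An orthonormal basis of the span of the `v k` in `L²` has at most as many members, and
combinations of the `v k` with vector coefficients are re-expanded in it. -/
theorem exists_orthonormal_span {Z : Type*} [MeasurableSpace Z] {ν : Measure Z}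
    {H₁ : Type*} [NormedAddCommGroup H₁] [InnerProductSpace ℝ H₁] {ι : Type*} [Fintype ι] {v : ι → Z → ℝ}
    (hv : ∀ k, MemLp (v k) 2 ν) (h : ι → H₁) :
    ∃ (n : ℕ) (e : Fin n → Z → ℝ) (a : Fin n → H₁), n ≤ Fintype.card ι ∧ (∀ i, MemLp (e i) 2 ν) ∧
      (∀ i j, ∫ z, e i z * e j z ∂ν = if i = j then 1 else 0) ∧
      ∀ᵐ z ∂ν, ∑ k, v k z • h k = ∑ i, e i z • a i := by
  set p := Submodule.span ℝ (Set.range fun k => (hv k).toLp (v k)) with hp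
  have : FiniteDimensional ℝ p := FiniteDimensional.span_of_finite ℝ (Set.finite_range _)
  obtain ⟨n, hn, ⟨b⟩⟩ : ∃ n ≤ Fintype.card ι, Nonempty (OrthonormalBasis (Fin n) ℝ p) :=
    ⟨_, finrank_range_le_card _, ⟨stdOrthonormalBasis ℝ p⟩⟩
  have hmem : ∀ k, (hv k).toLp (v k) ∈ p := fun k => Submodule.subset_span ⟨k, rfl⟩
  refine ⟨n, fun i => ((b i : p) : Lp ℝ 2 ν),
    fun i => ∑ k, (b.repr ⟨_, hmem k⟩ i) • h k, hn, fun i => Lp.memLp _,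
    fun i j => ?_, ?_⟩
  · have h1 := orthonormal_iff_ite.1 b.orthonormal i j
    rw [Submodule.coe_inner, L2.inner_def] at h1
    rw [← h1]
    refine integral_congr_ae (Filter.Eventually.of_forall fun z => ?_)
    simp only [RCLike.inner_apply, RCLike.conj_to_real]
    exact mul_comm _ _
  · have hexp : ∀ k, ∀ᵐ z ∂ν, v k z = ∑ i, b.repr ⟨_, hmem k⟩ i * ((b i : p) : Lp ℝ 2 ν) z := by
      intro k
      have h1 := congrArg (Subtype.val) (b.sum_repr ⟨_, hmem k⟩)
      simp only [Submodule.coe_sum, Submodule.coe_smul] at h1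
      have h2 : ((hv k).toLp (v k) : Z → ℝ) =ᵐ[ν] fun z =>
          ∑ i, b.repr ⟨_, hmem k⟩ i * ((b i : p) : Lp ℝ 2 ν) z := by
        conv_lhs => rw [← h1]
        refine (Lp.coeFn_finsetSum _ _).trans ?_
        have h3 : ∀ᵐ z ∂ν, ∀ i, ((b.repr ⟨_, hmem k⟩ i • ((b i : p) : Lp ℝ 2 ν) : Lp ℝ 2 ν)) z =
            b.repr ⟨_, hmem k⟩ i * ((b i : p) : Lp ℝ 2 ν) z := by
          rw [ae_all_iff]
          intro i
          filter_upwards [Lp.coeFn_smul (b.repr ⟨_, hmem k⟩ i) ((b i : p) : Lp ℝ 2 ν)] with z hz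
          rw [hz]; rfl
        filter_upwards [h3] with z hz
        rw [Finset.sum_apply]
        exact Finset.sum_congr rfl fun i _ => hz i
      filter_upwards [h2, (hv k).coeFn_toLp] with z hz1 hz2
      rw [← hz2, hz1]
    filter_upwards [ae_all_iff.2 hexp] with z hz
    simp only [Finset.smul_sum, smul_smul]
    rw [Finset.sum_comm]
    refine Finset.sum_congr rfl fun k _ => ?_
    rw [← Finset.sum_smul]
    congr 1
    rw [hz k]
    exact Finset.sum_congr rfl fun i _ => mul_comm _ _

section AbstractCoupling

variable {Z : Type*} [MeasurableSpace Z] {ν : Measure Z} [IsFiniteMeasure ν]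
  {H₁ H₂ : Type} [NormedAddCommGroup H₁] [InnerProductSpace ℝ H₁] [CompleteSpace H₁]
  [NormedAddCommGroup H₂] [InnerProductSpace ℝ H₂] [CompleteSpace H₂]

/-- The difference is the double integral of `f z * f z'` against the difference of the Gram
kernels, hence at most `η (∫ |f|)²`; Cauchy–Schwarz finishes. -/
theorem abs_norm_sq_integral_sub_le {Φ : Z → H₁} {Ψ : Z → H₂} (hΦ : MemLp Φ 2 ν)
    (hΨ : MemLp Ψ 2 ν) {s : Set Z} (hs : ∀ᵐ z ∂ν, z ∈ s) {η : ℝ} (hη : 0 ≤ η)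
    (hd : ∀ z ∈ s, ∀ z' ∈ s, |⟪Φ z, Φ z'⟫_ℝ - ⟪Ψ z, Ψ z'⟫_ℝ| ≤ η) {f : Z → ℝ} (hf : MemLp f 2 ν) :
    |‖∫ z, f z • Φ z ∂ν‖ ^ 2 - ‖∫ z, f z • Ψ z ∂ν‖ ^ 2| ≤
      η * ν.real Set.univ * ∫ z, f z ^ 2 ∂ν := by
  have hiΦ := memLp_two_integrable_smul hf hΦ
  have hiΨ := memLp_two_integrable_smul hf hΨ
  have hi : Integrable f ν := hf.integrable (by norm_num)
  have e1 : ‖∫ z, f z • Φ z ∂ν‖ ^ 2 = ∫ z, ⟪∫ z, f z • Φ z ∂ν, f z • Φ z⟫_ℝ ∂ν := by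
    rw [integral_inner hiΦ, real_inner_self_eq_norm_sq]
  have e2 : ‖∫ z, f z • Ψ z ∂ν‖ ^ 2 = ∫ z, ⟪∫ z, f z • Ψ z ∂ν, f z • Ψ z⟫_ℝ ∂ν := by
    rw [integral_inner hiΨ, real_inner_self_eq_norm_sq]
  rw [e1, e2, ← integral_sub (hiΦ.const_inner _) (hiΨ.const_inner _), mul_assoc]
  have hpt : ∀ᵐ z ∂ν, ‖⟪∫ z, f z • Φ z ∂ν, f z • Φ z⟫_ℝ - ⟪∫ z, f z • Ψ z ∂ν, f z • Ψ z⟫_ℝ‖ ≤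
      |f z| * (η * ∫ z, |f z| ∂ν) := by
    filter_upwards [hs] with z hz
    rw [real_inner_comm, ← integral_inner hiΦ, real_inner_comm, ← integral_inner hiΨ,
      ← integral_sub (hiΦ.const_inner _) (hiΨ.const_inner _), ← integral_const_mul,
      ← integral_const_mul]
    refine norm_integral_le_of_norm_le ((hi.abs.const_mul _).const_mul _) ?_
    filter_upwards [hs] with z' hz'
    simp only [inner_smul_left, inner_smul_right, RCLike.conj_to_real]
    rw [← mul_sub, ← mul_sub, norm_mul, norm_mul, Real.norm_eq_abs, Real.norm_eq_abs,
      Real.norm_eq_abs]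
    have h := hd z hz z' hz'
    calc |f z'| * (|f z| * |⟪Φ z, Φ z'⟫_ℝ - ⟪Ψ z, Ψ z'⟫_ℝ|) ≤ |f z'| * (|f z| * η) := by gcongr
      _ = _ := by ring
  refine (norm_integral_le_of_norm_le (hi.abs.mul_const _) hpt).trans ?_
  rw [integral_mul_const]
  have := mul_le_mul_of_nonneg_left (sq_integral_abs_le hf) hη
  linarith

/-- The coefficients of `Φ` and `Ψ` along the `e i` are aligned by Powers–Størmer, at cost `|κ| η
V`. The residuals are not aligned at all and are merely estimated by their norms. -/
theorem exists_coupling_of_orthonormal {κ : Type*} [Fintype κ] [DecidableEq κ] {e : κ → Z → ℝ}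
    (he : ∀ i, MemLp (e i) 2 ν)
    (ho : ∀ i j, ∫ z, e i z * e j z ∂ν = if i = j then 1 else 0)
    {Φ : Z → H₁} {Ψ : Z → H₂} (hΦ : MemLp Φ 2 ν)
    (hΨ : MemLp Ψ 2 ν) {s : Set Z} (hs : ∀ᵐ z ∂ν, z ∈ s) {η τ : ℝ} (hη : 0 ≤ η)
    (hd : ∀ z ∈ s, ∀ z' ∈ s, |⟪Φ z, Φ z'⟫_ℝ - ⟪Ψ z, Ψ z'⟫_ℝ| ≤ η) (a : κ → H₁)
    (hτ : ∫ z, ‖Φ z - ∑ i, e i z • a i‖ ^ 2 ∂ν ≤ τ) :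
    ∃ (I : H₁ →ₗᵢ[ℝ] WithLp 2 (EuclideanSpace ℝ κ × WithLp 2 (H₁ × H₂)))
      (J : H₂ →ₗᵢ[ℝ] WithLp 2 (EuclideanSpace ℝ κ × WithLp 2 (H₁ × H₂))),
      ∫ z, ‖I (Φ z) - J (Ψ z)‖ ^ 2 ∂ν ≤
        4 * τ + 2 * (η * ν.real Set.univ) + 3 * (Fintype.card κ * (η * ν.real Set.univ)) := by
  set V := ν.real Set.univ
  set u : κ → H₁ := fun i => ∫ z, e i z • Φ z ∂ν with hu
  set w : κ → H₂ := fun i => ∫ z, e i z • Ψ z ∂ν with hw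
  have hquad : ∀ v : κ → ℝ, v ⬝ᵥ v = 1 → |‖∑ i, v i • u i‖ ^ 2 - ‖∑ i, v i • w i‖ ^ 2| ≤ η * V := by
    intro v hv
    have hf : MemLp (fun z => ∑ i, v i * e i z) 2 ν :=
      memLp_finsetSum _ fun i _ => (he i).const_mul _
    have h := abs_norm_sq_integral_sub_le hΦ hΨ hs hη hd hf
    have h1 : ∫ z, (∑ i, v i * e i z) • Φ z ∂ν = ∑ i, v i • u i := by
      have hint : ∀ i, Integrable (fun z => v i • e i z • Φ z) ν := fun i =>
        (memLp_two_integrable_smul (he i) hΦ).smul (v i)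
      simp only [Finset.sum_smul, mul_smul]
      rw [integral_finsetSum _ fun i _ => hint i]
      simp only [integral_smul, hu]
    have h2 : ∫ z, (∑ i, v i * e i z) • Ψ z ∂ν = ∑ i, v i • w i := by
      have hint : ∀ i, Integrable (fun z => v i • e i z • Ψ z) ν := fun i =>
        (memLp_two_integrable_smul (he i) hΨ).smul (v i)
      simp only [Finset.sum_smul, mul_smul]
      rw [integral_finsetSum _ fun i _ => hint i]
      simp only [integral_smul, hw]
    have h3 : ∫ z, (∑ i, v i * e i z) ^ 2 ∂ν = 1 := by
      have hexp : ∀ z, (∑ i, v i * e i z) ^ 2 = ∑ i, ∑ j, v i * v j * (e i z * e j z) := by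
        intro z
        rw [sq, Finset.sum_mul_sum]
        exact Finset.sum_congr rfl fun i _ => Finset.sum_congr rfl fun j _ => by ring
      have hint : ∀ i j, Integrable (fun z => v i * v j * (e i z * e j z)) ν := fun i j =>
        (memLp_two_integrable_smul (he i) (he j)).const_mul _
      simp only [hexp]
      rw [integral_finsetSum _ fun i _ => integrable_finsetSum _ fun j _ => hint i j, ← hv]
      refine Finset.sum_congr rfl fun i _ => ?_
      rw [integral_finsetSum _ fun j _ => hint i j]
      simp [integral_const_mul, ho]
    rw [h1, h2, h3, mul_one] at h
    exact h
  have hgram : ∀ {G : Type} [NormedAddCommGroup G] [InnerProductSpace ℝ G] (x : κ → G)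
      (v : κ → ℝ), v ⬝ᵥ (Matrix.of fun i j => ⟪x i, x j⟫_ℝ) *ᵥ v = ‖∑ i, v i • x i‖ ^ 2 := by
    intro G _ _ x v
    rw [← real_inner_self_eq_norm_sq]
    simp only [sum_inner, inner_sum, inner_smul_left, inner_smul_right, RCLike.conj_to_real,
      dotProduct, Matrix.mulVec, Matrix.of_apply, Finset.mul_sum]
    refine Finset.sum_congr rfl fun i _ => Finset.sum_congr rfl fun j _ => ?_
    rw [real_inner_comm]
    ring
  have hpos : ∀ {G : Type} [NormedAddCommGroup G] [InnerProductSpace ℝ G] (x : κ → G),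
      (Matrix.of fun i j => ⟪x i, x j⟫_ℝ).PosSemidef := by
    intro G _ _ x
    refine Matrix.PosSemidef.of_dotProduct_mulVec_nonneg ?_ fun v => ?_
    · ext i j
      simp [real_inner_comm]
    · rw [star_trivial, hgram]
      positivity
  obtain ⟨a', b', ha', hb', hab⟩ := exists_gram_coupling (hpos u) (hpos w) (c := η * V) (by
    intro v hv
    rw [Matrix.sub_mulVec, dotProduct_sub, hgram, hgram]
    exact hquad v hv)
  obtain ⟨I, J, hIJ⟩ := exists_isometry_pair u w a' b' (fun i j => (ha' i j).symm)
    (fun i j => (hb' i j).symm)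
  refine ⟨I, J, ?_⟩
  have hF : MemLp (fun z => I (Φ z) - J (Ψ z)) 2 ν :=
    (I.toContinuousLinearMap.comp_memLp' hΦ).sub (J.toContinuousLinearMap.comp_memLp' hΨ)
  have hc : ∀ i, ∫ z, e i z • (I (Φ z) - J (Ψ z)) ∂ν = I (u i) - J (w i) := by
    intro i
    have h1 := I.toContinuousLinearMap.integral_comp_comm (memLp_two_integrable_smul (he i) hΦ)
    have h2 := J.toContinuousLinearMap.integral_comp_comm (memLp_two_integrable_smul (he i) hΨ)
    simp only [LinearIsometry.coe_toContinuousLinearMap] at h1 h2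
    rw [hu, hw]
    simp only
    rw [← h1, ← h2, ← integral_sub]
    · refine integral_congr_ae (Filter.Eventually.of_forall fun z => ?_)
      simp [smul_sub]
    · exact I.toContinuousLinearMap.integrable_comp (memLp_two_integrable_smul (he i) hΦ)
    · exact J.toContinuousLinearMap.integrable_comp (memLp_two_integrable_smul (he i) hΨ)
  have hPF := integral_norm_sq_sub_projection he ho hF (fun i => I (u i) - J (w i))
  simp only [hc, sub_self, norm_zero] at hPF
  have hPΦ := integral_norm_sq_sub_projection he ho hΦ u
  have hPa := integral_norm_sq_sub_projection he ho hΦ a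
  have hPΨ := integral_norm_sq_sub_projection he ho hΨ w
  have hmΦ : MemLp (fun z => Φ z - ∑ i, e i z • u i) 2 ν := hΦ.sub (memLp_two_sum_smul he u)
  have hmΨ : MemLp (fun z => Ψ z - ∑ i, e i z • w i) 2 ν := hΨ.sub (memLp_two_sum_smul he w)
  have hiΦ := hmΦ.integrable_norm_pow two_ne_zero
  have hiΨ := hmΨ.integrable_norm_pow two_ne_zero
  -- What remains after projection is bounded by twice the residual of `Φ` plus twice that of `Ψ`.
  have hle : ∫ z, ‖I (Φ z) - J (Ψ z) - ∑ i, e i z • (I (u i) - J (w i))‖ ^ 2 ∂ν ≤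
      2 * (∫ z, ‖Φ z - ∑ i, e i z • u i‖ ^ 2 ∂ν) + 2 * ∫ z, ‖Ψ z - ∑ i, e i z • w i‖ ^ 2 ∂ν := by
    rw [← integral_const_mul, ← integral_const_mul, ← integral_add (hiΦ.const_mul _)
      (hiΨ.const_mul _)]
    refine integral_mono_of_nonneg (Filter.Eventually.of_forall fun z => by positivity)
      ((hiΦ.const_mul _).add (hiΨ.const_mul _)) (Filter.Eventually.of_forall fun z => ?_)
    have hz : I (Φ z) - J (Ψ z) - ∑ i, e i z • (I (u i) - J (w i)) =
        I (Φ z - ∑ i, e i z • u i) - J (Ψ z - ∑ i, e i z • w i) := by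
      simp only [map_sub, map_sum, map_smul, smul_sub, Finset.sum_sub_distrib]
      abel
    simp only
    rw [hz]
    have h1 := norm_sub_le (I (Φ z - ∑ i, e i z • u i)) (J (Ψ z - ∑ i, e i z • w i))
    rw [LinearIsometry.norm_map, LinearIsometry.norm_map] at h1
    have h2 := pow_le_pow_left₀ (norm_nonneg _) h1 2
    nlinarith [sq_nonneg (‖Φ z - ∑ i, e i z • u i‖ - ‖Ψ z - ∑ i, e i z • w i‖)]
  have hdiag : ∀ i, |‖u i‖ ^ 2 - ‖w i‖ ^ 2| ≤ η * V := by
    intro i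
    simpa [Pi.single_apply, ite_smul] using hquad (Pi.single i 1) (by simp)
  have hsum : ∑ i, ‖u i‖ ^ 2 - ∑ i, ‖w i‖ ^ 2 ≤ Fintype.card κ * (η * V) := by
    rw [← Finset.sum_sub_distrib]
    refine (Finset.sum_le_card_nsmul _ _ _ fun i _ => (le_abs_self _).trans (hdiag i)).trans_eq ?_
    simp
  -- The residual of `Ψ` is its total energy minus its captured energy. `hnorm` compares the totals
  -- and `hsum` the captured parts with those of `Φ`, so it exceeds the residual of `Φ` by at most
  -- `ηV + |κ| ηV`.
  have hnorm : (∫ z, ‖Ψ z‖ ^ 2 ∂ν) - ∫ z, ‖Φ z‖ ^ 2 ∂ν ≤ η * V := by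
    have hj1 := hΨ.integrable_norm_pow two_ne_zero
    have hj2 := hΦ.integrable_norm_pow two_ne_zero
    rw [← integral_sub hj1 hj2]
    have : η * V = ∫ _, η ∂ν := by simp [V, mul_comm]
    rw [this]
    refine integral_mono_ae (hj1.sub hj2) (integrable_const _) ?_
    filter_upwards [hs] with z hz
    have := hd z hz z hz
    rw [real_inner_self_eq_norm_sq, real_inner_self_eq_norm_sq, abs_sub_comm] at this
    exact (le_abs_self _).trans this
  have hcsum : ∑ i, ‖I (u i) - J (w i)‖ ^ 2 ≤ Fintype.card κ * (η * V) := by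
    simpa only [hIJ] using hab
  simp only [hu, hw, sub_self, norm_zero] at hPΦ hPΨ hle hsum hcsum hPF
  have hnn : 0 ≤ ∑ i, ‖(∫ z, e i z • Φ z ∂ν) - a i‖ ^ 2 :=
    Finset.sum_nonneg fun i _ => sq_nonneg _
  simp only [ne_eq, OfNat.ofNat_ne_zero, not_false_eq_true, zero_pow, Finset.sum_const_zero,
    add_zero] at hPΦ hPΨ hPF
  -- The budget: `2τ` from `Φ`, `2(τ + ηV + |κ| ηV)` from `Ψ`, and `|κ| ηV` from the aligned
  -- coefficients.
  linarith

theorem exists_coupling {ι : Type*} [Fintype ι] {v : ι → Z → ℝ}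
    (hv : ∀ k, MemLp (v k) 2 ν) (h : ι → H₁)
    {Φ : Z → H₁} {Ψ : Z → H₂} (hΦ : MemLp Φ 2 ν)
    (hΨ : MemLp Ψ 2 ν) {s : Set Z} (hs : ∀ᵐ z ∂ν, z ∈ s) {η τ : ℝ} (hη : 0 ≤ η)
    (hd : ∀ z ∈ s, ∀ z' ∈ s, |⟪Φ z, Φ z'⟫_ℝ - ⟪Ψ z, Ψ z'⟫_ℝ| ≤ η)
    (hτ : ∫ z, ‖Φ z - ∑ k, v k z • h k‖ ^ 2 ∂ν ≤ τ) :
    ∃ (H : Type) (_ : NormedAddCommGroup H) (_ : InnerProductSpace ℝ H) (_ : CompleteSpace H)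
      (I : H₁ →ₗᵢ[ℝ] H) (J : H₂ →ₗᵢ[ℝ] H),
      ∫ z, ‖I (Φ z) - J (Ψ z)‖ ^ 2 ∂ν ≤
        4 * τ + 2 * (η * ν.real Set.univ) + 3 * (Fintype.card ι * (η * ν.real Set.univ)) := by
  obtain ⟨n, e, a, hn, he, ho, hea⟩ := exists_orthonormal_span hv h
  have hτ' : ∫ z, ‖Φ z - ∑ i, e i z • a i‖ ^ 2 ∂ν ≤ τ := by
    refine hτ.trans_eq' (integral_congr_ae ?_)
    filter_upwards [hea] with z hz
    rw [hz]
  obtain ⟨I, J, hIJ⟩ := exists_coupling_of_orthonormal he ho hΦ hΨ hs hη hd a hτ'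
  refine ⟨_, _, _, inferInstance, I, J, hIJ.trans ?_⟩
  have : 0 ≤ η * ν.real Set.univ := mul_nonneg hη measureReal_nonneg
  have hn' : (Fintype.card (Fin n) : ℝ) ≤ Fintype.card ι := by
    rw [Fintype.card_fin]; exact_mod_cast hn
  have := mul_le_mul_of_nonneg_right hn' this
  linarith

end AbstractCoupling

end

/-! ### Coupling of jets -/

section

open scoped InnerProductSpace

section JetCoupling

variable {d : ℕ} {H₁ H₂ : Type} [NormedAddCommGroup H₁] [InnerProductSpace ℝ H₁] [CompleteSpace H₁]
  [NormedAddCommGroup H₂] [InnerProductSpace ℝ H₂] [CompleteSpace H₂]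

/-- The measure on pairs of a multi-index in `S(M)` and a point of `B_R`. -/
abbrev jetMeasure (d M : ℕ) (R : ℝ) : Measure (multiIndices d M × E d) :=
  Measure.count.prod (volume.restrict (Metric.ball 0 R))

instance isFiniteMeasure_jetMeasure (d M : ℕ) (R : ℝ) : IsFiniteMeasure (jetMeasure d M R) := by
  have : IsFiniteMeasure ((volume : Measure (E d)).restrict (Metric.ball 0 R)) :=
    ⟨by rw [Measure.restrict_apply_univ]; exact measure_ball_lt_top⟩
  infer_instance

theorem jetMeasure_real_univ (d M : ℕ) (R : ℝ) : (jetMeasure d M R).real Set.univ =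
    (multiIndices d M).card * volume.real (Metric.ball (0 : E d) R) := by
  rw [Measure.real, ← Set.univ_prod_univ, Measure.prod_prod, ENNReal.toReal_mul]
  simp [Measure.real, Measure.count_apply]

theorem ae_jetMeasure_mem (d M : ℕ) (R : ℝ) :
    ∀ᵐ z ∂(jetMeasure d M R), z.2 ∈ Metric.ball (0 : E d) R :=
  Measure.quasiMeasurePreserving_snd.ae (self_mem_ae_restrict measurableSet_ball)

theorem continuous_jet {H : Type*} [NormedAddCommGroup H] [NormedSpace ℝ H] {φ : E d → H}
    (hφ : ContDiff ℝ ∞ φ) (M : ℕ) :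
    Continuous fun z : multiIndices d M × E d => vecDeriv z.1.1 φ z.2 :=
  continuous_prod_of_discrete_left.2 fun α => (vecDeriv_contDiff α.1 hφ).continuous

theorem memLp_jet {H : Type*} [NormedAddCommGroup H] [NormedSpace ℝ H] {φ : E d → H}
    (hφ : ContDiff ℝ ∞ φ) (M : ℕ) (R : ℝ) :
    MemLp (fun z : multiIndices d M × E d => vecDeriv z.1.1 φ z.2) 2 (jetMeasure d M R) := by
  have hb : ∀ α : multiIndices d M, ∃ c, ∀ x ∈ Metric.closedBall (0 : E d) R,
      ‖vecDeriv α.1 φ x‖ ≤ c := fun α =>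
    (isCompact_closedBall 0 R).exists_bound_of_continuousOn
      (vecDeriv_contDiff α.1 hφ).continuous.continuousOn
  choose c hc using hb
  refine MemLp.of_bound (continuous_jet hφ M).aestronglyMeasurable (∑ α, |c α|) ?_
  filter_upwards [ae_jetMeasure_mem d M R] with z hz
  refine (hc z.1 z.2 (Metric.ball_subset_closedBall hz)).trans ((le_abs_self _).trans ?_)
  exact Finset.single_le_sum (f := fun α => |c α|) (fun _ _ => abs_nonneg _) (Finset.mem_univ _)

theorem lintegral_jetMeasure {M : ℕ} {R : ℝ} {f : multiIndices d M × E d → ℝ≥0∞}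
    (hf : Measurable f) : ∫⁻ z, f z ∂(jetMeasure d M R) =
      ∑ α, ∫⁻ x in Metric.ball (0 : E d) R, f (α, x) := by
  rw [lintegral_prod _ hf.aemeasurable, lintegral_count, tsum_fintype]

/-- The abstract coupling on `S(M) × B_R`, where the squared `L²` norm of a jet is the Sobolev
energy. Isometries commute with differentiation, so the coupled jets are again jets of maps. -/
theorem exists_jet_coupling {M : ℕ} {R : ℝ} {φ : E d → H₁} {ψ : E d → H₂}
    (hφ : ContDiff ℝ ∞ φ) (hψ : ContDiff ℝ ∞ ψ) {η τ : ℝ} (hη : 0 ≤ η)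
    (hd : ∀ α ∈ multiIndices d M, ∀ β ∈ multiIndices d M, ∀ x ∈ Metric.ball (0 : E d) R,
      ∀ y ∈ Metric.ball (0 : E d) R, |⟪vecDeriv α φ x, vecDeriv β φ y⟫_ℝ -
        ⟪vecDeriv α ψ x, vecDeriv β ψ y⟫_ℝ| ≤ η)
    {ι : Type*} [Fintype ι] {v : ι → multiIndices d M × E d → ℝ}
    (hv : ∀ k, MemLp (v k) 2 (jetMeasure d M R)) (h : ι → H₁)
    (hτ : ∀ z : multiIndices d M × E d, z.2 ∈ Metric.ball (0 : E d) R →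
      ‖vecDeriv z.1.1 φ z.2 - ∑ k, v k z • h k‖ ^ 2 ≤ τ) :
    ∃ (H : Type) (_ : NormedAddCommGroup H) (_ : InnerProductSpace ℝ H) (_ : CompleteSpace H)
      (φ' ψ' : E d → H), ContDiff ℝ ∞ φ' ∧ ContDiff ℝ ∞ ψ' ∧
      (∀ x y, ⟪φ' x, φ' y⟫_ℝ = ⟪φ x, φ y⟫_ℝ) ∧ (∀ x y, ⟪ψ' x, ψ' y⟫_ℝ = ⟪ψ x, ψ y⟫_ℝ) ∧
      ∑ α ∈ multiIndices d M, ∫⁻ x in Metric.ball (0 : E d) R,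
          ‖vecDeriv α φ' x - vecDeriv α ψ' x‖ₑ ^ 2 ≤
        ENNReal.ofReal ((4 * τ + 2 * η + 3 * (Fintype.card ι * η)) *
          ((multiIndices d M).card * volume.real (Metric.ball (0 : E d) R))) := by
  set V := (jetMeasure d M R).real Set.univ with hV
  have hτ' : ∫ z, ‖vecDeriv z.1.1 φ z.2 - ∑ k, v k z • h k‖ ^ 2 ∂(jetMeasure d M R) ≤ τ * V := by
    have : τ * V = ∫ _, τ ∂(jetMeasure d M R) := by simp [V, mul_comm]
    rw [this]
    refine integral_mono_of_nonneg (Filter.Eventually.of_forall fun z => by positivity)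
      (integrable_const _) ?_
    filter_upwards [ae_jetMeasure_mem d M R] with z hz using hτ z hz
  obtain ⟨H, _, _, _, I, J, hIJ⟩ := exists_coupling hv h (memLp_jet hφ M R) (memLp_jet hψ M R)
    (ae_jetMeasure_mem d M R) hη
    (fun z hz z' hz' => hd z.1.1 z.1.2 z'.1.1 z'.1.2 z.2 hz z'.2 hz') hτ'
  have hI : ContDiff ℝ ∞ fun x => I (φ x) := I.toContinuousLinearMap.contDiff.comp hφ
  have hJ : ContDiff ℝ ∞ fun x => J (ψ x) := J.toContinuousLinearMap.contDiff.comp hψ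
  refine ⟨H, _, _, inferInstance, fun x => I (φ x), fun x => J (ψ x), hI, hJ,
    fun x y => I.inner_map_map _ _, fun x y => J.inner_map_map _ _, ?_⟩
  have hIα : ∀ α : MIdx d, vecDeriv α (fun x => I (φ x)) = fun x => I (vecDeriv α φ x) :=
    fun α => vecDeriv_clm I.toContinuousLinearMap hφ α
  have hJα : ∀ α : MIdx d, vecDeriv α (fun x => J (ψ x)) = fun x => J (vecDeriv α ψ x) :=
    fun α => vecDeriv_clm J.toContinuousLinearMap hψ α
  have hm : MemLp (fun z : multiIndices d M × E d =>
      I (vecDeriv z.1.1 φ z.2) - J (vecDeriv z.1.1 ψ z.2)) 2 (jetMeasure d M R) :=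
    (I.toContinuousLinearMap.comp_memLp' (memLp_jet hφ M R)).sub
      (J.toContinuousLinearMap.comp_memLp' (memLp_jet hψ M R))
  have hcont : Continuous (fun z : multiIndices d M × E d =>
      I (vecDeriv z.1.1 φ z.2) - J (vecDeriv z.1.1 ψ z.2)) :=
    (I.continuous.comp (continuous_jet hφ M)).sub (J.continuous.comp (continuous_jet hψ M))
  have hmeas : Measurable (fun z : multiIndices d M × E d =>
      ENNReal.ofReal (‖I (vecDeriv z.1.1 φ z.2) - J (vecDeriv z.1.1 ψ z.2)‖ ^ 2)) :=
    (ENNReal.continuous_ofReal.comp (hcont.norm.pow 2)).measurable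
  have h1 := ENNReal.ofReal_le_ofReal hIJ
  rw [ofReal_integral_eq_lintegral_ofReal (hm.integrable_norm_pow two_ne_zero)
    (Filter.Eventually.of_forall fun z => by positivity), lintegral_jetMeasure hmeas] at h1
  rw [← Finset.sum_coe_sort (multiIndices d M)]
  refine le_trans (le_of_eq ?_) (h1.trans (ENNReal.ofReal_le_ofReal (le_of_eq ?_)))
  · refine Finset.sum_congr rfl fun α _ => lintegral_congr fun x => ?_
    rw [hIα, hJα, ENNReal.ofReal_pow (norm_nonneg _), ofReal_norm]
  · rw [← hV, ← jetMeasure_real_univ]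
    ring

end JetCoupling

/-! ### Approximation of jets by localised Taylor polynomials -/

section Cells

theorem norm_le_of_abs_apply_le {d : ℕ} {v : E d} {h : ℝ} (hv : ∀ i, |v i| ≤ h) : ‖v‖ ≤ d * h := by
  have hs : v = ∑ i, v i • EuclideanSpace.single i (1 : ℝ) := by
    ext j
    simp [Finset.sum_apply, Pi.single_apply]
  rw [hs]
  refine (norm_sum_le _ _).trans ((Finset.sum_le_card_nsmul _ _ h fun i _ => ?_).trans_eq ?_)
  · simpa [norm_smul] using hv i
  · simp

/-- Taylor approximation of order `d` of the derivatives of a vector-valued function. -/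
theorem norm_vecDeriv_sub_taylor_le {d : ℕ} (hd : 1 ≤ d) {H : Type*} [NormedAddCommGroup H]
    [NormedSpace ℝ H] [CompleteSpace H] {φ : E d → H} (hφ : ContDiff ℝ ∞ φ) (α : MIdx d) {β h : ℝ}
    (hβ : ∀ γ : MIdx d, γ.length ≤ α.length + d → ∀ x, ‖vecDeriv γ φ x‖ ≤ β) {x z : E d}
    (hxz : ∀ i, |x i - z i| ≤ h) :
    ‖vecDeriv α φ x - ∑ k : Fin d, ∑ I : Fin k → Fin d,
      ((∏ j, (x (I j) - z (I j))) / (k : ℕ).factorial) •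
        vecDeriv (α + ∑ j, Pi.single (I j) 1) φ z‖ ≤ (d * (d * h)) ^ d * β := by
  obtain ⟨m, rfl⟩ : ∃ m, d = m + 1 := ⟨d - 1, by omega⟩
  have hJ := isJet_vecDeriv hφ
  set g := lineJet (fun α => vecDeriv α φ) α z (x - z) with hg
  have hgd : ∀ k t, HasDerivAt (g k) (g (k + 1) t) t := hJ.hasDerivAt_lineJet α z (x - z)
  have hT := taylor_sequence hgd m 0 1
  have h0 : g 0 1 = vecDeriv α φ x := by simp [hg, lineJet_zero]
  have hsum : ∑ k ∈ Finset.range (m + 1), ((1 - 0 : ℝ) ^ k / (k.factorial : ℝ)) • g k 0 =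
      ∑ k : Fin (m + 1), ∑ I : Fin k → Fin (m + 1),
      ((∏ j, (x (I j) - z (I j))) / ((k : ℕ).factorial : ℝ)) •
        vecDeriv (α + ∑ j, Pi.single (I j) 1) φ z := by
    rw [Finset.sum_range]
    refine Finset.sum_congr rfl fun k _ => ?_
    simp only [hg, lineJet, Finset.smul_sum, smul_smul, zero_smul, add_zero]
    refine Finset.sum_congr rfl fun I _ => ?_
    simp [div_eq_inv_mul]
  rw [← h0, ← hsum, hT, add_sub_cancel_left]
  have hb : ∀ t, ‖g (m + 1) t‖ ≤ ((m + 1 : ℕ) * ((m + 1 : ℕ) * h)) ^ (m + 1) * β := by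
    intro t
    refine norm_lineJet_le _ _ _ _ _ _ _ _ (norm_le_of_abs_apply_le hxz) fun I => hβ _ ?_ _
    rw [length_add, length_sum_single]
  have hmain := intervalIntegral.norm_integral_le_of_norm_le_const (a := (0 : ℝ)) (b := 1)
    (f := fun t => ((1 - t) ^ m / (m.factorial : ℝ)) • g (m + 1) t)
    (C := ((m + 1 : ℕ) * ((m + 1 : ℕ) * h)) ^ (m + 1) * β) (by
      intro t ht
      rw [Set.uIoc_of_le zero_le_one] at ht
      rw [norm_smul, norm_div, norm_pow, Real.norm_natCast,
        Real.norm_of_nonneg (sub_nonneg.2 ht.2)]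
      have h1 : (1 - t) ^ m / (m.factorial : ℝ) ≤ 1 :=
        div_le_one_of_le₀ ((pow_le_one₀ (sub_nonneg.2 ht.2) (by linarith [ht.1])).trans
          (by exact_mod_cast Nat.one_le_iff_ne_zero.2 m.factorial_ne_zero)) (by positivity)
      calc _ ≤ 1 * ‖g (m + 1) t‖ := mul_le_mul_of_nonneg_right h1 (norm_nonneg _)
        _ ≤ _ := by rw [one_mul]; exact hb t)
  simpa using hmain

/-- The indices of the cells of side length `h` that meet the ball `B_R`. -/
def cells (d : ℕ) (R h : ℝ) : Finset (Fin d → ℤ) :=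
  Fintype.piFinset fun _ => Finset.Icc (-⌈R / h⌉) ⌈R / h⌉

/-- The lattice point that corresponds to a cell. -/
def cellPoint {d : ℕ} (h : ℝ) (q : Fin d → ℤ) : E d := WithLp.toLp 2 fun i => h * q i

/-- Indices for the localized monomials of degree less than `d`. -/
abbrev LocalIdx (d M : ℕ) (R h : ℝ) : Type :=
  multiIndices d M × cells d R h × (Σ k : Fin d, Fin k → Fin d)

open scoped Classical in
/-- Localized monomials. -/
def localMonomial {d M : ℕ} {R h : ℝ} (k : LocalIdx d M R h) (z : multiIndices d M × E d) : ℝ :=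
  if z.1 = k.1 ∧ ∀ i, ⌊z.2 i / h⌋ = k.2.1.1 i then
    (∏ j, (z.2 (k.2.2.2 j) - cellPoint h k.2.1.1 (k.2.2.2 j))) / (k.2.2.1 : ℕ).factorial
  else 0

/-- Each coordinate has `2⌈R/h⌉ + 1 ≤ 2R/h + 3 ≤ 5R/h` cells, the last step because `R/h ≥ 1`. The
remaining factors count components and words of length less than `d`. -/
theorem card_localIdx_le (d M : ℕ) {R h : ℝ} (hR : 1 ≤ R) (hh : 0 < h) (hh1 : h ≤ 1) :
    (Fintype.card (LocalIdx d M R h) : ℝ) ≤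
      (multiIndices d M).card * ((5 * R / h) ^ d * ∑ k : Fin d, (d : ℝ) ^ (k : ℕ)) := by
  have hRh : 1 ≤ R / h := (one_le_div hh).2 (hh1.trans hR)
  have hc0 : 0 ≤ ⌈R / h⌉ := Int.ceil_nonneg (by linarith)
  have h1 : ((cells d R h).card : ℝ) ≤ (5 * R / h) ^ d := by
    unfold cells
    rw [Fintype.card_piFinset]
    simp only [Int.card_Icc, Finset.prod_const, Finset.card_univ, Fintype.card_fin]
    push_cast
    refine pow_le_pow_left₀ (by positivity) ?_ d
    have h2 : ((⌈R / h⌉ + 1 - -⌈R / h⌉).toNat : ℝ) = 2 * (⌈R / h⌉ : ℝ) + 1 := by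
      have : ((⌈R / h⌉ + 1 - -⌈R / h⌉).toNat : ℤ) = 2 * ⌈R / h⌉ + 1 := by
        rw [Int.toNat_of_nonneg (by omega)]; ring
      exact_mod_cast this
    rw [h2, mul_div_assoc]
    have := Int.ceil_lt_add_one (R / h)
    linarith
  have h3 : (Fintype.card (Σ k : Fin d, Fin k → Fin d) : ℝ) = ∑ k : Fin d, (d : ℝ) ^ (k : ℕ) := by
    rw [Fintype.card_sigma]
    simp
  rw [Fintype.card_prod, Fintype.card_prod]
  push_cast
  rw [h3, Fintype.card_coe, Fintype.card_coe]
  gcongr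

theorem abs_sub_cellPoint_le {d : ℕ} {h : ℝ} (hh : 0 < h) {x : E d} {q : Fin d → ℤ}
    (hq : ∀ i, ⌊x i / h⌋ = q i) (i : Fin d) : |x i - cellPoint h q i| ≤ h := by
  have h1 := Int.floor_le (x i / h)
  have h2 := Int.lt_floor_add_one (x i / h)
  rw [hq i] at h1 h2
  rw [le_div_iff₀ hh] at h1
  rw [div_lt_iff₀ hh] at h2
  change |x i - h * q i| ≤ h
  rw [abs_le]
  constructor <;> nlinarith

theorem measurable_localMonomial {d M : ℕ} {R h : ℝ} (k : LocalIdx d M R h) :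
    Measurable (localMonomial k) := by
  unfold localMonomial
  refine Measurable.ite ?_ ?_ measurable_const
  · refine (measurableSet_eq_fun measurable_fst measurable_const).inter ?_
    have : {z : multiIndices d M × E d | ∀ i, ⌊z.2 i / h⌋ = k.2.1.1 i} =
        ⋂ i, {z : multiIndices d M × E d | ⌊z.2 i / h⌋ = k.2.1.1 i} := by ext; simp
    change MeasurableSet {z : multiIndices d M × E d | ∀ i, ⌊z.2 i / h⌋ = k.2.1.1 i}
    rw [this]
    refine MeasurableSet.iInter fun i => ?_
    refine measurableSet_eq_fun (Int.measurable_floor.comp ?_) measurable_const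
    fun_prop
  · fun_prop

theorem memLp_localMonomial {d M : ℕ} {R h : ℝ} (hh : 0 < h) (hh1 : h ≤ 1)
    (k : LocalIdx d M R h) : MemLp (localMonomial k) 2 (jetMeasure d M R) := by
  refine MemLp.of_bound (measurable_localMonomial k).aestronglyMeasurable 1
    (Filter.Eventually.of_forall fun z => ?_)
  unfold localMonomial
  split_ifs with hz
  · rw [norm_div, norm_prod, Real.norm_natCast]
    have hf : (1 : ℝ) ≤ ((k.2.2.1 : ℕ).factorial : ℝ) := by
      exact_mod_cast Nat.one_le_iff_ne_zero.2 (Nat.factorial_ne_zero _)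
    refine div_le_one_of_le₀ (le_trans ?_ hf) (by positivity)
    exact Finset.prod_le_one (fun _ _ => norm_nonneg _) fun j _ =>
      (abs_sub_cellPoint_le hh hz.2 _).trans hh1
  · simp

theorem floor_mem_cells {d : ℕ} {R h : ℝ} (hh : 0 < h) {x : E d}
    (hx : x ∈ Metric.ball (0 : E d) R) : (fun i => ⌊x i / h⌋) ∈ cells d R h := by
  refine Fintype.mem_piFinset.2 fun i => ?_
  have hxi : |x i| ≤ R := (PiLp.norm_apply_le x i).trans (mem_ball_zero_iff.1 hx).le
  have h1 : |x i / h| ≤ R / h := by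
    rw [abs_div, abs_of_pos hh]
    gcongr
  rw [abs_le] at h1
  rw [Finset.mem_Icc]
  constructor
  · rw [Int.le_floor]
    push_cast
    linarith [Int.le_ceil (R / h)]
  · exact Int.floor_le_ceil _ |>.trans (Int.ceil_le_ceil h1.2)

/-- Exactly one component and one half-open cell are active at `z`, so the sum collapses to the
Taylor polynomial at the corner of that cell. The corner may lie outside the ball, which is harmless
as the bounds on `K` hold on all of `ℝ^d`. -/
theorem sum_localMonomial {d M : ℕ} {R h : ℝ} (hh : 0 < h) {H : Type*} [NormedAddCommGroup H]
    [NormedSpace ℝ H] (φ : E d → H) (z : multiIndices d M × E d)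
    (hz : z.2 ∈ Metric.ball (0 : E d) R) :
    ∑ k : LocalIdx d M R h, localMonomial k z •
        vecDeriv (k.1.1 + ∑ j, Pi.single (k.2.2.2 j) 1) φ (cellPoint h k.2.1.1) =
      ∑ k : Fin d, ∑ I : Fin k → Fin d,
        ((∏ j, (z.2 (I j) - cellPoint h (fun i => ⌊z.2 i / h⌋) (I j))) / (k : ℕ).factorial) •
        vecDeriv (z.1.1 + ∑ j, Pi.single (I j) 1) φ (cellPoint h fun i => ⌊z.2 i / h⌋) := by
  classical
  set q : cells d R h := ⟨_, floor_mem_cells hh hz⟩ with hq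
  rw [Fintype.sum_prod_type, Finset.sum_eq_single z.1, Fintype.sum_prod_type,
    Finset.sum_eq_single q, Fintype.sum_sigma]
  · refine Finset.sum_congr rfl fun k _ => Finset.sum_congr rfl fun I _ => ?_
    rw [localMonomial, if_pos ⟨rfl, fun i => rfl⟩]
  · intro q' _ hne
    refine Finset.sum_eq_zero fun k _ => ?_
    rw [localMonomial, if_neg, zero_smul]
    rintro ⟨-, h2⟩
    exact hne (Subtype.ext (funext fun i => (h2 i).symm))
  · simp
  · intro α _ hne
    refine Finset.sum_eq_zero fun k _ => ?_
    rw [localMonomial, if_neg, zero_smul]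
    rintro ⟨h1, -⟩
    exact hne h1.symm
  · simp

end Cells

end

/-! ### Choice of the mesh: close feature maps in one Hilbert space -/

section

open scoped InnerProductSpace

theorem le_eta {d : ℕ} {K C : E d → E d → ℝ} {M : ℕ} {R : ℝ} {α β : MIdx d}
    (hα : α ∈ multiIndices d M) (hβ : β ∈ multiIndices d M) {x y : E d}
    (hx : x ∈ Metric.ball (0 : E d) R) (hy : y ∈ Metric.ball (0 : E d) R) :
    ‖mixedDeriv α β K x y - mixedDeriv α β C x y‖ₑ ≤ eta K C M R :=
  le_iSup₂_of_le α hα <| le_iSup₂_of_le β hβ <| le_iSup₂_of_le x hx <|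
    le_iSup₂_of_le y hy le_rfl

theorem zero_mem_multiIndices (d M : ℕ) : (0 : MIdx d) ∈ multiIndices d M :=
  mem_multiIndices.2 (by simp [MIdx.length])

theorem volume_real_ball {d : ℕ} {R : ℝ} (hR : 1 ≤ R) : volume.real (Metric.ball (0 : E d) R) =
    R ^ d * volume.real (Metric.ball (0 : E d) 1) := by
  rw [Measure.real, Measure.addHaar_ball_of_pos volume _ (by linarith : 0 < R), ENNReal.toReal_mul,
    ENNReal.toReal_ofReal (by positivity)]
  simp [Measure.real]

/-- The elementary inequality behind the choice of the mesh size. -/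
theorem rate_bound {d : ℕ} {N β L v R V η m c : ℝ} (hN : 0 ≤ N) (hL : 0 ≤ L)
    (hv : 0 ≤ v) (hR : 1 ≤ R) (hV : V = R ^ d * v) (hη : 0 < η)
    (hm : m ≤ N * ((5 * R) ^ d / √η * L)) :
    (4 * ((c * √η) * β) ^ 2 + 2 * η + 3 * (m * η)) * (N * V) ≤
      ((4 * (c * β) ^ 2 + 2) * N) * (η * V) +
        (3 * N ^ 2 * 5 ^ d * L * √v) * (√η * √V * R ^ ((3 * (d : ℝ) + 1) / 2)) := by
  have hR0 : 0 ≤ R := by linarith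
  have hV0 : 0 ≤ V := by rw [hV]; positivity
  have hsη : 0 < √η := Real.sqrt_pos.2 hη
  have hse : √η * √η = η := Real.mul_self_sqrt hη.le
  have h1 : 3 * (m * η) * (N * V) ≤ 3 * N ^ 2 * 5 ^ d * L * (√η * (R ^ d * V)) := by
    have : m * η ≤ N * ((5 * R) ^ d * L) * √η := by
      calc m * η ≤ N * ((5 * R) ^ d / √η * L) * η := mul_le_mul_of_nonneg_right hm hη.le
        _ = N * ((5 * R) ^ d * L) * (√η * √η / √η) := by rw [hse]; ring
        _ = _ := by rw [mul_div_assoc, div_self hsη.ne', mul_one]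
    calc _ ≤ 3 * (N * ((5 * R) ^ d * L) * √η) * (N * V) := by gcongr
      _ = _ := by rw [mul_pow]; ring
  -- Half of the volume is converted into a power of `R` by `√V = R^(d/2) √v`. This gives the
  -- exponent `3d/2`; the further `1/2` in the stated exponent is slack, since `R ≥ 1`.
  have h2 : R ^ d * V ≤ √v * (√V * R ^ ((3 * (d : ℝ) + 1) / 2)) := by
    have hsV : √V = R ^ ((d : ℝ) / 2) * √v := by
      rw [hV, Real.sqrt_mul (by positivity), Real.sqrt_eq_rpow, ← Real.rpow_natCast,
        ← Real.rpow_mul hR0]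
      congr 2
      ring
    have hVV : V = √V * √V := (Real.mul_self_sqrt hV0).symm
    have hpow : R ^ d * R ^ ((d : ℝ) / 2) ≤ R ^ ((3 * (d : ℝ) + 1) / 2) := by
      rw [← Real.rpow_natCast, ← Real.rpow_add (by linarith)]
      exact Real.rpow_le_rpow_of_exponent_le hR (by linarith)
    calc R ^ d * V = (R ^ d * R ^ ((d : ℝ) / 2)) * (√v * √V) := by
          nth_rewrite 1 [hVV]
          nth_rewrite 1 [hsV]
          ring
      _ ≤ R ^ ((3 * (d : ℝ) + 1) / 2) * (√v * √V) := by gcongr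
      _ = _ := by ring
  have h3 : 3 * N ^ 2 * 5 ^ d * L * (√η * (R ^ d * V)) ≤ 3 * N ^ 2 * 5 ^ d * L *
      (√η * (√v * (√V * R ^ ((3 * (d : ℝ) + 1) / 2)))) := by gcongr
  have h4 : (4 * ((c * √η) * β) ^ 2 + 2 * η) * (N * V) = ((4 * (c * β) ^ 2 + 2) * N) * (η * V) := by
    have : ((c * √η) * β) ^ 2 = (c * β) ^ 2 * η := by
      rw [mul_pow, mul_pow, Real.sq_sqrt hη.le]; ring
    rw [this]; ring
  linarith

/-- Smooth feature maps of `K` and `C` in a common Hilbert space whose derivatives are close. -/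
theorem exists_close_features (d M : ℕ) (hd : 1 ≤ d) (b : MIdx d → MIdx d → ℝ) :
    ∃ A : ℝ≥0, 0 < A ∧ ∀ K C : E d → E d → ℝ, IsCovKernel K → IsCovKernel C → SmoothKernel K →
      SmoothKernel C → (∀ α β x y, |mixedDeriv α β K x y| ≤ b α β) → ∀ R : ℝ, 1 ≤ R →
      ∃ (H : Type) (_ : NormedAddCommGroup H) (_ : InnerProductSpace ℝ H) (_ : CompleteSpace H)
        (φ ψ : E d → H), ContDiff ℝ ∞ φ ∧ ContDiff ℝ ∞ ψ ∧
        (∀ x ∈ Metric.ball (0 : E d) R, ∀ y ∈ Metric.ball (0 : E d) R, ⟪φ x, φ y⟫_ℝ = K x y) ∧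
        (∀ x ∈ Metric.ball (0 : E d) R, ∀ y ∈ Metric.ball (0 : E d) R, ⟪ψ x, ψ y⟫_ℝ = C x y) ∧
        ∑ α ∈ multiIndices d M, ∫⁻ x in Metric.ball (0 : E d) R,
          ‖vecDeriv α φ x - vecDeriv α ψ x‖ₑ ^ 2 ≤ A * couplingRate K C M R := by
  set N : ℝ := ((multiIndices d M).card : ℝ) with hN
  set β : ℝ := ∑ γ ∈ multiIndices d (M + d), √(b γ γ) with hβ
  set L : ℝ := ∑ k : Fin d, (d : ℝ) ^ (k : ℕ) with hL
  set v : ℝ := volume.real (Metric.ball (0 : E d) 1) with hv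
  set c : ℝ := ((d : ℝ) * d) ^ d with hc
  -- The summand with `c` pays for the Taylor error when `η < 1`, the summand `4 * β ^ 2` for the
  -- absence of any approximation when `η ≥ 1`.
  set A₁ : ℝ := (4 * (c * β) ^ 2 + 4 * β ^ 2 + 2) * N with hA₁
  set A₂ : ℝ := 3 * N ^ 2 * 5 ^ d * L * √v with hA₂
  have hA₁0 : 0 ≤ A₁ := by positivity
  have hN0 : 0 ≤ N := Nat.cast_nonneg _
  have hL0 : 0 ≤ L := Finset.sum_nonneg fun _ _ => by positivity
  have hA₂0 : 0 ≤ A₂ := by positivity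
  have hβ0 : 0 ≤ β := Finset.sum_nonneg fun _ _ => Real.sqrt_nonneg _
  have hA0 : 0 ≤ A₁ + A₂ + 1 := by positivity
  refine ⟨(A₁ + A₂ + 1).toNNReal, Real.toNNReal_pos.2 (by positivity), ?_⟩
  intro K C hK hC hKs hCs hb R hR
  have hR0 : 0 < R := by linarith
  set B := Metric.ball (0 : E d) R with hB
  obtain ⟨H₁, _, _, _, φ, hφ, hφK⟩ := exists_smooth_feature hK hKs
  obtain ⟨H₂, _, _, _, ψ, hψ, hψC⟩ := exists_smooth_feature hC hCs
  have hφb : ∀ γ : MIdx d, γ.length ≤ M + d → ∀ x, ‖vecDeriv γ φ x‖ ≤ β := by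
    intro γ hγ x
    have h1 : ‖vecDeriv γ φ x‖ ^ 2 ≤ b γ γ := by
      rw [← real_inner_self_eq_norm_sq, ← mixedDeriv_eq_inner hφ hφK]
      exact (le_abs_self _).trans (hb γ γ x x)
    refine (Real.le_sqrt_of_sq_le h1).trans ?_
    exact Finset.single_le_sum (f := fun γ => √(b γ γ)) (fun _ _ => Real.sqrt_nonneg _)
      (mem_multiIndices.2 hγ)
  have hVtop : volume B ≠ ⊤ := measure_ball_lt_top.ne
  have hVpos : volume B ≠ 0 := (Metric.measure_ball_pos volume (0 : E d) hR0).ne'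
  rcases eq_or_ne (eta K C M R) ⊤ with htop | htop
  -- For infinite `η` the right-hand side is infinite, and orthogonal embeddings suffice.
  · refine ⟨WithLp 2 (H₁ × H₂), inferInstance, inferInstance, inferInstance,
      fun x => inlIsometry H₁ H₂ (φ x), fun x => inrIsometry H₁ H₂ (ψ x),
      (inlIsometry H₁ H₂).toContinuousLinearMap.contDiff.comp hφ,
      (inrIsometry H₁ H₂).toContinuousLinearMap.contDiff.comp hψ,
      fun x _ y _ => by rw [LinearIsometry.inner_map_map, hφK],
      fun x _ y _ => by rw [LinearIsometry.inner_map_map, hψC], ?_⟩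
    have : couplingRate K C M R = ⊤ := by
      rw [couplingRate, htop, ENNReal.top_mul hVpos, top_add]
    rw [this, ENNReal.mul_top]
    · exact le_top
    · rw [ENNReal.coe_ne_zero]
      exact (Real.toNNReal_pos.2 (by positivity)).ne'
  set η : ℝ := (eta K C M R).toReal with hη
  have hηe : eta K C M R = ENNReal.ofReal η := (ENNReal.ofReal_toReal htop).symm
  have hη0 : 0 ≤ η := ENNReal.toReal_nonneg
  have hclose : ∀ α ∈ multiIndices d M, ∀ β ∈ multiIndices d M, ∀ x ∈ B, ∀ y ∈ B,
      |⟪vecDeriv α φ x, vecDeriv β φ y⟫_ℝ - ⟪vecDeriv α ψ x, vecDeriv β ψ y⟫_ℝ| ≤ η := by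
    intro α hα β hβ x hx y hy
    rw [← mixedDeriv_eq_inner hφ hφK, ← mixedDeriv_eq_inner hψ hψC]
    have h1 := le_eta (K := K) (C := C) hα hβ hx hy
    rw [hηe, ← ofReal_norm] at h1
    exact (ENNReal.ofReal_le_ofReal_iff hη0).1 h1
  rcases hη0.eq_or_lt with hz | hpos
  -- For `η = 0` the mesh would degenerate, but then `K = C` on the ball and `φ` serves for both
  -- kernels.
  · refine ⟨H₁, _, _, inferInstance, φ, φ, hφ, hφ, fun x _ y _ => hφK x y, fun x hx y hy => ?_, ?_⟩
    · have := hclose 0 (zero_mem_multiIndices d M) 0 (zero_mem_multiIndices d M) x hx y hy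
      rw [vecDeriv_zero, vecDeriv_zero, ← hz, abs_nonpos_iff, sub_eq_zero] at this
      rw [this, hψC]
    · simp
  set V : ℝ := volume.real B with hV
  have hVR : V = R ^ d * v := volume_real_ball hR
  have hrate : couplingRate K C M R =
      ENNReal.ofReal (η * V + √η * √V * R ^ ((3 * (d : ℝ) + 1) / 2)) := by
    have hVe : volume B = ENNReal.ofReal V := (ENNReal.ofReal_toReal hVtop).symm
    have hV0 : 0 ≤ V := measureReal_nonneg
    rw [couplingRate, ← hB, hηe, hVe, ENNReal.ofReal_rpow_of_nonneg hη0 (by norm_num),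
      ENNReal.ofReal_rpow_of_nonneg hV0 (by norm_num), ← ENNReal.ofReal_mul hη0,
      ← ENNReal.ofReal_mul (by positivity), ← ENNReal.ofReal_mul (by positivity),
      ← ENNReal.ofReal_add (by positivity) (by positivity), Real.sqrt_eq_rpow, Real.sqrt_eq_rpow]
  set T : ℝ := √η * √V * R ^ ((3 * (d : ℝ) + 1) / 2) with hT
  have hT0 : 0 ≤ T := by positivity
  have hηV0 : 0 ≤ η * V := mul_nonneg hη0 measureReal_nonneg
  suffices hmain : ∃ (H : Type) (_ : NormedAddCommGroup H) (_ : InnerProductSpace ℝ H)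
      (_ : CompleteSpace H) (φ' ψ' : E d → H), ContDiff ℝ ∞ φ' ∧ ContDiff ℝ ∞ ψ' ∧
      (∀ x y, ⟪φ' x, φ' y⟫_ℝ = ⟪φ x, φ y⟫_ℝ) ∧ (∀ x y, ⟪ψ' x, ψ' y⟫_ℝ = ⟪ψ x, ψ y⟫_ℝ) ∧
      ∑ α ∈ multiIndices d M, ∫⁻ x in B, ‖vecDeriv α φ' x - vecDeriv α ψ' x‖ₑ ^ 2 ≤
        ENNReal.ofReal (A₁ * (η * V) + A₂ * T) by
    obtain ⟨H, i1, i2, i3, φ', ψ', h1, h2, h3, h4, h5⟩ := hmain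
    refine ⟨H, i1, i2, i3, φ', ψ', h1, h2, fun x _ y _ => (h3 x y).trans (hφK x y),
      fun x _ y _ => (h4 x y).trans (hψC x y), h5.trans ?_⟩
    rw [hrate]
    change _ ≤ ENNReal.ofReal (A₁ + A₂ + 1) * _
    rw [← ENNReal.ofReal_mul hA0]
    refine ENNReal.ofReal_le_ofReal ?_
    nlinarith [mul_nonneg hA₁0 hT0, mul_nonneg hA₂0 hηV0]
  rcases le_or_gt 1 η with h1η | hη1
  -- For `η ≥ 1` no approximating functions are used: the trivial error `β²` is already at most `β²
  -- η`.
  · obtain ⟨H, i1, i2, i3, φ', ψ', h1, h2, h3, h4, h5⟩ := exists_jet_coupling (R := R) hφ hψ hη0 hclose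
      (ι := Fin 0) (v := fun k => k.elim0) (fun k => k.elim0) (fun k => k.elim0) (τ := β ^ 2)
      (fun z _ => by
        have hl : z.1.1.length ≤ M + d := (mem_multiIndices.1 z.1.2).trans (by omega)
        simpa using pow_le_pow_left₀ (norm_nonneg _) (hφb z.1.1 hl z.2) 2)
    refine ⟨H, i1, i2, i3, φ', ψ', h1, h2, h3, h4, h5.trans (ENNReal.ofReal_le_ofReal ?_)⟩
    rw [Fintype.card_fin, Nat.cast_zero, zero_mul, mul_zero, add_zero, ← hV, ← hN]
    have hNV : 0 ≤ N * V := mul_nonneg hN0 measureReal_nonneg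
    have h6 : β ^ 2 * (N * V) ≤ β ^ 2 * η * (N * V) := by
      have : β ^ 2 ≤ β ^ 2 * η := le_mul_of_one_le_right (sq_nonneg _) h1η
      exact mul_le_mul_of_nonneg_right this hNV
    have h7 : 0 ≤ 4 * (c * β) ^ 2 * N * (η * V) :=
      mul_nonneg (mul_nonneg (by positivity) hN0) hηV0
    have h8 : 0 ≤ A₂ * T := mul_nonneg hA₂0 hT0
    rw [hA₁]
    linarith
  -- With `h ^ d = √η` the squared Taylor error is a multiple of `η`, while the number of monomials
  -- is of order `R^d / √η`.
  · set h : ℝ := η ^ ((1 : ℝ) / (2 * d)) with hh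
    have hd0 : (0 : ℝ) < d := by exact_mod_cast hd
    have hh0 : 0 < h := Real.rpow_pos_of_pos hpos _
    have hh1 : h ≤ 1 := Real.rpow_le_one hη0 hη1.le (by positivity)
    have hhd : h ^ d = √η := by
      rw [hh, ← Real.rpow_natCast, ← Real.rpow_mul hη0, Real.sqrt_eq_rpow]
      congr 1
      field_simp
    obtain ⟨H, i1, i2, i3, φ', ψ', h1, h2, h3, h4, h5⟩ := exists_jet_coupling (R := R) hφ hψ hη0 hclose
      (fun k => memLp_localMonomial hh0 hh1 k)
      (fun k : LocalIdx d M R h =>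
        vecDeriv (k.1.1 + ∑ j, Pi.single (k.2.2.2 j) 1) φ (cellPoint h k.2.1.1))
      (τ := ((c * √η) * β) ^ 2)
      (fun z hz => by
        rw [sum_localMonomial hh0 φ z hz]
        refine pow_le_pow_left₀ (norm_nonneg _) ((norm_vecDeriv_sub_taylor_le hd hφ z.1.1
          (fun γ hγ => hφb γ (hγ.trans (by have := mem_multiIndices.1 z.1.2; omega)))
          (abs_sub_cellPoint_le hh0 fun i => rfl)).trans_eq ?_) 2
        rw [hc, ← hhd, ← mul_assoc, mul_pow])
    refine ⟨H, i1, i2, i3, φ', ψ', h1, h2, h3, h4, h5.trans (ENNReal.ofReal_le_ofReal ?_)⟩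
    have hm := card_localIdx_le d M hR hh0 hh1
    rw [div_pow, hhd] at hm
    refine (rate_bound hN0 hL0 measureReal_nonneg hR hVR hpos hm).trans ?_
    have h7 : 0 ≤ 4 * β ^ 2 * N * (η * V) :=
      mul_nonneg (mul_nonneg (by positivity) hN0) hηV0
    rw [hA₁]
    linarith

end

/-! ### Countable coordinates and Gaussian series -/

section

open scoped InnerProductSpace Topology
open Filter

/-- Countably many coordinates of a Hilbert space that determine the values and derivatives of two
smooth maps. -/
theorem exists_coordinates {d : ℕ} {H : Type*} [NormedAddCommGroup H] [InnerProductSpace ℝ H]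
    [CompleteSpace H] {φ ψ : E d → H} (hφ : ContDiff ℝ ∞ φ) (hψ : ContDiff ℝ ∞ ψ) :
    ∃ e : ℕ → H, ∀ α x w,
      HasSum (fun n => ⟪vecDeriv α φ x, e n⟫_ℝ * ⟪w, e n⟫_ℝ) ⟪vecDeriv α φ x, w⟫_ℝ ∧
      HasSum (fun n => ⟪vecDeriv α ψ x, e n⟫_ℝ * ⟪w, e n⟫_ℝ) ⟪vecDeriv α ψ x, w⟫_ℝ := by
  obtain ⟨ι, b, -⟩ := exists_hilbertBasis ℝ H
  obtain ⟨s, hs, hsd⟩ := TopologicalSpace.exists_countable_dense (E d)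
  -- `H` need not be separable. Each vector has countably many nonzero coordinates, so countably
  -- many basis vectors account for both maps on a countable dense set; the other coordinates vanish
  -- everywhere by continuity, together with their derivatives.
  have hcount : ∀ v : H, {i | ⟪v, b i⟫_ℝ * ⟪b i, v⟫_ℝ ≠ 0}.Countable := fun v =>
    (b.hasSum_inner_mul_inner v v).summable.countable_support
  set S : Set ι := ⋃ x ∈ s, ({i | ⟪φ x, b i⟫_ℝ * ⟪b i, φ x⟫_ℝ ≠ 0} ∪
    {i | ⟪ψ x, b i⟫_ℝ * ⟪b i, ψ x⟫_ℝ ≠ 0}) with hS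
  have hSc : S.Countable := hs.biUnion fun x _ => (hcount _).union (hcount _)
  have hzero : ∀ i, i ∉ S → ∀ x ∈ s, ⟪φ x, b i⟫_ℝ = 0 ∧ ⟪ψ x, b i⟫_ℝ = 0 := by
    intro i hi x hx
    simp only [hS, Set.mem_iUnion, not_exists, Set.mem_union, not_or, Set.mem_ofPred_eq,
      not_not] at hi
    obtain ⟨h1, h2⟩ := hi x hx
    rw [real_inner_comm, mul_self_eq_zero] at h1 h2
    rw [real_inner_comm, h1, real_inner_comm, h2]
    exact ⟨rfl, rfl⟩
  have hderiv : ∀ {χ : E d → H}, ContDiff ℝ ∞ χ → ∀ i, (∀ x ∈ s, ⟪χ x, b i⟫_ℝ = 0) →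
      ∀ α x, ⟪vecDeriv α χ x, b i⟫_ℝ = 0 := by
    intro χ hχ i hi α x
    have h1 : (fun x => innerSL ℝ (b i) (χ x)) = fun x => (0 : E d →L[ℝ] ℝ) x := by
      refine Continuous.ext_on hsd ((innerSL ℝ (b i)).continuous.comp hχ.continuous)
        (ContinuousLinearMap.continuous _) fun x hx => ?_
      rw [innerSL_apply_apply, real_inner_comm]
      exact hi x hx
    have h2 := congrFun (vecDeriv_clm (innerSL ℝ (b i)) hχ α) x
    have h3 := vecDeriv_clm (0 : H →L[ℝ] ℝ) hχ α
    have h4 : (fun x => (0 : E d →L[ℝ] ℝ) x) = fun x => (0 : H →L[ℝ] ℝ) (χ x) := rfl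
    rw [h1, h4, h3] at h2
    rw [real_inner_comm, ← innerSL_apply_apply ℝ]
    exact h2.symm
  have := hSc.toEncodable
  -- The countable set of basis vectors is indexed by `ℕ`, with zero at unused indices; repetitions
  -- are excluded by `decode₂`.
  let e : ℕ → H := fun n => ((Encodable.decode₂ S n).map fun j => b j).getD 0
  have he : ∀ j : S, e (Encodable.encode j) = b j := fun j => by simp [e]
  have he0 : ∀ n, n ∉ Set.range (Encodable.encode : S → ℕ) → e n = 0 := by
    intro n hn
    have : Encodable.decode₂ S n = none := by
      by_contra h
      obtain ⟨j, hj⟩ := Option.ne_none_iff_exists'.1 h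
      exact hn ⟨j, Encodable.mem_decode₂.1 hj⟩
    simp [e, this]
  have hsum : ∀ v w : H, (∀ i, i ∉ S → ⟪v, b i⟫_ℝ = 0) →
      HasSum (fun n => ⟪v, e n⟫_ℝ * ⟪w, e n⟫_ℝ) ⟪v, w⟫_ℝ := by
    intro v w hv
    rw [← Encodable.encode_injective (α := S) |>.hasSum_iff
      (fun n hn => by rw [he0 n hn, inner_zero_right, zero_mul])]
    have h1 := b.hasSum_inner_mul_inner v w
    rw [← Subtype.val_injective (p := (· ∈ S)) |>.hasSum_iff (fun i hi => by
      rw [hv i (fun h => hi ⟨⟨i, h⟩, rfl⟩), zero_mul])] at h1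
    convert! h1 using 1
    funext j
    simp [he, real_inner_comm]
  exact ⟨e, fun α x w => ⟨hsum _ _ fun i hi => hderiv hφ i (fun x hx => (hzero i hi x hx).1) α x,
    hsum _ _ fun i hi => hderiv hψ i (fun x hx => (hzero i hi x hx).2) α x⟩⟩

/-- The law of a sequence of independent standard Gaussian random variables. -/
def gaussSeq : Measure (ℕ → ℝ) := Measure.infinitePi fun _ => gaussianReal 0 1

instance : IsProbabilityMeasure gaussSeq := by unfold gaussSeq; infer_instance

theorem map_sum_gaussSeq (c : ℕ → ℝ) (s : Finset ℕ) :
    gaussSeq.map (fun w => ∑ i ∈ s, w i * c i) =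
      gaussianReal 0 (∑ i ∈ s, c i ^ 2).toNNReal := by
  classical
  have hind : iIndepFun (fun i (w : ℕ → ℝ) => w i * c i) gaussSeq :=
    iIndepFun_infinitePi (X := fun i y => y * c i) fun i => measurable_id.mul_const _
  have hmeas : ∀ i, Measurable fun w : ℕ → ℝ => w i * c i := fun i =>
    (measurable_pi_apply i).mul_const _
  have hone : ∀ i, gaussSeq.map (fun w => w i * c i) = gaussianReal 0 (c i ^ 2).toNNReal := by
    intro i
    have h1 : (fun w : ℕ → ℝ => w i * c i) = (· * c i) ∘ fun w => w i := rfl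
    have hm : Measurable fun y : ℝ => y * c i := measurable_id.mul_const _
    rw [h1, ← Measure.map_map hm (measurable_pi_apply i), gaussSeq,
      Measure.infinitePi_map_eval (fun _ => gaussianReal 0 1) i, gaussianReal_map_mul_const,
      mul_zero, mul_one]
    congr 1
    exact NNReal.coe_injective (by simp [sq_nonneg])
  induction s using Finset.induction_on with
  | empty =>
    simp [gaussianReal_zero_var]
  | insert i s hi ih =>
    have h1 : (fun w : ℕ → ℝ => ∑ j ∈ insert i s, w j * c j) =
        (fun w => ∑ j ∈ s, w j * c j) + fun w => w i * c i := by
      funext w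
      rw [Pi.add_apply, Finset.sum_insert hi, add_comm]
    have h2 := hind.indepFun_finsetSum_of_notMem hmeas hi
    have h3 : (∑ j ∈ s, fun w : ℕ → ℝ => w j * c j) = fun w => ∑ j ∈ s, w j * c j := by
      funext w; simp
    rw [h3] at h2
    rw [h1, gaussianReal_add_gaussianReal_of_indepFun h2 ih (hone i), zero_add,
      Finset.sum_insert hi, add_comm, Real.toNNReal_add (sq_nonneg _)
        (Finset.sum_nonneg fun _ _ => sq_nonneg _)]

theorem lintegral_sum_gaussSeq (c : ℕ → ℝ) (s : Finset ℕ) :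
    ∫⁻ w, ‖∑ i ∈ s, w i * c i‖ₑ ^ 2 ∂gaussSeq = ∑ i ∈ s, ‖c i‖ₑ ^ 2 := by
  have hmeas : Measurable fun w : ℕ → ℝ => ∑ i ∈ s, w i * c i := by fun_prop
  have h1 : ∫⁻ w, ‖∑ i ∈ s, w i * c i‖ₑ ^ 2 ∂gaussSeq =
      ∫⁻ y, ‖y‖ₑ ^ 2 ∂(gaussianReal 0 (∑ i ∈ s, c i ^ 2).toNNReal) := by
    rw [← map_sum_gaussSeq, lintegral_map (by fun_prop) hmeas]
  have h2 : ∀ v : ℝ≥0, ∫⁻ y, ‖y‖ₑ ^ 2 ∂(gaussianReal 0 v) = v := by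
    intro v
    have h3 : eVar[id; gaussianReal 0 v] = v := by
      rw [← (memLp_id_gaussianReal' 2 (by simp)).ofReal_variance_eq, variance_id_gaussianReal,
        ENNReal.ofReal_coe_nnreal]
    rw [← h3, evariance]
    simp
  rw [h1, h2]
  change ENNReal.ofReal _ = _
  rw [ENNReal.ofReal_sum_of_nonneg fun _ _ => sq_nonneg _]
  refine Finset.sum_congr rfl fun i _ => ?_
  rw [← ofReal_norm, ← ENNReal.ofReal_pow (norm_nonneg _), Real.norm_eq_abs, sq_abs]

/-- An almost sure limit of partial sums `∑ ξ_i c_i` is Gaussian with variance `∑ c_i²`. -/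
theorem map_limit_gaussSeq {c : ℕ → ℝ} {v : ℝ} (hc : HasSum (fun i => c i ^ 2) v) {n : ℕ → ℕ}
    (hn : StrictMono n) {Z : (ℕ → ℝ) → ℝ}
    (hZ : ∀ᵐ w ∂gaussSeq,
      Tendsto (fun l => ∑ i ∈ Finset.range (n l), w i * c i) atTop (𝓝 (Z w))) :
    gaussSeq.map Z = gaussianReal 0 v.toNNReal := by
  have hmeas : ∀ l, Measurable fun w : ℕ → ℝ => ∑ i ∈ Finset.range (n l), w i * c i := by
    intro l; fun_prop
  have hZm : AEMeasurable Z gaussSeq :=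
    aemeasurable_of_tendsto_metrizable_ae atTop (fun l => (hmeas l).aemeasurable) hZ
  have : IsProbabilityMeasure (gaussSeq.map Z) := Measure.isProbabilityMeasure_map hZm
  have hv : 0 ≤ v := hc.nonneg fun _ => sq_nonneg _
  -- The limit law is identified by its characteristic function, using dominated convergence.
  refine Measure.ext_of_charFun (funext fun t => ?_)
  have hcont : Continuous fun x : ℝ => Complex.exp (t * x * Complex.I) := by fun_prop
  have h1 : Tendsto (fun l => ∫ w, Complex.exp
      (t * ((∑ i ∈ Finset.range (n l), w i * c i : ℝ) : ℂ) * Complex.I) ∂gaussSeq) atTop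
      (𝓝 (charFun (gaussSeq.map Z) t)) := by
    rw [charFun_apply_real, integral_map hZm hcont.aestronglyMeasurable]
    refine tendsto_integral_of_dominated_convergence (fun _ => 1)
      (fun l => (hcont.measurable.comp (hmeas l)).aestronglyMeasurable) (integrable_const _)
      (fun l => Eventually.of_forall fun w => ?_) ?_
    · rw [← Complex.ofReal_mul, Complex.norm_exp_ofReal_mul_I]
    · filter_upwards [hZ] with w hw
      exact (hcont.tendsto _).comp hw
  refine tendsto_nhds_unique h1 ?_
  have h2 : ∀ l, ∫ w, Complex.exp
      (t * ((∑ i ∈ Finset.range (n l), w i * c i : ℝ) : ℂ) * Complex.I) ∂gaussSeq =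
      Complex.exp (-((∑ i ∈ Finset.range (n l), c i ^ 2 : ℝ) : ℂ) * t ^ 2 / 2) := by
    intro l
    have h3 := charFun_gaussianReal (μ := 0) (v := (∑ i ∈ Finset.range (n l), c i ^ 2).toNNReal) t
    rw [← map_sum_gaussSeq, charFun_apply_real,
      integral_map (hmeas l).aemeasurable hcont.aestronglyMeasurable] at h3
    rw [h3, Real.coe_toNNReal _ (Finset.sum_nonneg fun _ _ => sq_nonneg _)]
    congr 1
    push_cast
    ring
  simp_rw [h2]
  rw [charFun_gaussianReal, Real.coe_toNNReal _ hv]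
  have h4 : Tendsto (fun l => ∑ i ∈ Finset.range (n l), c i ^ 2) atTop (𝓝 v) :=
    hc.tendsto_sum_nat.comp hn.tendsto_atTop
  have h5 : Continuous fun x : ℝ => Complex.exp (-(x : ℂ) * t ^ 2 / 2) := by fun_prop
  have h6 := (h5.tendsto v).comp h4
  convert! h6 using 2
  congr 1
  push_cast
  ring

end

/-! ### Almost sure convergence of random series with all derivatives -/

section

open scoped Topology
open Filter

variable {d : ℕ}

theorem IsJet.add {J J' : MIdx d → E d → ℝ} (hJ : IsJet J) (hJ' : IsJet J') :
    IsJet fun α x => J α x + J' α x := by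
  intro α x
  convert! (hJ α x).fun_add (hJ' α x) using 1
  rw [← Finset.sum_add_distrib]
  refine Finset.sum_congr rfl fun i _ => ?_
  ext v
  simp [mul_add]

theorem isJet_sum_mul {f : ℕ → E d → ℝ} (hf : ∀ i, ContDiff ℝ ∞ (f i)) (w : ℕ → ℝ)
    (s : Finset ℕ) : IsJet fun α x => ∑ i ∈ s, w i * multiDeriv α (f i) x := by
  intro α x
  have h1 : ∀ i ∈ s, HasFDerivAt (fun x => w i * multiDeriv α (f i) x) _ x := fun i _ =>
    (isJet_vecDeriv (hf i) α x).const_mul (w i)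
  convert! HasFDerivAt.fun_sum h1 using 1
  ext v
  simp only [_root_.sum_apply, _root_.smul_apply,
    ContinuousLinearMap.smulRight_apply, smul_eq_mul, Finset.mul_sum]
  rw [Finset.sum_comm]
  refine Finset.sum_congr rfl fun i _ => Finset.sum_congr rfl fun k _ => ?_
  rw [vecDeriv_real]
  ring

theorem multiDeriv_sum_mul {f : ℕ → E d → ℝ} (hf : ∀ i, ContDiff ℝ ∞ (f i)) (w : ℕ → ℝ)
    (s : Finset ℕ) (α : MIdx d) : multiDeriv α (fun x => ∑ i ∈ s, w i * f i x) =
      fun x => ∑ i ∈ s, w i * multiDeriv α (f i) x := by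
  have h1 := (isJet_sum_mul hf w s).vecDeriv_eq α
  have h2 : ∀ i, multiDeriv 0 (f i) = f i := fun i => vecDeriv_zero (f i)
  simp only [h2] at h1
  exact h1

theorem multiDeriv_sub {u v : E d → ℝ} (hu : ContDiff ℝ ∞ u) (hv : ContDiff ℝ ∞ v) (α : MIdx d)
    (x : E d) : multiDeriv α (fun x => u x - v x) x = multiDeriv α u x - multiDeriv α v x := by
  have h1 : IsJet fun α x => vecDeriv α u x - vecDeriv α v x := by
    intro α x
    convert! (isJet_vecDeriv hu α x).fun_sub (isJet_vecDeriv hv α x) using 1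
    rw [← Finset.sum_sub_distrib]
    refine Finset.sum_congr rfl fun i _ => ?_
    ext v
    simp [mul_sub]
  have h2 := congrFun (h1.vecDeriv_eq α) x
  simp only [vecDeriv_zero] at h2
  exact h2

theorem multiDeriv_contDiff (α : MIdx d) {u : E d → ℝ} (hu : ContDiff ℝ ∞ u) :
    ContDiff ℝ ∞ (multiDeriv α u) := vecDeriv_contDiff α hu

theorem multiDeriv_multiDeriv (α β : MIdx d) {u : E d → ℝ} (hu : ContDiff ℝ ∞ u) :
    multiDeriv β (multiDeriv α u) = multiDeriv (α + β) u := by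
  have h1 : IsJet fun β => vecDeriv (α + β) u := by
    intro β x
    simpa only [add_assoc] using isJet_vecDeriv hu (α + β) x
  have h2 := h1.vecDeriv_eq β
  simp only [add_zero] at h2
  exact h2

theorem measurable_sum_mul {g : ℕ → E d → ℝ} (hg : ∀ i, Continuous (g i)) (s : Finset ℕ) :
    Measurable fun p : (ℕ → ℝ) × E d => ‖∑ i ∈ s, p.1 i * g i p.2‖ₑ ^ 2 := by
  have : Measurable fun p : (ℕ → ℝ) × E d => ∑ i ∈ s, p.1 i * g i p.2 :=
    Finset.measurable_fun_sum s fun i _ => ((measurable_pi_apply i).comp measurable_fst).mul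
      ((hg i).measurable.comp measurable_snd)
  fun_prop

theorem measurable_lintegral_sum_mul {g : ℕ → E d → ℝ} (hg : ∀ i, Continuous (g i))
    (s : Finset ℕ) (B : Set (E d)) :
    Measurable fun w : ℕ → ℝ => ∫⁻ x in B, ‖∑ i ∈ s, w i * g i x‖ₑ ^ 2 :=
  (measurable_sum_mul hg s).lintegral_prod_right'

theorem lintegral_lintegral_sum_gaussSeq {g : ℕ → E d → ℝ} (hg : ∀ i, Continuous (g i))
    (s : Finset ℕ) (B : Set (E d)) :
    ∫⁻ w, (∫⁻ x in B, ‖∑ i ∈ s, w i * g i x‖ₑ ^ 2) ∂gaussSeq =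
      ∑ i ∈ s, ∫⁻ x in B, ‖g i x‖ₑ ^ 2 := by
  rw [lintegral_lintegral_swap (measurable_sum_mul hg s).aemeasurable]
  simp_rw [lintegral_sum_gaussSeq (fun i => g i _) s]
  exact lintegral_finsetSum s fun i _ => ((hg i).measurable.enorm.pow_const 2)

/-- A series of smooth functions with rapidly decreasing Sobolev norms converges together with all
its derivatives. -/
theorem exists_jet_of_sobolev_le (hd : 1 ≤ d) {D : ℕ → E d → ℝ} (hD : ∀ l, ContDiff ℝ ∞ (D l))
    {T : ℝ≥0∞} (hT : T ≠ ⊤)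
    (hb : ∀ l, ∑ α ∈ multiIndices d l, ∫⁻ y in Metric.ball (0 : E d) l,
      ‖multiDeriv α (D l) y‖ₑ ^ 2 ≤ T * (4⁻¹) ^ l) :
    ∃ J : MIdx d → E d → ℝ, IsJet J ∧ ∀ α x, HasSum (fun l => multiDeriv α (D l) x) (J α x) := by
  obtain ⟨c, hc⟩ := exists_sobolev_const d hd
  have hbound : ∀ (α : MIdx d) (r : ℕ), 1 ≤ r → ∃ u : ℕ → ℝ, Summable u ∧
      ∀ l, ∀ x ∈ Metric.ball (0 : E d) r, ‖multiDeriv α (D l) x‖ ≤ u l := by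
    intro α r hr
    set Q : ℝ≥0∞ := c * ENNReal.ofReal ((r : ℝ) ^ (2 * ((d / 2 + 1 : ℕ) : ℝ) - d)) *
      ((multiIndices d (d / 2 + 1)).card * T) with hQ
    have hQt : Q ≠ ⊤ := by
      refine ENNReal.mul_ne_top (ENNReal.mul_ne_top ENNReal.coe_ne_top ENNReal.ofReal_ne_top)
        (ENNReal.mul_ne_top (ENNReal.natCast_ne_top _) hT)
    -- Once `l` exceeds both `r` and `|α| + ⌊d/2⌋ + 1`, the hypothesis covers all derivatives needed
    -- by Sobolev's inequality for `∂^α (D l)` on the ball of radius `r`. The square root turns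
    -- `4⁻ˡ` into the summable `2⁻ˡ`; the finitely many smaller `l` are bounded by compactness.
    have hlarge : ∀ l, max r (α.length + (d / 2 + 1)) ≤ l → ∀ x ∈ Metric.ball (0 : E d) r,
        ‖multiDeriv α (D l) x‖ ≤ √Q.toReal * (1 / 2) ^ l := by
      intro l hl x hx
      have hlr : r ≤ l := (le_max_left _ _).trans hl
      have hlα : α.length + (d / 2 + 1) ≤ l := (le_max_right _ _).trans hl
      have h1 := hc r (by exact_mod_cast hr) (multiDeriv α (D l)) (multiDeriv_contDiff α (hD l)) x hx
      have h2 : ∀ β ∈ multiIndices d (d / 2 + 1), ∫⁻ y in Metric.ball (0 : E d) r,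
          ‖multiDeriv β (multiDeriv α (D l)) y‖ₑ ^ 2 ≤ T * (4⁻¹) ^ l := by
        intro β hβ
        rw [multiDeriv_multiDeriv α β (hD l)]
        refine (lintegral_mono_set (Metric.ball_subset_ball (Nat.cast_le.2 hlr))).trans
          (le_trans ?_ (hb l))
        refine Finset.single_le_sum (f := fun γ => ∫⁻ y in Metric.ball (0 : E d) l,
          ‖multiDeriv γ (D l) y‖ₑ ^ 2) (fun _ _ => zero_le) ?_
        rw [mem_multiIndices, length_add]
        have := mem_multiIndices.1 hβ
        omega
      have h3 : ‖multiDeriv α (D l) x‖ₑ ^ 2 ≤ Q * (4⁻¹) ^ l := by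
        refine h1.trans ?_
        rw [hQ, mul_assoc (_ * _) _ ((4⁻¹ : ℝ≥0∞) ^ l), mul_assoc _ T]
        gcongr
        refine (Finset.sum_le_card_nsmul _ _ _ h2).trans ?_
        rw [nsmul_eq_mul]
      have h4 : ‖multiDeriv α (D l) x‖ ^ 2 ≤ Q.toReal * (1 / 4) ^ l := by
        have h5 := ENNReal.toReal_mono (ENNReal.mul_ne_top hQt (by simp)) h3
        simpa [ENNReal.toReal_mul, ENNReal.toReal_pow] using h5
      rw [Real.norm_eq_abs] at h4 ⊢
      refine abs_le_of_sq_le_sq ?_ (by positivity)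
      rw [sq_abs] at h4
      rw [mul_pow, Real.sq_sqrt ENNReal.toReal_nonneg, ← pow_mul, mul_comm l, pow_mul]
      norm_num at h4 ⊢
      exact h4
    have hsmall : ∀ l, ∃ C, ∀ x ∈ Metric.closedBall (0 : E d) r, ‖multiDeriv α (D l) x‖ ≤ C :=
      fun l => (isCompact_closedBall 0 _).exists_bound_of_continuousOn
        (multiDeriv_contDiff α (hD l)).continuous.continuousOn
    choose C hC using hsmall
    refine ⟨fun l => if max r (α.length + (d / 2 + 1)) ≤ l then √Q.toReal * (1 / 2) ^ l else |C l|,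
      ?_, fun l x hx => ?_⟩
    · refine Summable.of_norm_bounded_eventually_nat (g := fun l => √Q.toReal * (1 / 2) ^ l)
        (summable_geometric_two.mul_left _) ?_
      filter_upwards [eventually_ge_atTop (max r (α.length + (d / 2 + 1)))] with l hl
      rw [if_pos hl, Real.norm_of_nonneg (by positivity)]
    · dsimp only
      split_ifs with hl
      · exact hlarge l hl x hx
      · exact (hC l x (Metric.ball_subset_closedBall hx)).trans (le_abs_self _)
  have hball : ∀ x : E d, ∃ r : ℕ, 1 ≤ r ∧ x ∈ Metric.ball (0 : E d) r := by
    intro x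
    obtain ⟨r, hr⟩ := exists_nat_gt ‖x‖
    refine ⟨r + 1, by omega, ?_⟩
    rw [mem_ball_zero_iff]
    push_cast
    linarith
  have hsum : ∀ α x, Summable fun l => multiDeriv α (D l) x := by
    intro α x
    obtain ⟨r, hr, hx⟩ := hball x
    obtain ⟨u, hu, hub⟩ := hbound α r hr
    exact Summable.of_norm_bounded hu fun l => hub l x hx
  refine ⟨fun α x => ∑' l, multiDeriv α (D l) x, fun α x => ?_, fun α x => (hsum α x).hasSum⟩
  obtain ⟨r, hr, hx⟩ := hball x
  have hbi := fun i : Fin d => hbound (α + Pi.single i 1) r hr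
  choose u hu hub using hbi
  have h1 := hasFDerivAt_tsum_of_isPreconnected (𝕜 := ℝ) (summable_sum fun i (_ : i ∈ Finset.univ) => hu i)
    Metric.isOpen_ball (convex_ball (0 : E d) r).isPreconnected
    (fun l y _ => isJet_vecDeriv (hD l) α y)
    (fun l y hy => (norm_sum_le _ _).trans (Finset.sum_le_sum fun i _ => by
      rw [ContinuousLinearMap.norm_smulRight_apply]
      calc _ ≤ 1 * ‖vecDeriv (α + Pi.single i 1) (D l) y‖ := by
            gcongr
            refine ContinuousLinearMap.opNorm_le_bound _ zero_le_one fun v => ?_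
            rw [one_mul]
            exact PiLp.norm_apply_le v i
        _ ≤ u i l := by
            rw [one_mul]
            exact hub i l y hy)) hx (hsum α x) hx
  convert! h1 using 1
  have h2 : ∀ i : Fin d, HasSum (fun l => (EuclideanSpace.proj i : E d →L[ℝ] ℝ).smulRight
      (vecDeriv (α + Pi.single i 1) (D l) x)) ((EuclideanSpace.proj i : E d →L[ℝ] ℝ).smulRight
      (∑' l, multiDeriv (α + Pi.single i 1) (D l) x)) := fun i =>
    (ContinuousLinearMap.smulRightL ℝ (E d) ℝ (EuclideanSpace.proj i)).hasSum
      (hsum (α + Pi.single i 1) x).hasSum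
  exact (hasSum_sum fun i _ => h2 i).tsum_eq.symm

/-- Tails of convergent series tend to zero. Fast decay along blocks makes a first moment argument
sufficient later on. -/
theorem exists_block_sequence {a : ℕ → ℕ → ℝ≥0∞} (ha : ∀ l, ∑' i, a l i ≠ ⊤) :
    ∃ n : ℕ → ℕ, StrictMono n ∧ ∀ l, ∑' k, a l (k + n l) ≤ 8⁻¹ ^ l := by
  refine extraction_forall_of_eventually'
    (P := fun l m => ∑' k, a l (k + m) ≤ 8⁻¹ ^ l) fun l => ?_
  have h1 : (0 : ℝ≥0∞) < 8⁻¹ ^ l := ENNReal.pow_pos (by simp) l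
  exact eventually_atTop.1 (((ENNReal.tendsto_sum_nat_add (a l) (ha l)).eventually
    (gt_mem_nhds h1)).mono fun i hi => hi.le)

/-- Random series with independent Gaussian coefficients converge almost surely together with all
their derivatives along a suitable subsequence. -/
theorem ae_exists_jet (hd : 1 ≤ d) {f : ℕ → E d → ℝ} (hf : ∀ i, ContDiff ℝ ∞ (f i)) {n : ℕ → ℕ}
    (hn : StrictMono n)
    (hsum : ∀ l, ∑' k, ∑ α ∈ multiIndices d l, ∫⁻ x in Metric.ball (0 : E d) l,
      ‖multiDeriv α (f (k + n l)) x‖ₑ ^ 2 ≤ 8⁻¹ ^ l) :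
    ∀ᵐ w ∂gaussSeq, ∃ J : MIdx d → E d → ℝ, IsJet J ∧ ∀ α x,
      Tendsto (fun l => ∑ i ∈ Finset.range (n l), w i * multiDeriv α (f i) x) atTop
        (𝓝 (J α x)) := by
  set D : ℕ → (ℕ → ℝ) → E d → ℝ := fun l w x =>
    ∑ i ∈ Finset.Ico (n l) (n (l + 1)), w i * f i x with hD
  have hDd : ∀ l w α, multiDeriv α (D l w) = fun x =>
      ∑ i ∈ Finset.Ico (n l) (n (l + 1)), w i * multiDeriv α (f i) x := fun l w α =>
    multiDeriv_sum_mul hf w _ α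
  have hDs : ∀ l w, ContDiff ℝ ∞ (D l w) := fun l w =>
    ContDiff.sum fun i _ => contDiff_const.mul (hf i)
  set N : ℕ → (ℕ → ℝ) → ℝ≥0∞ := fun l w => ∑ α ∈ multiIndices d l,
    ∫⁻ x in Metric.ball (0 : E d) l, ‖multiDeriv α (D l w) x‖ₑ ^ 2 with hN
  have hmeas : ∀ (l : ℕ) (α : MIdx d), Measurable fun w : ℕ → ℝ =>
      ∫⁻ x in Metric.ball (0 : E d) l, ‖multiDeriv α (D l w) x‖ₑ ^ 2 := by
    intro l α
    simp only [hDd]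
    exact measurable_lintegral_sum_mul (fun i => (multiDeriv_contDiff α (hf i)).continuous) _ _
  have hNm : ∀ l, Measurable (N l) := fun l => Finset.measurable_fun_sum _ fun α _ => hmeas l α
  have hNi : ∀ l, ∫⁻ w, N l w ∂gaussSeq ≤ 8⁻¹ ^ l := by
    intro l
    refine le_trans (le_of_eq ?_) ((ENNReal.sum_le_tsum (Finset.range (n (l + 1) - n l))).trans
      (hsum l))
    rw [lintegral_finsetSum _ fun α _ => hmeas l α, Finset.sum_comm]
    refine Finset.sum_congr rfl fun α _ => ?_
    simp only [hDd]
    rw [lintegral_lintegral_sum_gaussSeq fun i => (multiDeriv_contDiff α (hf i)).continuous,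
      Finset.sum_Ico_eq_sum_range]
    exact Finset.sum_congr rfl fun k _ => by rw [add_comm]
  -- The block energies have mean at most `8⁻ˡ`, so `∑ 4ˡ N l` has finite mean and is almost surely
  -- finite. Its value `T` then gives `N l ≤ T 4⁻ˡ` for every `l`.
  have hfin : ∫⁻ w, ∑' l, 4 ^ l * N l w ∂gaussSeq ≠ ⊤ := by
    rw [lintegral_tsum fun l => ((hNm l).const_mul _).aemeasurable]
    have h1 : ∀ l, ∫⁻ w, 4 ^ l * N l w ∂gaussSeq ≤ 2⁻¹ ^ l := by
      intro l
      rw [lintegral_const_mul _ (hNm l)]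
      refine (mul_le_mul_right (hNi l) _).trans (le_of_eq ?_)
      rw [← mul_pow]
      congr 1
      rw [show (8 : ℝ≥0∞) = 4 * 2 by norm_num, ENNReal.mul_inv (by simp) (by simp), ← mul_assoc,
        ENNReal.mul_inv_cancel (by simp) (by simp), one_mul]
    refine ((ENNReal.tsum_le_tsum h1).trans_lt ?_).ne
    rw [ENNReal.tsum_geometric, ENNReal.one_sub_inv_two, inv_inv]
    exact ENNReal.ofNat_lt_top
  filter_upwards [ae_lt_top (Measurable.tsum fun l => (hNm l).const_mul _) hfin] with w hw
  obtain ⟨J, hJ, hJs⟩ := exists_jet_of_sobolev_le hd (hDs · w) hw.ne fun l => by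
    have h1 : (4 : ℝ≥0∞) ^ l * N l w ≤ ∑' l, 4 ^ l * N l w := ENNReal.le_tsum l
    calc N l w = 4⁻¹ ^ l * (4 ^ l * N l w) := by
          rw [← mul_assoc, ← mul_pow, ENNReal.inv_mul_cancel (by simp) (by simp), one_pow, one_mul]
      _ ≤ _ := by rw [mul_comm]; gcongr
  -- The blocks start at `n 0`, so the initial finite sum is added separately.
  refine ⟨_, (isJet_sum_mul hf w (Finset.range (n 0))).add hJ, fun α x => ?_⟩
  have h1 := (hJs α x).tendsto_sum_nat.const_add
    (∑ i ∈ Finset.range (n 0), w i * multiDeriv α (f i) x)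
  refine h1.congr fun l => ?_
  simp only [hDd]
  induction l with
  | zero => simp
  | succ l ih =>
    rw [Finset.sum_range_succ, ← add_assoc, ih,
      Finset.sum_range_add_sum_Ico _ (hn.monotone (Nat.le_succ l))]

end

/-! ### Construction of the jointly Gaussian smooth field -/

section

open scoped Topology InnerProductSpace
open Filter

section Limits

variable {c c' : ℕ → ℝ} {v v' k : ℝ} {n : ℕ → ℕ} {Z Z' : (ℕ → ℝ) → ℝ}

theorem hasGaussianLaw_limit (hc : HasSum (fun i => c i ^ 2) v) (hn : StrictMono n)
    (hZ : ∀ᵐ w ∂gaussSeq,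
      Tendsto (fun l => ∑ i ∈ Finset.range (n l), w i * c i) atTop (𝓝 (Z w))) :
    HasGaussianLaw Z gaussSeq :=
  ⟨by rw [map_limit_gaussSeq hc hn hZ]; infer_instance⟩

theorem integral_limit (hc : HasSum (fun i => c i ^ 2) v) (hn : StrictMono n)
    (hZ : ∀ᵐ w ∂gaussSeq,
      Tendsto (fun l => ∑ i ∈ Finset.range (n l), w i * c i) atTop (𝓝 (Z w))) :
    ∫ w, Z w ∂gaussSeq = 0 := by
  have h1 : ∫ y, y ∂(gaussSeq.map Z) = 0 := by
    rw [map_limit_gaussSeq hc hn hZ, integral_id_gaussianReal]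
  rwa [integral_map (hasGaussianLaw_limit hc hn hZ).aemeasurable (by fun_prop)] at h1

theorem variance_limit (hc : HasSum (fun i => c i ^ 2) v) (hn : StrictMono n)
    (hZ : ∀ᵐ w ∂gaussSeq,
      Tendsto (fun l => ∑ i ∈ Finset.range (n l), w i * c i) atTop (𝓝 (Z w))) :
    Var[Z; gaussSeq] = v := by
  have h1 : Var[id; gaussSeq.map Z] = v := by
    rw [map_limit_gaussSeq hc hn hZ, variance_id_gaussianReal,
      Real.coe_toNNReal _ (hc.nonneg fun _ => sq_nonneg _)]
  rwa [variance_map aemeasurable_id (hasGaussianLaw_limit hc hn hZ).aemeasurable] at h1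

/-- Polarisation: the sum of two limits is a limit of the same kind, with variance `v + 2k + v'`. -/
theorem covariance_limit (hc : HasSum (fun i => c i ^ 2) v) (hc' : HasSum (fun i => c' i ^ 2) v')
    (hk : HasSum (fun i => c i * c' i) k) (hn : StrictMono n)
    (hZ : ∀ᵐ w ∂gaussSeq,
      Tendsto (fun l => ∑ i ∈ Finset.range (n l), w i * c i) atTop (𝓝 (Z w)))
    (hZ' : ∀ᵐ w ∂gaussSeq,
      Tendsto (fun l => ∑ i ∈ Finset.range (n l), w i * c' i) atTop (𝓝 (Z' w))) :
    cov[Z, Z'; gaussSeq] = k := by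
  have h1 := variance_add (hasGaussianLaw_limit hc hn hZ).memLp_two
    (hasGaussianLaw_limit hc' hn hZ').memLp_two
  have h2 : HasSum (fun i => (c i + c' i) ^ 2) (v + 2 * k + v') := by
    convert! (hc.add (hk.mul_left 2)).add hc' using 1
    funext i
    ring
  have h3 : ∀ᵐ w ∂gaussSeq, Tendsto (fun l => ∑ i ∈ Finset.range (n l), w i * (c i + c' i)) atTop
      (𝓝 ((Z + Z') w)) := by
    filter_upwards [hZ, hZ'] with w h h'
    simp_rw [mul_add, Finset.sum_add_distrib]
    exact h.add h'
  rw [variance_limit h2 hn h3, variance_limit hc hn hZ, variance_limit hc' hn hZ'] at h1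
  linarith

end Limits

variable {d : ℕ}

/-- Any linear functional `L` of finitely many values is again a limit of series, with coefficients
`L (f i, g i)`, and hence Gaussian. The common subsequence `n` is essential here. -/
theorem isGaussianProcess_limit {S : Set (E d)} {f g : ℕ → E d → ℝ}
    (hf : ∀ x, Summable fun i => f i x ^ 2) (hg : ∀ x, Summable fun i => g i x ^ 2) {n : ℕ → ℕ}
    (hn : StrictMono n) {X Y : E d → (ℕ → ℝ) → ℝ} (hX : ∀ x, Measurable (X x))
    (hY : ∀ x, Measurable (Y x))
    (hXl : ∀ x, ∀ᵐ w ∂gaussSeq,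
      Tendsto (fun l => ∑ i ∈ Finset.range (n l), w i * f i x) atTop (𝓝 (X x w)))
    (hYl : ∀ x, ∀ᵐ w ∂gaussSeq,
      Tendsto (fun l => ∑ i ∈ Finset.range (n l), w i * g i x) atTop (𝓝 (Y x w))) :
    IsGaussianProcess (fun (z : S) w => (X z w, Y z w)) gaussSeq := by
  refine ⟨fun I => ⟨isGaussian_of_map_eq_gaussianReal fun L => ?_⟩⟩
  set V : (ℕ → ℝ) → I → ℝ × ℝ := fun w k => (X k.1 w, Y k.1 w) with hV
  have hVm : Measurable V :=
    measurable_pi_lambda _ fun k => (hX _).prodMk (hY _)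
  set c : ℕ → ℝ := fun i => L fun k => (f i k.1, g i k.1) with hc
  have hcs : Summable fun i => c i ^ 2 := by
    have h1 : Summable fun i => ‖L‖ ^ 2 * ∑ k : I, (f i k.1 ^ 2 + g i k.1 ^ 2) :=
      (summable_sum fun k (_ : k ∈ Finset.univ) => (hf _).add (hg _)).mul_left _
    refine Summable.of_nonneg_of_le (fun i => sq_nonneg _) (fun i => ?_) h1
    have h2 : ‖fun k : I => (f i k.1, g i k.1)‖ ≤ √(∑ k : I, (f i k.1 ^ 2 + g i k.1 ^ 2)) := by
      refine (pi_norm_le_iff_of_nonneg (Real.sqrt_nonneg _)).2 fun k => ?_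
      have h3 : f i k.1 ^ 2 + g i k.1 ^ 2 ≤ ∑ k : I, (f i k.1 ^ 2 + g i k.1 ^ 2) :=
        Finset.single_le_sum (f := fun k : I => f i k.1 ^ 2 + g i k.1 ^ 2)
          (fun _ _ => by positivity) (Finset.mem_univ k)
      refine max_le (Real.abs_le_sqrt ?_) (Real.abs_le_sqrt ?_)
      · nlinarith [sq_nonneg (g i k.1)]
      · nlinarith [sq_nonneg (f i k.1)]
    have h3 : 0 ≤ ∑ k : I, (f i k.1 ^ 2 + g i k.1 ^ 2) :=
      Finset.sum_nonneg fun _ _ => by positivity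
    calc c i ^ 2 = ‖c i‖ ^ 2 := by rw [Real.norm_eq_abs, sq_abs]
      _ ≤ (‖L‖ * √(∑ k : I, (f i k.1 ^ 2 + g i k.1 ^ 2))) ^ 2 := by
          gcongr
          exact (L.le_opNorm _).trans (by gcongr)
      _ = _ := by rw [mul_pow, Real.sq_sqrt h3]
  refine ⟨0, (∑' i, c i ^ 2).toNNReal, ?_⟩
  have hlim : ∀ᵐ w ∂gaussSeq, Tendsto (fun l => ∑ i ∈ Finset.range (n l), w i * c i) atTop
      (𝓝 (L (V w))) := by
    have h1 : ∀ᵐ w ∂gaussSeq, ∀ k : I,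
        Tendsto (fun l => ∑ i ∈ Finset.range (n l), w i * f i k.1) atTop (𝓝 (X k.1 w)) ∧
        Tendsto (fun l => ∑ i ∈ Finset.range (n l), w i * g i k.1) atTop (𝓝 (Y k.1 w)) :=
      ae_all_iff.2 fun k => (hXl _).and (hYl _)
    filter_upwards [h1] with w hw
    have h2 : Tendsto (fun l (k : I) => (∑ i ∈ Finset.range (n l), w i * f i k.1,
        ∑ i ∈ Finset.range (n l), w i * g i k.1)) atTop (𝓝 (V w)) :=
      tendsto_pi_nhds.2 fun k => (hw k).1.prodMk_nhds (hw k).2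
    refine ((L.continuous.tendsto _).comp h2).congr fun l => ?_
    have h3 : (fun k : I => (∑ i ∈ Finset.range (n l), w i * f i k.1,
        ∑ i ∈ Finset.range (n l), w i * g i k.1)) =
        ∑ i ∈ Finset.range (n l), w i • fun k : I => (f i k.1, g i k.1) := by
      funext k
      simp [Finset.sum_apply, Prod.ext_iff, Prod.fst_sum, Prod.snd_sum]
    rw [Function.comp_apply, h3, map_sum]
    simp [hc]
  have h4 := map_limit_gaussSeq hcs.hasSum hn hlim
  rw [← h4]
  exact Measure.map_map L.continuous.measurable hVm

theorem exists_smooth_process (hd : 1 ≤ d) {f : ℕ → E d → ℝ} (hf : ∀ i, ContDiff ℝ ∞ (f i))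
    {n : ℕ → ℕ} (hn : StrictMono n)
    (hsum : ∀ l, ∑' k, ∑ α ∈ multiIndices d l, ∫⁻ x in Metric.ball (0 : E d) l,
      ‖multiDeriv α (f (k + n l)) x‖ₑ ^ 2 ≤ 8⁻¹ ^ l) :
    ∃ X : E d → (ℕ → ℝ) → ℝ, (∀ x, Measurable (X x)) ∧
      (∀ w, ContDiff ℝ ∞ fun x => X x w) ∧ ∀ᵐ w ∂gaussSeq, ∀ α x,
      Tendsto (fun l => ∑ i ∈ Finset.range (n l), w i * multiDeriv α (f i) x) atTop
        (𝓝 (multiDeriv α (fun x => X x w) x)) := by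
  classical
  -- The field is set to zero off a measurable set of full measure on which the series converges.
  -- All paths, and not only almost all, are then smooth.
  obtain ⟨G, hG, hGm, hGJ⟩ := (ae_exists_jet hd hf hn hsum).exists_measurable_mem
  choose! J hJ hJl using hGJ
  have hz : ∀ i x, multiDeriv 0 (f i) x = f i x := fun i x => by
    rw [← vecDeriv_real, vecDeriv_zero]
  refine ⟨fun x => G.indicator fun w => J w 0 x, fun x => ?_, fun w => ?_, ?_⟩
  · refine measurable_of_tendsto_metrizable (f := fun l => G.indicator fun w =>
      ∑ i ∈ Finset.range (n l), w i * f i x) (fun l => Measurable.indicator (by fun_prop) hGm)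
      (tendsto_pi_nhds.2 fun w => ?_)
    by_cases hw : w ∈ G
    · simp only [Set.indicator_of_mem hw]
      simpa only [hz] using hJl w hw 0 x
    · simp only [Set.indicator_of_notMem hw]
      exact tendsto_const_nhds
  · by_cases hw : w ∈ G
    · simp only [Set.indicator_of_mem hw]
      exact (hJ w hw).contDiff 0
    · simp only [Set.indicator_of_notMem hw]
      exact contDiff_const
  · filter_upwards [hG] with w hw α x
    simp only [Set.indicator_of_mem hw]
    have h1 := hJl w hw α x
    rwa [← (hJ w hw).vecDeriv_eq α] at h1

theorem lintegral_ball_lt_top {F : Type*} [NormedAddCommGroup F] {u : E d → F} (hu : Continuous u)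
    (r : ℝ) : ∫⁻ x in Metric.ball (0 : E d) r, ‖u x‖ₑ ^ 2 < ⊤ := by
  obtain ⟨C, hC⟩ := (isCompact_closedBall (0 : E d) r).exists_bound_of_continuousOn hu.continuousOn
  refine (setLIntegral_mono (g := fun _ => ENNReal.ofReal C ^ 2) measurable_const
    fun x hx => ?_).trans_lt ?_
  · rw [← ofReal_norm]
    gcongr
    exact hC x (Metric.ball_subset_closedBall hx)
  · rw [setLIntegral_const]
    exact ENNReal.mul_lt_top (by simp) measure_ball_lt_top

/-- Jointly Gaussian fields with smooth sample paths and given smooth feature maps. -/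
theorem exists_gaussian_field (hd : 1 ≤ d) {H : Type*} [NormedAddCommGroup H]
    [InnerProductSpace ℝ H] [CompleteSpace H] {φ ψ : E d → H} (hφ : ContDiff ℝ ∞ φ)
    (hψ : ContDiff ℝ ∞ ψ) :
    ∃ X Y : E d → (ℕ → ℝ) → ℝ, (∀ x, Measurable (X x)) ∧ (∀ x, Measurable (Y x)) ∧
      (∀ w, ContDiff ℝ ∞ fun x => X x w) ∧ (∀ w, ContDiff ℝ ∞ fun x => Y x w) ∧
      (∀ S : Set (E d), IsGaussianProcess (fun (z : S) w => (X z w, Y z w)) gaussSeq) ∧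
      (∀ x, ∫ w, X x w ∂gaussSeq = 0) ∧ (∀ x, ∫ w, Y x w ∂gaussSeq = 0) ∧
      (∀ x y, cov[X x, X y; gaussSeq] = ⟪φ x, φ y⟫_ℝ) ∧
      (∀ x y, cov[Y x, Y y; gaussSeq] = ⟪ψ x, ψ y⟫_ℝ) ∧
      ∀ (s : Finset (MIdx d)) (B : Set (E d)),
        ∫⁻ w, ∑ α ∈ s, (∫⁻ x in B, ‖multiDeriv α (fun x => X x w - Y x w) x‖ₑ ^ 2) ∂gaussSeq ≤
          ∑ α ∈ s, ∫⁻ x in B, ‖vecDeriv α φ x - vecDeriv α ψ x‖ₑ ^ 2 := by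
  obtain ⟨e, he⟩ := exists_coordinates hφ hψ
  have hcoord : ∀ {χ : E d → H}, ContDiff ℝ ∞ χ → ∀ i α x,
      multiDeriv α (fun x => ⟪χ x, e i⟫_ℝ) x = ⟪vecDeriv α χ x, e i⟫_ℝ := by
    intro χ hχ i α x
    have := congrFun (vecDeriv_clm (innerSL ℝ (e i)) hχ α) x
    simp only [innerSL_apply_apply] at this
    simp only [real_inner_comm (e i)]
    exact this
  have hpars : ∀ v : H, HasSum (fun i => ⟪v, e i⟫_ℝ * ⟪v, e i⟫_ℝ) ⟪v, v⟫_ℝ →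
      ∑' i, ‖⟪v, e i⟫_ℝ‖ₑ ^ 2 = ‖v‖ₑ ^ 2 := by
    intro v hv
    have h1 : ∀ i, ‖⟪v, e i⟫_ℝ‖ₑ ^ 2 = ENNReal.ofReal (⟪v, e i⟫_ℝ * ⟪v, e i⟫_ℝ) := fun i => by
      rw [← ofReal_norm, ← ENNReal.ofReal_pow (norm_nonneg _), Real.norm_eq_abs, sq_abs, sq]
    simp_rw [h1]
    rw [← ENNReal.ofReal_tsum_of_nonneg (fun i => mul_self_nonneg _) hv.summable, hv.tsum_eq,
      real_inner_self_eq_norm_sq, ENNReal.ofReal_pow (norm_nonneg _), ofReal_norm]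
  have hφp : ∀ α x, ∑' i, ‖⟪vecDeriv α φ x, e i⟫_ℝ‖ₑ ^ 2 = ‖vecDeriv α φ x‖ₑ ^ 2 := fun α x =>
    hpars _ (he α x _).1
  have hψp : ∀ α x, ∑' i, ‖⟪vecDeriv α ψ x, e i⟫_ℝ‖ₑ ^ 2 = ‖vecDeriv α ψ x‖ₑ ^ 2 := fun α x =>
    hpars _ (he α x _).2
  have hdp : ∀ α x, ∑' i, ‖⟪vecDeriv α φ x - vecDeriv α ψ x, e i⟫_ℝ‖ₑ ^ 2 =
      ‖vecDeriv α φ x - vecDeriv α ψ x‖ₑ ^ 2 := fun α x => by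
    refine hpars _ ?_
    convert! (he α x (vecDeriv α φ x - vecDeriv α ψ x)).1.sub
      (he α x (vecDeriv α φ x - vecDeriv α ψ x)).2 using 1
    · funext i; rw [inner_sub_left]; ring
    · rw [← inner_sub_left]
  have hsm : ∀ {χ : E d → H}, ContDiff ℝ ∞ χ → ∀ i, ContDiff ℝ ∞ fun x => ⟪χ x, e i⟫_ℝ :=
    fun hχ i => hχ.inner ℝ contDiff_const
  -- The energies for `φ` and `ψ` are added so that one block sequence serves both fields.
  set a : ℕ → ℕ → ℝ≥0∞ := fun l i => (∑ α ∈ multiIndices d l, ∫⁻ x in Metric.ball (0 : E d) l,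
      ‖multiDeriv α (fun x => ⟪φ x, e i⟫_ℝ) x‖ₑ ^ 2) + ∑ α ∈ multiIndices d l,
      ∫⁻ x in Metric.ball (0 : E d) l, ‖multiDeriv α (fun x => ⟪ψ x, e i⟫_ℝ) x‖ₑ ^ 2 with ha
  have hfin : ∀ {χ : E d → H}, ContDiff ℝ ∞ χ →
      (∀ α x, ∑' i, ‖⟪vecDeriv α χ x, e i⟫_ℝ‖ₑ ^ 2 = ‖vecDeriv α χ x‖ₑ ^ 2) → ∀ l : ℕ,
      ∑' i, ∑ α ∈ multiIndices d l, ∫⁻ x in Metric.ball (0 : E d) l,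
        ‖multiDeriv α (fun x => ⟪χ x, e i⟫_ℝ) x‖ₑ ^ 2 ≠ ⊤ := by
    intro χ hχ hp l
    rw [Summable.tsum_finsetSum fun _ _ => ENNReal.summable]
    refine (ENNReal.sum_lt_top.2 fun α _ => ?_).ne
    rw [← lintegral_tsum fun i =>
      ((multiDeriv_contDiff α (hsm hχ i)).continuous.measurable.enorm.pow_const 2).aemeasurable]
    simp_rw [hcoord hχ, hp]
    exact lintegral_ball_lt_top (vecDeriv_contDiff α hχ).continuous _
  obtain ⟨n, hn, hna⟩ := exists_block_sequence (a := a) fun l => by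
    rw [ENNReal.tsum_add]
    exact ENNReal.add_ne_top.2 ⟨hfin hφ hφp l, hfin hψ hψp l⟩
  obtain ⟨X, hXm, hXs, hXl⟩ := exists_smooth_process hd (hsm hφ) hn fun l =>
    (ENNReal.tsum_le_tsum fun k => le_self_add).trans (hna l)
  obtain ⟨Y, hYm, hYs, hYl⟩ := exists_smooth_process hd (hsm hψ) hn fun l =>
    (ENNReal.tsum_le_tsum fun k => le_add_self).trans (hna l)
  have hz : ∀ u : E d → ℝ, multiDeriv 0 u = u := fun u => vecDeriv_zero u
  have hX0 : ∀ x, ∀ᵐ w ∂gaussSeq, Tendsto (fun l => ∑ i ∈ Finset.range (n l), w i * ⟪φ x, e i⟫_ℝ)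
      atTop (𝓝 (X x w)) := fun x => by
    filter_upwards [hXl] with w hw
    simpa only [hz] using hw 0 x
  have hY0 : ∀ x, ∀ᵐ w ∂gaussSeq, Tendsto (fun l => ∑ i ∈ Finset.range (n l), w i * ⟪ψ x, e i⟫_ℝ)
      atTop (𝓝 (Y x w)) := fun x => by
    filter_upwards [hYl] with w hw
    simpa only [hz] using hw 0 x
  have hφi : ∀ x v, HasSum (fun i => ⟪φ x, e i⟫_ℝ * ⟪v, e i⟫_ℝ) ⟪φ x, v⟫_ℝ := fun x v => by
    simpa only [vecDeriv_zero] using (he 0 x v).1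
  have hψi : ∀ x v, HasSum (fun i => ⟪ψ x, e i⟫_ℝ * ⟪v, e i⟫_ℝ) ⟪ψ x, v⟫_ℝ := fun x v => by
    simpa only [vecDeriv_zero] using (he 0 x v).2
  have hφq : ∀ x, HasSum (fun i => ⟪φ x, e i⟫_ℝ ^ 2) ⟪φ x, φ x⟫_ℝ := fun x => by
    simpa only [sq] using hφi x (φ x)
  have hψq : ∀ x, HasSum (fun i => ⟪ψ x, e i⟫_ℝ ^ 2) ⟪ψ x, ψ x⟫_ℝ := fun x => by
    simpa only [sq] using hψi x (ψ x)
  refine ⟨X, Y, hXm, hYm, hXs, hYs, fun S => isGaussianProcess_limit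
    (f := fun i x => ⟪φ x, e i⟫_ℝ) (g := fun i x => ⟪ψ x, e i⟫_ℝ) (fun x => (hφq x).summable)
    (fun x => (hψq x).summable) hn hXm hYm hX0 hY0, fun x => integral_limit (hφq x) hn (hX0 x),
    fun x => integral_limit (hψq x) hn (hY0 x),
    fun x y => covariance_limit (hφq x) (hφq y) (hφi x _) hn (hX0 x) (hX0 y),
    fun x y => covariance_limit (hψq x) (hψq y) (hψi x _) hn (hY0 x) (hY0 y), fun s B => ?_⟩
  -- Since `X` and `Y` share their Gaussian coefficients, the derivatives of `X - Y` are limits of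
  -- the series with coefficients `δ`.
  set δ : MIdx d → ℕ → E d → ℝ := fun α i x => ⟪vecDeriv α φ x - vecDeriv α ψ x, e i⟫_ℝ with hδ
  have hδc : ∀ α i, Continuous (δ α i) := fun α i =>
    ((vecDeriv_contDiff α hφ).continuous.sub (vecDeriv_contDiff α hψ).continuous).inner
      continuous_const
  set S : MIdx d → ℕ → (ℕ → ℝ) → ℝ≥0∞ := fun α l w =>
    ∫⁻ x in B, ‖∑ i ∈ Finset.range (n l), w i * δ α i x‖ₑ ^ 2 with hS
  have hSm : ∀ α l, Measurable (S α l) := fun α l => measurable_lintegral_sum_mul (hδc α) _ _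
  -- Only an upper bound on the expected energy is needed, so Fatou's lemma replaces `L²`
  -- convergence, here in `x` and below in `w`.
  have h1 : ∀ᵐ w ∂gaussSeq, ∀ α, ∫⁻ x in B, ‖multiDeriv α (fun x => X x w - Y x w) x‖ₑ ^ 2 ≤
      liminf (fun l => S α l w) atTop := by
    filter_upwards [hXl, hYl] with w hwX hwY α
    have h2 : ∀ x, Tendsto (fun l => ∑ i ∈ Finset.range (n l), w i * δ α i x) atTop
        (𝓝 (multiDeriv α (fun x => X x w - Y x w) x)) := by
      intro x
      have h3 : multiDeriv α (fun x => X x w - Y x w) x =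
          multiDeriv α (fun x => X x w) x - multiDeriv α (fun x => Y x w) x :=
        multiDeriv_sub (hXs w) (hYs w) α x
      rw [h3]
      refine ((hwX α x).sub (hwY α x)).congr fun l => ?_
      rw [← Finset.sum_sub_distrib]
      refine Finset.sum_congr rfl fun i _ => ?_
      rw [hcoord hφ, hcoord hψ, ← mul_sub, ← inner_sub_left]
    refine le_trans (le_of_eq (lintegral_congr fun x => ?_)) (lintegral_liminf_le fun l => ?_)
    · have h4 : Continuous fun y : ℝ => ‖y‖ₑ ^ 2 := by fun_prop
      exact ((h4.tendsto _).comp (h2 x)).liminf_eq.symm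
    · exact (continuous_finsetSum _ fun i _ => (hδc α i).const_mul _).measurable.enorm.pow_const 2
  calc _ ≤ ∫⁻ w, ∑ α ∈ s, liminf (fun l => S α l w) atTop ∂gaussSeq :=
        lintegral_mono_ae (h1.mono fun w hw => Finset.sum_le_sum fun α _ => hw α)
    _ = ∑ α ∈ s, ∫⁻ w, liminf (fun l => S α l w) atTop ∂gaussSeq :=
        lintegral_finsetSum s fun α _ => Measurable.liminf fun l => hSm α l
    _ ≤ _ := Finset.sum_le_sum fun α _ => ?_
  refine (lintegral_liminf_le fun l => hSm α l).trans ?_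
  refine liminf_le_of_le (by isBoundedDefault) fun b hb => ?_
  obtain ⟨l, hl⟩ := hb.exists
  refine hl.trans ?_
  rw [lintegral_lintegral_sum_gaussSeq (hδc α)]
  refine (ENNReal.sum_le_tsum _).trans (le_of_eq ?_)
  rw [← lintegral_tsum fun i => ((hδc α i).measurable.enorm.pow_const 2).aemeasurable]
  simp_rw [hδ, hdp]

end

/-! ### Weak derivatives and the Sobolev and `C_b` norms -/

section

open scoped Topology InnerProductSpace

variable {d : ℕ}

theorem MIdx.induction {p : MIdx d → Prop} (h0 : p 0)
    (hs : ∀ (α : MIdx d) (i : Fin d), p α → p (α + Pi.single i 1)) (α : MIdx d) : p α := by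
  suffices H : ∀ n (α : MIdx d), ∑ i, α i = n → p α from H _ α rfl
  intro n
  induction n with
  | zero =>
    intro α hα
    have : α = 0 := funext fun i => (Finset.sum_eq_zero_iff.1 hα) i (Finset.mem_univ i)
    rwa [this]
  | succ n ih =>
    intro α hα
    obtain ⟨i, -, hi⟩ := Finset.exists_ne_zero_of_sum_ne_zero (by rw [hα]; omega : ∑ i, α i ≠ 0)
    have h1 : α - Pi.single i 1 + Pi.single i 1 = α := by
      funext k
      by_cases hk : k = i
      · subst hk
        simp
        omega
      · simp [hk]
    rw [← h1]
    refine hs _ i (ih _ ?_)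
    have h2 : ∑ k, (α - Pi.single i 1 + Pi.single i 1 : MIdx d) k = n + 1 := by rw [h1, hα]
    simp only [Pi.add_apply, Finset.sum_add_distrib, Finset.sum_pi_single', Finset.mem_univ,
      if_true] at h2
    omega

theorem multiDeriv_add_single (α : MIdx d) (i : Fin d) {u : E d → ℝ} (hu : ContDiff ℝ ∞ u) :
    multiDeriv (α + Pi.single i 1) u =
      fun x => fderiv ℝ (multiDeriv α u) x (EuclideanSpace.single i 1) :=
  vecDeriv_add_single α i hu

theorem tsupport_multiDeriv_subset (α : MIdx d) {u : E d → ℝ} (hu : ContDiff ℝ ∞ u) :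
    tsupport (multiDeriv α u) ⊆ tsupport u := by
  induction α using MIdx.induction with
  | h0 => rw [← vecDeriv_real, vecDeriv_zero]
  | hs α i ih =>
    rw [multiDeriv_add_single α i hu]
    exact (tsupport_fderiv_apply_subset ℝ _).trans ih

/-- Integration by parts, one derivative at a time. The induction is over all `u`, since each step
replaces `u` by a partial derivative of `u`. -/
theorem integral_mul_multiDeriv (α : MIdx d) {u φ : E d → ℝ} (hu : ContDiff ℝ ∞ u)
    (hφ : ContDiff ℝ ∞ φ) (hc : HasCompactSupport φ) :
    ∫ x, u x * multiDeriv α φ x = (-1) ^ α.length * ∫ x, multiDeriv α u x * φ x := by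
  induction α using MIdx.induction generalizing u with
  | h0 =>
    have hz : ∀ u : E d → ℝ, multiDeriv 0 u = u := fun u => vecDeriv_zero u
    simp [hz, MIdx.length]
  | hs α i ih =>
    have hsingle : multiDeriv (Pi.single i 1) u =
        fun x => fderiv ℝ u x (EuclideanSpace.single i 1) := by
      have := multiDeriv_add_single 0 i hu
      rwa [zero_add, show multiDeriv 0 u = u from vecDeriv_zero u] at this
    have hαc : HasCompactSupport (multiDeriv α φ) :=
      hc.mono' ((subset_tsupport _).trans (tsupport_multiDeriv_subset α hφ))
    have hαs := multiDeriv_contDiff α hφ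
    have h1 := multiDeriv_contDiff (Pi.single i 1) hu
    have h2 : Continuous fun x => fderiv ℝ (multiDeriv α φ) x (EuclideanSpace.single i 1) := by
      rw [← multiDeriv_add_single α i hφ]
      exact (multiDeriv_contDiff _ hφ).continuous
    have h2c : HasCompactSupport
        fun x => fderiv ℝ (multiDeriv α φ) x (EuclideanSpace.single i 1) :=
      hαc.mono' ((subset_tsupport _).trans (tsupport_fderiv_apply_subset ℝ _))
    have h3 := integral_mul_fderiv_eq_neg_fderiv_mul_of_integrable (μ := volume) (f := u)
      (g := multiDeriv α φ) (v := EuclideanSpace.single i 1)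
      (by
        rw [hsingle] at h1
        exact (h1.continuous.mul hαs.continuous).integrable_of_hasCompactSupport hαc.mul_left)
      ((hu.continuous.mul h2).integrable_of_hasCompactSupport h2c.mul_left)
      ((hu.continuous.mul hαs.continuous).integrable_of_hasCompactSupport hαc.mul_left)
      (fun x _ => hu.differentiable (by simp) x) (fun x _ => hαs.differentiable (by simp) x)
    have h4 := ih h1
    rw [multiDeriv_multiDeriv _ _ hu, add_comm, hsingle] at h4
    rw [multiDeriv_add_single α i hφ, h3, h4, length_add]
    have h5 : MIdx.length (Pi.single i 1 : MIdx d) = 1 := by simp [MIdx.length]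
    rw [h5, pow_succ]
    ring

theorem hasWeakDeriv_multiDeriv (U : Set (E d)) (α : MIdx d) {u : E d → ℝ}
    (hu : ContDiff ℝ ∞ u) : HasWeakDeriv U α u (multiDeriv α u) where
  locallyIntegrable := hu.continuous.locallyIntegrable.locallyIntegrableOn U
  locallyIntegrable_deriv :=
    (multiDeriv_contDiff α hu).continuous.locallyIntegrable.locallyIntegrableOn U
  integral_eq φ hφ hc hU := by
    have h1 : ∀ x ∉ U, φ x = 0 := fun x hx =>
      image_eq_zero_of_notMem_tsupport fun h => hx (hU h)
    have h2 : ∀ x ∉ U, multiDeriv α φ x = 0 := fun x hx =>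
      image_eq_zero_of_notMem_tsupport fun h => hx (hU (tsupport_multiDeriv_subset α hφ h))
    rw [setIntegral_eq_integral_of_forall_compl_eq_zero fun x hx => by rw [h2 x hx, mul_zero],
      setIntegral_eq_integral_of_forall_compl_eq_zero fun x hx => by rw [h1 x hx, mul_zero]]
    exact integral_mul_multiDeriv α hu hφ hc

/-- Classical derivatives are weak derivatives, hence an admissible choice in the infimum. -/
theorem sobolevNorm_sq_le (U : Set (E d)) (k : ℕ) {u : E d → ℝ} (hu : ContDiff ℝ ∞ u) :
    sobolevNorm U k u ^ 2 ≤ ∑ α ∈ multiIndices d k, ∫⁻ x in U, ‖multiDeriv α u x‖ₑ ^ 2 := by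
  have h1 : sobolevNorm U k u ≤ (∑ α ∈ multiIndices d k,
      eLpNorm (multiDeriv α u) 2 (volume.restrict U) ^ 2) ^ (1 / 2 : ℝ) :=
    iInf₂_le (fun α => multiDeriv α u) fun α _ => hasWeakDeriv_multiDeriv U α hu
  refine (pow_le_pow_left' h1 2).trans (le_of_eq ?_)
  rw [rpow_half_sq]
  refine Finset.sum_congr rfl fun α _ => ?_
  have h2 := eLpNorm_nnreal_pow_eq_lintegral (μ := volume.restrict U) (f := multiDeriv α u)
    (p := 2) two_ne_zero
  simpa using h2

theorem memCb_ball (R : ℝ) (k : ℕ) {u : E d → ℝ} (hu : ContDiff ℝ ∞ u) :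
    MemCb (Metric.ball (0 : E d) R) k u where
  contDiffOn := (hu.of_le (by exact_mod_cast le_top)).contDiffOn
  uniformContinuousOn α _ :=
    ((isCompact_closedBall (0 : E d) R).uniformContinuousOn_of_continuous
      (multiDeriv_contDiff α hu).continuous.continuousOn).mono Metric.ball_subset_closedBall
  bounded α _ := by
    obtain ⟨c, hc⟩ := (isCompact_closedBall (0 : E d) R).exists_bound_of_continuousOn
      (multiDeriv_contDiff α hu).continuous.continuousOn
    exact ⟨c, fun x hx => hc x (Metric.ball_subset_closedBall hx)⟩

/-- The Sobolev inequality for the `C_b`-norm of a smooth function. -/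
theorem exists_cbNorm_sq_le (hd : 1 ≤ d) (M : ℕ) : ∃ c : ℝ≥0, ∀ R : ℝ, 1 ≤ R → d / 2 + 1 < M →
    ∀ u : E d → ℝ, ContDiff ℝ ∞ u →
      cbNorm (Metric.ball 0 R) (M - (d / 2 + 1)) u ^ 2 ≤
        c * ENNReal.ofReal (R ^ (2 * (M : ℝ) - d)) *
          ∑ α ∈ multiIndices d M, ∫⁻ x in Metric.ball (0 : E d) R, ‖multiDeriv α u x‖ₑ ^ 2 := by
  obtain ⟨c, hc⟩ := exists_sobolev_const d hd
  refine ⟨c * (multiIndices d (d / 2 + 1)).card, fun R hR hM u hu => ?_⟩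
  set S : ℝ≥0∞ := ∑ α ∈ multiIndices d M, ∫⁻ x in Metric.ball (0 : E d) R,
    ‖multiDeriv α u x‖ₑ ^ 2 with hS
  have h1 : ∀ α ∈ multiIndices d (M - (d / 2 + 1)), ∀ x ∈ Metric.ball (0 : E d) R,
      ‖multiDeriv α u x‖ₑ ^ 2 ≤ (c * (multiIndices d (d / 2 + 1)).card : ℝ≥0) *
        ENNReal.ofReal (R ^ (2 * (M : ℝ) - d)) * S := by
    intro α hα x hx
    refine (hc R hR _ (multiDeriv_contDiff α hu) x hx).trans ?_
    have h2 : ∑ β ∈ multiIndices d (d / 2 + 1), ∫⁻ y in Metric.ball (0 : E d) R,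
        ‖multiDeriv β (multiDeriv α u) y‖ₑ ^ 2 ≤ (multiIndices d (d / 2 + 1)).card * S := by
      rw [← nsmul_eq_mul]
      refine Finset.sum_le_card_nsmul _ _ _ fun β hβ => ?_
      rw [multiDeriv_multiDeriv α β hu]
      refine Finset.single_le_sum (f := fun γ => ∫⁻ y in Metric.ball (0 : E d) R,
        ‖multiDeriv γ u y‖ₑ ^ 2) (fun _ _ => zero_le) ?_
      rw [mem_multiIndices] at hα hβ ⊢
      rw [length_add]
      omega
    -- Sobolev's inequality gives the smaller exponent `2j - d`; it is enlarged to `2M - d` using `R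
    -- ≥ 1`.
    have h3 : R ^ (2 * ((d / 2 + 1 : ℕ) : ℝ) - d) ≤ R ^ (2 * (M : ℝ) - d) := by
      refine Real.rpow_le_rpow_of_exponent_le hR ?_
      have : ((d / 2 + 1 : ℕ) : ℝ) ≤ M := by exact_mod_cast hM.le
      linarith
    calc _ ≤ c * ENNReal.ofReal (R ^ (2 * (M : ℝ) - d)) *
          ((multiIndices d (d / 2 + 1)).card * S) := by gcongr
      _ = _ := by push_cast; ring
  refine (pow_le_pow_left' ((iInf_le _ (memCb_ball R _ hu)).trans (iSup₂_le fun α hα =>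
    iSup₂_le fun x hx => le_rpow_half_of_sq_le (h1 α hα x hx))) 2).trans (le_of_eq ?_)
  rw [rpow_half_sq]

end

end GaussCoupling

end

theorem theorem2p2 (d M : ℕ) (hd : 1 ≤ d)
    (b : GaussCoupling.MIdx d → GaussCoupling.MIdx d → ℝ) :
    ∃ A A' : ℝ≥0, 0 < A ∧ 0 < A' ∧
      ∀ K C : GaussCoupling.E d → GaussCoupling.E d → ℝ,
        GaussCoupling.IsCovKernel K → GaussCoupling.IsCovKernel C →
        GaussCoupling.SmoothKernel K → GaussCoupling.SmoothKernel C →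
        (∀ α β x y, |GaussCoupling.mixedDeriv α β K x y| ≤ b α β) →
        ∀ R : ℝ, 1 ≤ R →
          ∃ (Ω : Type) (_ : MeasurableSpace Ω) (P : Measure Ω)
            (X Y : GaussCoupling.E d → Ω → ℝ),
            IsProbabilityMeasure P ∧
            GaussCoupling.IsGaussianCoupling K C R P X Y ∧
            ∫⁻ w, GaussCoupling.sobolevNorm (Metric.ball 0 R) M
                (fun z => X z w - Y z w) ^ 2 ∂P ≤
              A * GaussCoupling.couplingRate K C M R ∧
            (d / 2 + 1 < M →
              ∫⁻ w, GaussCoupling.cbNorm (Metric.ball 0 R) (M - (d / 2 + 1))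
                  (fun z => X z w - Y z w) ^ 2 ∂P ≤
                A' * ENNReal.ofReal (R ^ (2 * (M : ℝ) - d)) *
                  GaussCoupling.couplingRate K C M R) := by
  obtain ⟨A, hA, hfeat⟩ := GaussCoupling.exists_close_features d M hd b
  obtain ⟨c, hc⟩ := GaussCoupling.exists_cbNorm_sq_le hd M
  -- The summand 1 only ensures positivity, as `c` is not known to be nonzero.
  refine ⟨A, c * A + 1, hA, by positivity, fun K C hK hC hKs hCs hb R hR => ?_⟩
  obtain ⟨H, _, _, _, φ, ψ, hφ, hψ, hφK, hψC, hφψ⟩ := hfeat K C hK hC hKs hCs hb R hR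
  obtain ⟨X, Y, hXm, hYm, hXs, hYs, hG, hX0, hY0, hXc, hYc, hXY⟩ :=
    GaussCoupling.exists_gaussian_field hd hφ hψ
  have henergy := (hXY (GaussCoupling.multiIndices d M) (Metric.ball 0 R)).trans hφψ
  have hs : ∀ w, ContDiff ℝ ∞ fun z => X z w - Y z w := fun w => (hXs w).sub (hYs w)
  refine ⟨ℕ → ℝ, inferInstance, GaussCoupling.gaussSeq, X, Y, inferInstance,
    ⟨fun z _ => hXm z, fun z _ => hYm z, fun w => (hXs w).contDiffOn,
      fun w => (hYs w).contDiffOn, hG _, fun z _ => hX0 z, fun z _ => hY0 z,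
      fun x hx y hy => (hXc x y).trans (hφK x hx y hy),
      fun x hx y hy => (hYc x y).trans (hψC x hx y hy)⟩,
    (lintegral_mono fun w => GaussCoupling.sobolevNorm_sq_le _ M (hs w)).trans henergy,
    fun hM => ?_⟩
  refine (lintegral_mono fun w => hc R hR hM _ (hs w)).trans ?_
  rw [lintegral_const_mul' _ _ (ENNReal.mul_ne_top ENNReal.coe_ne_top ENNReal.ofReal_ne_top)]
  calc _ ≤ c * ENNReal.ofReal (R ^ (2 * (M : ℝ) - d)) *
        (A * GaussCoupling.couplingRate K C M R) := by gcongr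
    _ = (c * A : ℝ≥0) * ENNReal.ofReal (R ^ (2 * (M : ℝ) - d)) *
        GaussCoupling.couplingRate K C M R := by push_cast; ring
    _ ≤ _ := by
        gcongr
        exact le_self_add
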